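/- **Setting.** Let $d\ge 1$, $k\ge 0$, and let $\mathcal B\subset\mathbb R^d$ be a bounded polyhedral open set whose boundary has finite $\mathcal H^{d-1}$ measure, with a finite triangulation $\mathcal T$ of $\overline{\mathcal B}$ into $d$-simplices; $a\in\mathcal T$ also denotes the nodes (vertices). For each node let $\mathcal N_a$ be a continuous function on $\overline{\mathcal B}$, affine on each simplex, such that $\{\mathcal N_a\}_a$ is orthonormal in $L^2(\mathcal B)$. Let $m_a>0$ be nodal masses and $\eta>0$. Nodal values $(u_a)_a\in(\mathbb R^d)^{\mathcal T}\cong\mathbb R^D$, $(\nu_a)_a\in(\mathbb R^k)^{\mathcal T}\cong\mathbb R^M$ are identified with the fields $u(x)=\sum_a\mathcal N_a(x)u_a$, $\nu(x)=\sum_a\mathcal N_a(x)\nu_a$; the same identification is used for $\dot\nu$. Assume: * (A1) $e:\mathbb R^{d\times d}\times\mathbb R^k\times\mathbb R^{k\times d}\to[0,\infty)$, $e=e(F,\nu,N)$, is a continuous quadratic form with $\lambda(|F|^2+|\nu|^2+|N|^2)\le e\le\Lambda(|F|^2+|\nu|^2+|N|^2)$ for some $\lambda,\Lambda>0$. * (A2)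 $w\in C^1(\mathbb R^d\times\mathbb R^k,[0,\infty))$ and $|\nabla w(u,\nu)|\le\Xi_1(1+|u|+|\nu|)$ for some $\Xi_1>0$. * (A3) $\partial\mathcal B_t,\partial\mathcal B_\nu\subseteq\partial\mathcal B$ are closed, $\mathsf t\in L^2(\partial\mathcal B,\mathcal H^{d-1};\mathbb R^d)$, and $\partial\mathcal B_u:=\overline{\partial\mathcal B\setminus\partial\mathcal B_t}$. * (A4) $\chi\in C^2(\mathbb R^k\times\mathbb R^k,[0,\infty))$, $\chi=\chi(\nu,\dot\nu)$, and $|\nabla^2\chi|\le\Xi$ for some $\Xi>0$. * (A5) $\partial^2_{\dot\nu\dot\nu}\chi(\nu,\zeta)\cdot(\xi\otimes\xi)\ge\gamma|\xi|^2$ for all $\nu,\zeta,\xi\in\mathbb R^k$, for some $\gamma>0$. A nodal state $(u,\nu)$ is called *admissible* if $u_a=0$ for every node $a\in\partial\mathcal B_u$ and $\nu_a=0$ for every node $a\in\partial\mathcal B_\nu$. Put $$V(u,\nu)=\int_{\mathcal B}\big(e(\nabla u,\nu,\nabla\nu)+w(u,\nu)\big)\,dx-\int_{\partial\mathcal B_t}\mathsf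 t\cdot u\,d\mathcal H^{d-1}.$$ Let $I=(t_0,t_f)$ be a bounded interval, $t_0<t_f$. For a time set $\Theta=\{t_0<t_1<\dots<t_N=t_f\}$ let $T_\Theta=\max_i(t_{i+1}-t_i)$ and $\tau'_\Theta=T_\Theta/\min_i(t_{i+1}-t_i)$. Let $\mathcal Y_\Theta$ be the space of continuous maps $(u,\nu):\overline I\to\mathbb R^{D}\times\mathbb R^{M}$ that are affine on each $[t_i,t_{i+1}]$ and have admissible values; $(\dot u,\dot\nu)$ is their piecewise constant derivative, $(\dot u,\dot\nu)(t_i)$ denoting its value on $[t_i,t_{i+1})$. For $(u,\nu)\in\mathcal Y_\Theta$ let $$\mathcal A_\Theta(u,\nu)=\sum_{i=0}^{N-1}(t_{i+1}-t_i)\Big(\sum_a\frac{m_a}{2}|\dot u_a(t_i)|^2+\int_{\mathcal B}\chi\big(\nu(x,t_i),\dot\nu(x,t_i)\big)\,dx-V\big((u,\nu)(t_i)\big)\Big),$$ $$\mathcal D_\Theta(\dot\nu)[\phi]=\eta\sum_a\sum_{i=1}^{N}(\nu_a(t_i)-\nu_a(t_{i-1}))\cdot\phi_a(t_{i-1}).$$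 A *discrete solution* is a $(u,\nu)\in\mathcal Y_\Theta$ such that $\delta\mathcal A_\Theta(u,\nu)[\varphi,\phi]+\mathcal D_\Theta(\dot\nu)[\phi]=0$ for all $(\varphi,\phi)\in\mathcal Y_\Theta$ vanishing at $t_0$ and $t_f$, where $\delta\mathcal A_\Theta$ denotes the first variation. **Theorem.** Assume (A1)–(A5). Let $(\Theta_h)_{h\in\mathbb N}$ be time sets for $I$ with $T_{\Theta_h}\to0$, and let $(u_h(t_0),\nu_h(t_0))$, $(\dot u_h(t_0),\dot\nu_h(t_0))$ be admissible initial data with $$\sup_h\big(\tau'_{\Theta_h}+|u_h(t_0)|+|\nu_h(t_0)|+|\dot u_h(t_0)|+|\dot\nu_h(t_0)|\big)<\infty.$$ Then for all sufficiently large $h$ there is a unique discrete solution $(u_h,\nu_h)$ relative to $\Theta_h$ with these initial data. Moreover there is $(u,\nu)\in W^{2,\infty}(I,\mathbb R^{D}\times\mathbb R^{M})$, with admissible values, such that, for every node $a\notin\partial\mathcal B_u$ and every $\varphi_a\in H^1_0(I,\mathbb R^d)$, $$\int_I m_a\dot u_a\cdot\dot\varphi_a\,dt=\int_I\Big(\int_{\mathcal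 B}\partial_Fe(\nabla u,\nu,\nabla\nu)\nabla\mathcal N_a\,dx+\int_{\mathcal B}\partial_uw(u,\nu)\mathcal N_a\,dx-\int_{\partial\mathcal B_t}\mathsf t\,\mathcal N_a\,d\mathcal H^{d-1}\Big)\cdot\varphi_a\,dt,$$ and, for every node $a\notin\partial\mathcal B_\nu$ and every $\phi_a\in H^1_0(I,\mathbb R^k)$, $$\int_I\Big(\int_{\mathcal B}\partial_{\dot\nu}\chi(\nu,\dot\nu)\mathcal N_a\,dx\Big)\cdot\dot\phi_a\,dt+\int_I\Big(\int_{\mathcal B}\partial_\nu\chi(\nu,\dot\nu)\mathcal N_a\,dx\Big)\cdot\phi_a\,dt+\eta\int_I\dot\nu_a\cdot\phi_a\,dt$$ $$=\int_I\Big(\int_{\mathcal B}\partial_Ne(\nabla u,\nu,\nabla\nu)\nabla\mathcal N_a\,dx+\int_{\mathcal B}\big(\partial_\nu e(\nabla u,\nu,\nabla\nu)+\partial_\nu w(u,\nu)\big)\mathcal N_a\,dx\Big)\cdot\phi_a\,dt,$$ and such that, along a subsequence, $(u_h,\nu_h)\to(u,\nu)$ uniformly on $\overline I$ and $(\dot u_h,\dot\nu_h)\to(\dot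 u,\dot\nu)$ in $L^p(I,\mathbb R^{D}\times\mathbb R^{M})$ for every $p\in[1,\infty)$. -/

import Mathlib

open MeasureTheory Set Filter Topology
open scoped ENNReal ContDiff

noncomputable section

namespace ComplexBody

/-! ### Spatial setting -/

/-- Euclidean space of dimension `n`. -/
abbrev Vec (n : ℕ) := EuclideanSpace ℝ (Fin n)

/-- Spatial gradients of `ℝⁿ`-valued fields on `ℝᵈ`. -/
abbrev Grad (d n : ℕ) := Vec d →L[ℝ] Vec n

/-- The square of the Euclidean (Frobenius) norm of a gradient. -/
def frobSq {d n : ℕ} (L : Grad d n) : ℝ :=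
  ∑ i : Fin d, ‖L (EuclideanSpace.single i 1)‖ ^ 2

/-- A triangulation of a polyhedral body in `ℝᵈ`: a finite geometric simplicial complex, all of
whose faces are faces of `d`-dimensional elements. -/
structure Triangulation (d : ℕ) extends Geometry.SimplicialComplex ℝ (Vec d) where
  finite_faces : faces.Finite
  pure : ∀ s ∈ faces, ∃ r ∈ faces, s ⊆ r ∧ r.card = d + 1

namespace Triangulation

variable {d : ℕ} (T : Triangulation d)

/-- The nodes are the vertices of the elements. -/
abbrev Node := {a : Vec d // {a} ∈ T.faces}

instance instFiniteNode : Finite T.Node :=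
  (T.finite_faces.preimage Finset.singleton_injective.injOn).to_subtype

instance instFintypeNode : Fintype T.Node := Fintype.ofFinite _

/-- The polyhedral (open) domain occupied by the body. -/
def domain : Set (Vec d) := interior T.toSimplicialComplex.space

/-- `PA(T)`: continuous functions on the closed body which are affine on each element. -/
def PiecewiseAffine (f : Vec d → ℝ) : Prop :=
  ContinuousOn f T.toSimplicialComplex.space ∧
    ∀ s ∈ T.faces, ∃ g : Vec d →ᵃ[ℝ] ℝ, EqOn f g (convexHull ℝ (s : Set (Vec d)))

end Triangulation

/-- The data of a space-discretized complex body in `ℝᵈ` with morphological descriptors in `ℝᵏ`. -/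
structure Body (d k : ℕ) where
  /-- the triangulation -/
  mesh : Triangulation d
  /-- the shape functions, one for each node -/
  shape : mesh.Node → Vec d → ℝ
  /-- the nodal masses -/
  mass : mesh.Node → ℝ
  /-- the dissipation coefficient -/
  eta : ℝ
  /-- the elastic energy density, a function of (displacement gradient, descriptor, descriptor
  gradient) -/
  e : Grad d d × Vec k × Grad d k → ℝ
  /-- the potential of external actions, a function of (displacement, descriptor) -/
  w : Vec d × Vec k → ℝ
  /-- the substructural kinetic co-energy, a function of (descriptor, rate of the descriptor) -/
  chi : Vec k × Vec k → ℝ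
  /-- the part of the boundary where the traction is applied -/
  tractionSet : Set (Vec d)
  /-- the part of the boundary where the descriptor is prescribed -/
  descriptorSet : Set (Vec d)
  /-- the traction -/
  traction : Vec d → Vec d

namespace Body

variable {d k : ℕ} (B : Body d k)

/-- The body as an open subset of `ℝᵈ`. -/
abbrev domain : Set (Vec d) := B.mesh.domain

abbrev Node := B.mesh.Node

/-- The surface measure `𝓗^{d-1}` on the boundary of the body. -/
def surface : Measure (Vec d) :=
  (Measure.euclideanHausdorffMeasure (d - 1) : Measure (Vec d)).restrict (frontier B.domain)

/-- The part of the boundary where the displacement vanishes. -/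
def displacementSet : Set (Vec d) := closure (frontier B.domain \ B.tractionSet)

/-- The standing conventions: the boundary has finite area, the shape functions are in `PA(T)` and
orthonormal in `L²` of the body, nodal masses and dissipation coefficient are positive. -/
structure Standing : Prop where
  boundary_finite : B.surface univ < ⊤
  shape_pa : ∀ a, B.mesh.PiecewiseAffine (B.shape a)
  shape_orthonormal : ∀ a b, ∫ x in B.domain, B.shape a x * B.shape b x =
    if (a : Vec d) = (b : Vec d) then 1 else 0
  mass_pos : ∀ a, 0 < B.mass a
  eta_pos : 0 < B.eta

/-- The elastic energy density is a continuous and coercive quadratic form. -/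
def A1 : Prop :=
  Continuous B.e ∧
  (∃ Q : QuadraticForm ℝ (Grad d d × Vec k × Grad d k), ∀ z, B.e z = Q z) ∧
  ∃ lam Lam : ℝ, 0 < lam ∧ 0 < Lam ∧ ∀ (U : Grad d d) (n : Vec k) (N : Grad d k),
    lam * (frobSq U + ‖n‖ ^ 2 + frobSq N) ≤ B.e (U, n, N) ∧
    B.e (U, n, N) ≤ Lam * (frobSq U + ‖n‖ ^ 2 + frobSq N)

/-- The potential of external actions is nonnegative, `C¹`, of quadratic growth. -/
def A2 : Prop :=
  ContDiff ℝ 1 B.w ∧ (∀ z, 0 ≤ B.w z) ∧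
  ∃ Xi₁ : ℝ, 0 < Xi₁ ∧ ∀ (u : Vec d) (n : Vec k),
    ‖fderiv ℝ B.w (u, n)‖ ≤ Xi₁ * (1 + ‖u‖ + ‖n‖)

/-- Boundary data: an `L²` traction, and closed parts of the boundary. -/
def A3 : Prop :=
  MemLp B.traction 2 B.surface ∧
  IsClosed B.tractionSet ∧ B.tractionSet ⊆ frontier B.domain ∧
  IsClosed B.descriptorSet ∧ B.descriptorSet ⊆ frontier B.domain

/-- The co-energy is nonnegative and `C²` with bounded Hessian. -/
def A4 : Prop :=
  ContDiff ℝ 2 B.chi ∧ (∀ z, 0 ≤ B.chi z) ∧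
  ∃ Xi : ℝ, 0 < Xi ∧ ∀ z, ‖fderiv ℝ (fderiv ℝ B.chi) z‖ ≤ Xi

/-- The co-energy is uniformly convex in the rate. -/
def A5 : Prop :=
  ∃ gam : ℝ, 0 < gam ∧ ∀ n ζ ξ : Vec k,
    gam * ‖ξ‖ ^ 2 ≤ fderiv ℝ (fderiv ℝ (fun z => B.chi (n, z))) ζ ξ ξ

/-! ### Nodal states, fields, potential energy -/

/-- Nodal values of displacement and descriptor, that is `ℝᴰ × ℝᴹ`. -/
abbrev State := (B.Node → Vec d) × (B.Node → Vec k)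

/-- The homogeneous boundary conditions at the nodes. -/
def Admissible (s : B.State) : Prop :=
  (∀ a : B.Node, (a : Vec d) ∈ B.displacementSet → s.1 a = 0) ∧
  (∀ a : B.Node, (a : Vec d) ∈ B.descriptorSet → s.2 a = 0)

/-- The field on the body with given nodal values. -/
def field {n : ℕ} (c : B.Node → Vec n) (x : Vec d) : Vec n := ∑ a, B.shape a x • c a

/-- The spatial gradient of the field with given nodal values. -/
def grad {n : ℕ} (c : B.Node → Vec n) (x : Vec d) : Grad d n := fderiv ℝ (B.field c) x

/-- The strain variables `(∇u, ν, ∇ν)` at the point `x`. -/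
def strain (s : B.State) (x : Vec d) : Grad d d × Vec k × Grad d k :=
  (B.grad s.1 x, B.field s.2 x, B.grad s.2 x)

/-- The potential energy of a nodal state. -/
def potential (s : B.State) : ℝ :=
  (∫ x in B.domain, (B.e (B.strain s x) + B.w (B.field s.1 x, B.field s.2 x)))
    - ∫ x in B.tractionSet, inner ℝ (B.traction x) (B.field s.1 x) ∂B.surface

/-! Partial derivatives of the densities. -/

def deF (z : Grad d d × Vec k × Grad d k) : Grad d d →L[ℝ] ℝ :=
  fderiv ℝ (fun F => B.e (F, z.2.1, z.2.2)) z.1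

def deNu (z : Grad d d × Vec k × Grad d k) : Vec k →L[ℝ] ℝ :=
  fderiv ℝ (fun n => B.e (z.1, n, z.2.2)) z.2.1

def deN (z : Grad d d × Vec k × Grad d k) : Grad d k →L[ℝ] ℝ :=
  fderiv ℝ (fun N => B.e (z.1, z.2.1, N)) z.2.2

def dwU (u : Vec d) (n : Vec k) : Vec d →L[ℝ] ℝ := fderiv ℝ (fun y => B.w (y, n)) u

def dwNu (u : Vec d) (n : Vec k) : Vec k →L[ℝ] ℝ := fderiv ℝ (fun y => B.w (u, y)) n

def dchiNu (n ζ : Vec k) : Vec k →L[ℝ] ℝ := fderiv ℝ (fun y => B.chi (y, ζ)) n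

def dchiRate (n ζ : Vec k) : Vec k →L[ℝ] ℝ := fderiv ℝ (fun z => B.chi (n, z)) ζ

/-- `ξ ⊗ ∇N_a`, so that `(A ∇N_a) · ξ = A · (ξ ⊗ ∇N_a)` for every matrix `A`. -/
def tensorShape {n : ℕ} (a : B.Node) (ξ : Vec n) (x : Vec d) : Grad d n :=
  (fderiv ℝ (B.shape a) x).smulRight ξ

/-- `(∫_B ∂_F e(∇u,ν,∇ν) ∇N_a dx + ∫_B ∂_u w(u,ν) N_a dx - ∫_{∂B_t} t N_a d𝓗^{d-1}) · ξ`. -/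
def loadU (a : B.Node) (s : B.State) (ξ : Vec d) : ℝ :=
  (∫ x in B.domain, B.deF (B.strain s x) (B.tensorShape a ξ x))
  + (∫ x in B.domain, B.dwU (B.field s.1 x) (B.field s.2 x) (B.shape a x • ξ))
  - ∫ x in B.tractionSet, inner ℝ (B.shape a x • B.traction x) ξ ∂B.surface

/-- `(∫_B ∂_N e(∇u,ν,∇ν) ∇N_a dx + ∫_B (∂_ν e(∇u,ν,∇ν) + ∂_ν w(u,ν)) N_a dx) · ξ`. -/
def loadNu (a : B.Node) (s : B.State) (ξ : Vec k) : ℝ :=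
  (∫ x in B.domain, B.deN (B.strain s x) (B.tensorShape a ξ x))
  + ∫ x in B.domain, (B.deNu (B.strain s x) (B.shape a x • ξ)
      + B.dwNu (B.field s.1 x) (B.field s.2 x) (B.shape a x • ξ))

end Body

/-! ### Sobolev spaces on an interval -/

section Sobolev

variable {F : Type*} [NormedAddCommGroup F] [NormedSpace ℝ F]

/-- `g` is the weak derivative of `f` on `(t₀, t_f)`. -/
def IsWeakDeriv (t₀ tf : ℝ) (f g : ℝ → F) : Prop :=
  ∀ ψ : ℝ → ℝ, ContDiff ℝ ∞ ψ → HasCompactSupport ψ → tsupport ψ ⊆ Ioo t₀ tf →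
    ∫ t in Ioo t₀ tf, deriv ψ t • f t = - ∫ t in Ioo t₀ tf, ψ t • g t

/-- `f ∈ W^{2,∞}(t₀, t_f)` with first weak derivative `f'`. -/
def MemW2Inf (t₀ tf : ℝ) (f f' : ℝ → F) : Prop :=
  MemLp f ⊤ (volume.restrict (Ioo t₀ tf)) ∧ MemLp f' ⊤ (volume.restrict (Ioo t₀ tf)) ∧
  IsWeakDeriv t₀ tf f f' ∧
  ∃ f'' : ℝ → F, MemLp f'' ⊤ (volume.restrict (Ioo t₀ tf)) ∧ IsWeakDeriv t₀ tf f' f''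

/-- `f ∈ H¹₀(t₀, t_f)` with weak derivative `f'`: the pair `(f, f')` is a limit in `L² × L²` of pairs
`(ψ, ψ')` with `ψ` smooth and compactly supported in the interval. -/
def MemH10 (t₀ tf : ℝ) (f f' : ℝ → F) : Prop :=
  MemLp f 2 (volume.restrict (Ioo t₀ tf)) ∧ MemLp f' 2 (volume.restrict (Ioo t₀ tf)) ∧
  ∃ ψ : ℕ → ℝ → F,
    (∀ j, ContDiff ℝ ∞ (ψ j) ∧ HasCompactSupport (ψ j) ∧ tsupport (ψ j) ⊆ Ioo t₀ tf) ∧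
    Tendsto (fun j => eLpNorm (fun t => ψ j t - f t) 2 (volume.restrict (Ioo t₀ tf)))
      atTop (𝓝 0) ∧
    Tendsto (fun j => eLpNorm (fun t => deriv (ψ j) t - f' t) 2 (volume.restrict (Ioo t₀ tf)))
      atTop (𝓝 0)

end Sobolev

/-- Semi-discrete equations for a trajectory `p = (u, ν)` of nodal states with (weak) time derivative
`v`, together with the homogeneous boundary conditions. -/
def Body.SemiDiscreteSolution {d k : ℕ} (B : Body d k) (t₀ tf : ℝ) (p v : ℝ → B.State) : Prop :=
  (∀ t ∈ Icc t₀ tf, B.Admissible (p t)) ∧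
  (∀ a : B.Node, (a : Vec d) ∉ B.displacementSet → ∀ φ φ' : ℝ → Vec d, MemH10 t₀ tf φ φ' →
    ∫ t in Ioo t₀ tf, B.mass a * inner ℝ ((v t).1 a) (φ' t) =
      ∫ t in Ioo t₀ tf, B.loadU a (p t) (φ t)) ∧
  (∀ a : B.Node, (a : Vec d) ∉ B.descriptorSet → ∀ φ φ' : ℝ → Vec k, MemH10 t₀ tf φ φ' →
    (∫ t in Ioo t₀ tf, ∫ x in B.domain,
        B.dchiRate (B.field (p t).2 x) (B.field (v t).2 x) (B.shape a x • φ' t))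
    + (∫ t in Ioo t₀ tf, ∫ x in B.domain,
        B.dchiNu (B.field (p t).2 x) (B.field (v t).2 x) (B.shape a x • φ t))
    + B.eta * (∫ t in Ioo t₀ tf, inner ℝ ((v t).2 a) (φ t)) =
      ∫ t in Ioo t₀ tf, B.loadNu a (p t) (φ t))

/-! ### Time discretization -/

/-- A time set `t₀ = t 0 < t 1 < ... < t N = t_f` (the values `t i` with `i > N` play no role). -/
structure TimeSet (t₀ tf : ℝ) where
  N : ℕ
  t : ℕ → ℝ
  strictMono : StrictMonoOn t (Iic N)
  t_zero : t 0 = t₀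
  t_last : t N = tf

namespace TimeSet

variable {t₀ tf : ℝ} (Θ : TimeSet t₀ tf)

/-- The `i`-th time step. -/
def step (i : ℕ) : ℝ := Θ.t (i + 1) - Θ.t i

/-- The largest time step. -/
def size : ℝ := ⨆ i : Fin Θ.N, Θ.step i

/-- The ratio of the largest and the smallest time step. -/
def ratio : ℝ := (⨆ i : Fin Θ.N, Θ.step i) / (⨅ i : Fin Θ.N, Θ.step i)

/-- The slope of `f` on the `i`-th time interval. -/
def rate {F : Type*} [AddCommGroup F] [Module ℝ F] (f : ℝ → F) (i : ℕ) : F :=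
  (Θ.step i)⁻¹ • (f (Θ.t (i + 1)) - f (Θ.t i))

/-- The piecewise constant velocity: the slope `rate f i` on `[t i, t (i+1))`. -/
def velocity {F : Type*} [AddCommGroup F] [Module ℝ F] (f : ℝ → F) (t : ℝ) : F :=
  ∑ i ∈ Finset.range Θ.N, (Ico (Θ.t i) (Θ.t (i + 1))).indicator (fun _ => Θ.rate f i) t

end TimeSet

namespace Body

variable {d k : ℕ} (B : Body d k) {t₀ tf : ℝ} (Θ : TimeSet t₀ tf)

/-- The space `Y_Θ` of continuous trajectories on `[t₀, t_f]`, affine on each time interval, subject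
to the homogeneous boundary conditions. -/
def InY (p : ℝ → B.State) : Prop :=
  (∀ i < Θ.N, ∀ t ∈ Icc (Θ.t i) (Θ.t (i + 1)), p t = p (Θ.t i) + (t - Θ.t i) • Θ.rate p i) ∧
  ∀ t ∈ Icc t₀ tf, B.Admissible (p t)

/-- The discrete action sum. -/
def action (p : ℝ → B.State) : ℝ :=
  ∑ i ∈ Finset.range Θ.N, Θ.step i *
    ((∑ a, B.mass a / 2 * ‖(Θ.rate p i).1 a‖ ^ 2)
      + (∫ x in B.domain, B.chi (B.field (p (Θ.t i)).2 x, B.field (Θ.rate p i).2 x))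
      - B.potential (p (Θ.t i)))

/-- The discrete dissipation of `p` against the test function `q`. -/
def dissipation (p q : ℝ → B.State) : ℝ :=
  B.eta * ∑ a, ∑ i ∈ Finset.range Θ.N,
    inner ℝ ((p (Θ.t (i + 1))).2 a - (p (Θ.t i)).2 a) ((q (Θ.t i)).2 a)

/-- The discrete d'Alembert-Lagrange principle: for all test functions `q` in `Y_Θ` vanishing at the
end points, the first variation of the action at `p` along `q` exists, and its sum with the
dissipation vanishes. -/
def DiscretePrinciple (p : ℝ → B.State) : Prop :=
  ∀ q : ℝ → B.State, B.InY Θ q → q t₀ = 0 → q tf = 0 →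
    ∃ δA : ℝ, HasDerivAt (fun ε : ℝ => B.action Θ (fun t => p t + ε • q t)) δA 0 ∧
      δA + B.dissipation Θ p q = 0

/-- Discrete solutions with initial state `p₀` and initial velocity `v₀`. -/
def DiscreteSolution (p₀ v₀ : B.State) (p : ℝ → B.State) : Prop :=
  B.InY Θ p ∧ B.DiscretePrinciple Θ p ∧ p t₀ = p₀ ∧ Θ.velocity p t₀ = v₀

end Body

end ComplexBody

end

noncomputable section

namespace ComplexBody

/-! ### Strongly monotone maps -/

/-! The discrete principle is a time-stepping scheme for an implicit first-order system. Write `y`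
for a nodal state, `v` for its velocity, `P(y, v)` for the momentum (derivative of the Lagrangian in
`v`) and `Q(y, v)` for the force (derivative in `y`, plus the term in `η`). Testing with hat
functions in time and summing by parts turns the principle into `y (i+1) = y i + h i • v i` and `P
(i+1) - h (i+1) • Q (i+1) = P i`, an identity of functionals on the admissible states
(`discretePrinciple_iff_recurrence`). The new position is explicit, the new velocity implicit.
`ImplicitSystem` retains only the properties of `P` and `Q` that the analysis of this scheme needs.

Solvability: convexity of the co-energy in the rate and positivity of the masses make `P` strongly
monotone in `v`; here orthonormality of the shape functions turns the `L²` norm of a field into the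
Euclidean norm of its nodal values. Since `Q` is Lipschitz in `v`, the map `v ↦ P - h • Q` stays
strongly monotone for small `h`, hence is a bijection onto the dual space (`existsUnique_velocity`).

Bounds: no energy balance is used, so the sign of the `η` term is immaterial. Strong monotonicity
bounds `v`, and then `Q`, linearly by `y` and `P`. Therefore `1 + ‖y‖ + ‖P‖` obeys a discrete
Gronwall inequality, and `y` and `v` both change by a multiple of the time steps from one node to
the next (`exists_bound`).

Limit: the nodal pairs `(y, v)`, seen as step functions of time, are Lipschitz up to an error of the
order of the largest step. An Arzelà–Ascoli argument gives a subsequence converging uniformly to a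
Lipschitz pair `z`, and Riemann sums pass to `y' = v`, `P(z)' = Q(z)` in integrated form
(`ImplicitSystem.exists_limit`). Lipschitz continuity of the position and of the velocity is the
`W^{2,∞}` regularity; pairing the equation with test functions supported at one free node, and using
the density built into `MemH10`, yields the semi-discrete equations. Uniform convergence of the
velocities implies convergence in every `Lʳ`. -/

/-- A Lipschitz and strongly monotone map of a Hilbert space into itself is onto. -/
theorem exists_eq_of_strongly_monotone {H : Type*} [NormedAddCommGroup H] [InnerProductSpace ℝ H]
    [CompleteSpace H] {G : H → H} {c L : ℝ} (hc : 0 < c)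
    (hmono : ∀ v w, c * ‖v - w‖ ^ 2 ≤ inner ℝ (G v - G w) (v - w))
    (hL : ∀ v w, ‖G v - G w‖ ≤ L * ‖v - w‖) (f : H) : ∃ v, G v = f := by
  -- Enlarging the Lipschitz constant to at least `c` makes it positive and keeps the contraction
  -- factor `1 - c² / M²` nonnegative.
  set M : ℝ := max L c with hM
  have hMpos : 0 < M := lt_max_of_lt_right hc
  have hcM : c ≤ M := le_max_right _ _
  have hLM : ∀ v w, ‖G v - G w‖ ≤ M * ‖v - w‖ := fun v w =>
    (hL v w).trans (mul_le_mul_of_nonneg_right (le_max_left _ _) (norm_nonneg _))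
  -- This step size minimizes `1 - 2 s c + s² M²`, the bound for the squared Lipschitz constant of
  -- `v ↦ v - s • (G v - f)`; the minimum is `q`.
  set s : ℝ := c / M ^ 2 with hs
  have hspos : 0 < s := by positivity
  set q : ℝ := 1 - c ^ 2 / M ^ 2 with hq
  have hq0 : 0 ≤ q := by
    rw [hq, sub_nonneg, div_le_one (by positivity)]
    exact pow_le_pow_left₀ hc.le hcM 2
  have hq1 : q < 1 := by
    have : 0 < c ^ 2 / M ^ 2 := by positivity
    linarith
  let T : H → H := fun v => v - s • (G v - f)
  have hT : ∀ v w, ‖T v - T w‖ ≤ Real.sqrt q * ‖v - w‖ := by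
    intro v w
    have e1 : T v - T w = (v - w) - s • (G v - G w) := by
      simp only [T, smul_sub]; abel
    have e2 : ‖T v - T w‖ ^ 2 ≤ q * ‖v - w‖ ^ 2 := by
      rw [e1, norm_sub_sq_real, real_inner_smul_right, real_inner_comm, norm_smul, mul_pow]
      have h1 := hmono v w
      have h2 : ‖G v - G w‖ ^ 2 ≤ M ^ 2 * ‖v - w‖ ^ 2 := by
        rw [← mul_pow]; exact pow_le_pow_left₀ (norm_nonneg _) (hLM v w) 2
      have h3 : ‖s‖ ^ 2 * ‖G v - G w‖ ^ 2 ≤ s ^ 2 * (M ^ 2 * ‖v - w‖ ^ 2) := by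
        rw [Real.norm_eq_abs, sq_abs]
        exact mul_le_mul_of_nonneg_left h2 (sq_nonneg _)
      have h4 : s * (c * ‖v - w‖ ^ 2) ≤ s * inner ℝ (G v - G w) (v - w) :=
        mul_le_mul_of_nonneg_left h1 hspos.le
      have h5 : q * ‖v - w‖ ^ 2
          = ‖v - w‖ ^ 2 - 2 * (s * (c * ‖v - w‖ ^ 2)) + s ^ 2 * (M ^ 2 * ‖v - w‖ ^ 2) := by
        rw [hq, hs]; field_simp; ring
      rw [h5]; linarith
    calc ‖T v - T w‖ = Real.sqrt (‖T v - T w‖ ^ 2) := (Real.sqrt_sq (norm_nonneg _)).symm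
      _ ≤ Real.sqrt (q * ‖v - w‖ ^ 2) := Real.sqrt_le_sqrt e2
      _ = Real.sqrt q * ‖v - w‖ := by rw [Real.sqrt_mul hq0, Real.sqrt_sq (norm_nonneg _)]
  have hcontr : ContractingWith (Real.toNNReal (Real.sqrt q)) T := by
    refine ⟨?_, LipschitzWith.of_dist_le_mul fun v w => ?_⟩
    · rw [← NNReal.coe_lt_coe, Real.coe_toNNReal _ (Real.sqrt_nonneg _), NNReal.coe_one,
        Real.sqrt_lt' one_pos]
      simpa using hq1
    · rw [dist_eq_norm, dist_eq_norm, Real.coe_toNNReal _ (Real.sqrt_nonneg _)]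
      exact hT v w
  refine ⟨hcontr.fixedPoint T, ?_⟩
  have hfix := hcontr.fixedPoint_isFixedPt
  have h6 : s • (G (hcontr.fixedPoint T) - f) = 0 := by
    have h7 : T (hcontr.fixedPoint T) = hcontr.fixedPoint T := hfix
    simpa [T] using h7
  exact sub_eq_zero.1 ((smul_eq_zero.1 h6).resolve_left hspos.ne')

/-- A Lipschitz and strongly monotone map of a finite-dimensional space into its dual is onto. -/
theorem exists_eq_of_strongly_monotone_dual {E : Type*} [NormedAddCommGroup E] [NormedSpace ℝ E]
    [FiniteDimensional ℝ E] {G : E → E →L[ℝ] ℝ} {c L : ℝ} (hc : 0 < c)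
    (hmono : ∀ v w, c * ‖v - w‖ ^ 2 ≤ (G v - G w) (v - w))
    (hL : ∀ v w, ‖G v - G w‖ ≤ L * ‖v - w‖) (f : E →L[ℝ] ℝ) : ∃ v, G v = f := by
  -- The norm of `E` need not be Hilbertian: a linear isomorphism with a Euclidean space and the
  -- Riesz identification there reduce the claim to the Hilbert case.
  let Φ := toEuclidean (E := E)
  let R := InnerProductSpace.toDual ℝ (EuclideanSpace ℝ (Fin (Module.finrank ℝ E)))
  let S : E →L[ℝ] EuclideanSpace ℝ (Fin (Module.finrank ℝ E)) := Φ
  let S' : EuclideanSpace ℝ (Fin (Module.finrank ℝ E)) →L[ℝ] E := Φ.symm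
  let lift : (E →L[ℝ] ℝ) → EuclideanSpace ℝ (Fin (Module.finrank ℝ E)) :=
    fun g => R.symm (g.comp S')
  have hlift : ∀ g g', lift g - lift g' = R.symm ((g - g').comp S') := by
    intro g g'
    simp only [lift]
    rw [← map_sub]
    congr 1
  have hS : ∀ x, ‖x‖ ≤ (‖S‖ + 1) * ‖S' x‖ := by
    intro x
    have h1 : S (S' x) = x := Φ.apply_symm_apply x
    calc ‖x‖ = ‖S (S' x)‖ := by rw [h1]
      _ ≤ ‖S‖ * ‖S' x‖ := S.le_opNorm _
      _ ≤ _ := mul_le_mul_of_nonneg_right (by linarith) (norm_nonneg _)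
  -- The change of norm costs the square of `‖S‖ + 1` in the monotonicity constant; the summand 1
  -- excludes division by zero, and `|L|` covers a negative `L`.
  obtain ⟨x, hx⟩ := exists_eq_of_strongly_monotone (G := fun x => lift (G (S' x)))
    (c := c / (‖S‖ + 1) ^ 2) (L := |L| * ‖S'‖ * ‖S'‖) (by positivity) (fun v w => by
      rw [hlift, InnerProductSpace.toDual_symm_apply]
      have h1 := hmono (S' v) (S' w)
      have h2 : ‖v - w‖ ^ 2 ≤ ((‖S‖ + 1) * ‖S' v - S' w‖) ^ 2 := by
        rw [← map_sub]
        exact pow_le_pow_left₀ (norm_nonneg _) (hS _) 2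
      calc c / (‖S‖ + 1) ^ 2 * ‖v - w‖ ^ 2
          ≤ c / (‖S‖ + 1) ^ 2 * ((‖S‖ + 1) * ‖S' v - S' w‖) ^ 2 :=
            mul_le_mul_of_nonneg_left h2 (by positivity)
        _ = c * ‖S' v - S' w‖ ^ 2 := by field_simp
        _ ≤ _ := by simpa using h1) (fun v w => by
      rw [hlift, LinearIsometryEquiv.norm_map]
      calc ‖(G (S' v) - G (S' w)).comp S'‖ ≤ ‖G (S' v) - G (S' w)‖ * ‖S'‖ :=
            ContinuousLinearMap.opNorm_comp_le _ _
        _ ≤ |L| * ‖S' (v - w)‖ * ‖S'‖ := by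
            refine mul_le_mul_of_nonneg_right ?_ (norm_nonneg _)
            rw [map_sub]
            exact (hL _ _).trans (mul_le_mul_of_nonneg_right (le_abs_self _) (norm_nonneg _))
        _ ≤ |L| * (‖S'‖ * ‖v - w‖) * ‖S'‖ := by
            gcongr; exact S'.le_opNorm _
        _ = _ := by ring) (lift f)
  refine ⟨S' x, ?_⟩
  have h1 : (G (S' x)).comp S' = f.comp S' := R.symm.injective hx
  ext y
  have h2 := congrArg (fun g => g (S y)) h1
  simpa [S, S'] using h2

/-! ### Compactness of almost equi-Lipschitz sequences -/

/-- Arzelà–Ascoli for functions that may jump: equicontinuity is only required up to an error `ε n`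
tending to zero, as for step functions on finer and finer time sets. The error disappears in the
limit, which is truly Lipschitz. -/
theorem exists_subseq_tendsto_of_almost_lipschitz {E : Type*} [NormedAddCommGroup E]
    [ProperSpace E] {a b : ℝ} (hab : a ≤ b) {f : ℕ → ℝ → E} {M K : ℝ} {ε : ℕ → ℝ}
    (hε : Tendsto ε atTop (𝓝 0)) (hK : 0 ≤ K)
    (hM : ∀ n, ∀ t ∈ Icc a b, ‖f n t‖ ≤ M)
    (hf : ∀ n, ∀ s ∈ Icc a b, ∀ t ∈ Icc a b, ‖f n s - f n t‖ ≤ K * |s - t| + ε n) :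
    ∃ (g : ℝ → E) (σ : ℕ → ℕ), StrictMono σ ∧ LipschitzWith K.toNNReal g ∧
      TendstoUniformlyOn (fun n => f (σ n)) g atTop (Icc a b) := by
  let D : ℕ → ℝ := fun m => projIcc a b hab (TopologicalSpace.denseSeq ℝ m)
  have hD : ∀ m, D m ∈ Icc a b := fun m => (projIcc a b hab _).2
  have hdense : ∀ t ∈ Icc a b, ∀ δ > 0, ∃ m, |t - D m| < δ := by
    intro t ht δ hδ
    obtain ⟨m, hm⟩ := (TopologicalSpace.denseRange_denseSeq ℝ).exists_dist_lt t hδ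
    refine ⟨m, lt_of_le_of_lt ?_ hm⟩
    have h1 : (projIcc a b hab t : ℝ) = t := by rw [projIcc_of_mem hab ht]
    have h2 := abs_projIcc_sub_projIcc hab (c := t) (d := TopologicalSpace.denseSeq ℝ m)
    rw [h1] at h2
    exact h2
  -- Sequential compactness of the countable product of balls replaces a diagonal extraction: one
  -- subsequence converges at all points `D m`.
  obtain ⟨G, -, σ, hσ, hG⟩ :=
    (isCompact_univ_pi fun _ : ℕ => isCompact_closedBall (0 : E) M).tendsto_subseq
      (x := fun n m => f n (D m)) (fun n m _ => by simpa using hM n _ (hD m))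
  rw [tendsto_pi_nhds] at hG
  have hεσ : Tendsto (fun n => ε (σ n)) atTop (𝓝 0) := hε.comp hσ.tendsto_atTop
  have hcauchy : UniformCauchySeqOn (fun n => f (σ n)) atTop (Icc a b) := by
    rw [Metric.uniformCauchySeqOn_iff]
    intro r hr
    obtain ⟨δ, hδ, hKδ⟩ : ∃ δ > 0, K * δ < r / 8 :=
      ⟨r / 8 / (K + 1), by positivity, by
        rw [mul_div_assoc', div_lt_iff₀ (by linarith)]; nlinarith⟩
    -- Finitely many points `D m` are `δ`-dense in the interval, so convergence at them, the
    -- Lipschitz bound and small `ε` give a uniform Cauchy estimate.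
    obtain ⟨F, hF⟩ := isCompact_Icc.elim_finite_subcover (fun m => Metric.ball (D m) δ)
      (fun m => Metric.isOpen_ball) (fun t ht => by
        obtain ⟨m, hm⟩ := hdense t ht δ hδ
        exact mem_iUnion.2 ⟨m, by simpa [Real.dist_eq] using hm⟩)
    have hev : ∀ᶠ n in atTop, (∀ m ∈ F, dist (f (σ n) (D m)) (G m) < r / 8) ∧ ε (σ n) < r / 8 := by
      refine Filter.Eventually.and ?_ (hεσ.eventually_lt_const (by linarith))
      rw [eventually_all_finset]
      intro m _
      exact (Metric.tendsto_nhds.1 (hG m)) _ (by linarith)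
    obtain ⟨n₀, hn₀⟩ := eventually_atTop.1 hev
    have key : ∀ n ≥ n₀, ∀ m ∈ F, ∀ t ∈ Icc a b, |t - D m| < δ →
        dist (f (σ n) t) (G m) < 3 * (r / 8) := by
      intro n hn m hm t ht htm
      have h1 := hf (σ n) t ht (D m) (hD m)
      have h2 := (hn₀ n hn).1 m hm
      have h3 := (hn₀ n hn).2
      rw [← dist_eq_norm] at h1
      have h4 : K * |t - D m| ≤ K * δ := mul_le_mul_of_nonneg_left htm.le hK
      linarith [dist_triangle (f (σ n) t) (f (σ n) (D m)) (G m)]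
    refine ⟨n₀, fun m hm n hn t ht => ?_⟩
    obtain ⟨l, hl, htl⟩ := mem_iUnion₂.1 (hF ht)
    rw [Metric.mem_ball, Real.dist_eq] at htl
    have h1 := key m hm l hl t ht htl
    have h2 := key n hn l hl t ht htl
    linarith [dist_triangle_right (f (σ m) t) (f (σ n) t) (G l)]
  have hlim : ∀ t ∈ Icc a b, ∃ x, Tendsto (fun n => f (σ n) t) atTop (𝓝 x) := fun t ht =>
    cauchySeq_tendsto_of_complete (hcauchy.cauchySeq ht)
  choose! g hg using hlim
  -- The limit is extended by constants outside the interval, so that it is Lipschitz on the whole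
  -- line.
  refine ⟨fun t => g (projIcc a b hab t), σ, hσ, ?_, ?_⟩
  · refine LipschitzWith.of_dist_le_mul fun s t => ?_
    rw [Real.coe_toNNReal _ hK, dist_eq_norm, Real.dist_eq]
    have hs := (projIcc a b hab s).2
    have ht := (projIcc a b hab t).2
    have h1 : Tendsto (fun n => K * |(projIcc a b hab s : ℝ) - projIcc a b hab t| + ε (σ n)) atTop
        (𝓝 (K * |(projIcc a b hab s : ℝ) - projIcc a b hab t| + 0)) := hεσ.const_add _
    refine (le_of_tendsto_of_tendsto' ((hg _ hs).sub (hg _ ht)).norm h1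
      fun n => hf (σ n) _ hs _ ht).trans ?_
    rw [add_zero]
    exact mul_le_mul_of_nonneg_left (abs_projIcc_sub_projIcc hab) hK
  · refine hcauchy.tendstoUniformlyOn_of_tendsto fun t ht => ?_
    rw [projIcc_of_mem hab ht]
    exact hg t ht

/-! ### Time sets -/

namespace TimeSet

variable {t₀ tf : ℝ} (Θ : TimeSet t₀ tf)

theorem step_pos {i : ℕ} (hi : i < Θ.N) : 0 < Θ.step i :=
  sub_pos.2 (Θ.strictMono (mem_Iic.2 hi.le) (mem_Iic.2 hi) (Nat.lt_succ_self i))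

theorem t_le_t {i j : ℕ} (hij : i ≤ j) (hj : j ≤ Θ.N) : Θ.t i ≤ Θ.t j :=
  Θ.strictMono.monotoneOn (mem_Iic.2 (hij.trans hj)) (mem_Iic.2 hj) hij

theorem t_mem_Icc {i : ℕ} (hi : i ≤ Θ.N) : Θ.t i ∈ Icc t₀ tf :=
  ⟨Θ.t_zero.symm.trans_le (Θ.t_le_t (Nat.zero_le i) hi),
    (Θ.t_le_t hi le_rfl).trans_eq Θ.t_last⟩

theorem Icc_subset_Icc {i : ℕ} (hi : i < Θ.N) : Icc (Θ.t i) (Θ.t (i + 1)) ⊆ Icc t₀ tf :=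
  Set.Icc_subset_Icc (Θ.t_mem_Icc hi.le).1 (Θ.t_mem_Icc hi).2

theorem t_succ (i : ℕ) : Θ.t (i + 1) = Θ.t i + Θ.step i := by simp [step]

theorem N_pos (h : t₀ < tf) : 0 < Θ.N := by
  rcases Nat.eq_zero_or_pos Θ.N with h0 | h0
  · have h1 := Θ.t_last
    rw [h0, Θ.t_zero] at h1
    exact absurd h1 h.ne
  · exact h0

theorem step_le_size {i : ℕ} (hi : i < Θ.N) : Θ.step i ≤ Θ.size :=
  le_ciSup (f := fun j : Fin Θ.N => Θ.step j) (finite_range _).bddAbove ⟨i, hi⟩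

theorem size_nonneg : 0 ≤ Θ.size := Real.iSup_nonneg fun i => (Θ.step_pos i.2).le

theorem ratio_nonneg : 0 ≤ Θ.ratio :=
  div_nonneg Θ.size_nonneg (Real.iInf_nonneg fun i => (Θ.step_pos i.2).le)

theorem exists_mem_Icc_step (h : t₀ < tf) {t : ℝ} (ht : t ∈ Icc t₀ tf) :
    ∃ i < Θ.N, t ∈ Icc (Θ.t i) (Θ.t (i + 1)) := by
  have key : ∀ n, 0 < n → n ≤ Θ.N → t ≤ Θ.t n → ∃ i < n, t ∈ Icc (Θ.t i) (Θ.t (i + 1)) := by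
    intro n
    induction n with
    | zero => intro h; omega
    | succ n ih =>
      intro _ hn htn
      by_cases h1 : Θ.t n ≤ t
      · exact ⟨n, Nat.lt_succ_self n, h1, htn⟩
      · rcases Nat.eq_zero_or_pos n with h0 | h0
        · subst h0; exact absurd (Θ.t_zero.symm ▸ ht.1) h1
        · obtain ⟨i, hi, hti⟩ := ih h0 (by omega) (not_le.1 h1).le
          exact ⟨i, by omega, hti⟩
  exact key Θ.N (Θ.N_pos h) le_rfl (Θ.t_last.symm ▸ ht.2)

theorem exists_mem_Ico_step {t : ℝ} (ht : t ∈ Ico t₀ tf) :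
    ∃ i < Θ.N, t ∈ Ico (Θ.t i) (Θ.t (i + 1)) := by
  have key : ∀ n, n ≤ Θ.N → t < Θ.t n → ∃ i < n, t ∈ Ico (Θ.t i) (Θ.t (i + 1)) := by
    intro n
    induction n with
    | zero => intro _ h; rw [Θ.t_zero] at h; exact absurd ht.1 (not_le.2 h)
    | succ n ih =>
      intro hn htn
      by_cases h1 : Θ.t n ≤ t
      · exact ⟨n, Nat.lt_succ_self n, h1, htn⟩
      · obtain ⟨i, hi, hti⟩ := ih (by omega) (not_le.1 h1)
        exact ⟨i, by omega, hti⟩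
  exact key Θ.N le_rfl (Θ.t_last.symm ▸ ht.2)

/-- Riemann sums with perturbed values: on each cell the integrand differs from the constant `a i`
by at most `ε`, and the errors add up to `ε` times the elapsed time. -/
theorem norm_sum_sub_integral_le {F : Type*} [NormedAddCommGroup F] [NormedSpace ℝ F]
    [CompleteSpace F] {g : ℝ → F} (hg : Continuous g) {a : ℕ → F} {ε : ℝ}
    (ha : ∀ i < Θ.N, ∀ t ∈ Icc (Θ.t i) (Θ.t (i + 1)), ‖a i - g t‖ ≤ ε) {j : ℕ} (hj : j ≤ Θ.N) :
    ‖∑ i ∈ Finset.range j, Θ.step i • a i - ∫ t in t₀..Θ.t j, g t‖ ≤ ε * (Θ.t j - t₀) := by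
  induction j with
  | zero => simp [Θ.t_zero]
  | succ j ih =>
    have hjN : j < Θ.N := hj
    have h1 := ih hjN.le
    have hstep := Θ.step_pos hjN
    have hle : Θ.t j ≤ Θ.t (j + 1) := Θ.t_le_t (Nat.le_succ j) hj
    rw [Finset.sum_range_succ, ← intervalIntegral.integral_add_adjacent_intervals
      (hg.intervalIntegrable _ _) (hg.intervalIntegrable (Θ.t j) (Θ.t (j + 1)))]
    have h2 : ‖Θ.step j • a j - ∫ t in Θ.t j..Θ.t (j + 1), g t‖ ≤ ε * Θ.step j := by
      have h3 : Θ.step j • a j = ∫ t in Θ.t j..Θ.t (j + 1), a j := by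
        rw [intervalIntegral.integral_const]; rfl
      rw [h3, ← intervalIntegral.integral_sub (by simp) (hg.intervalIntegrable _ _)]
      have h4 := intervalIntegral.norm_integral_le_of_norm_le_const
        (f := fun t => a j - g t) (a := Θ.t j) (b := Θ.t (j + 1)) (C := ε) (fun t ht => by
          rw [uIoc_of_le hle] at ht
          exact ha j hjN t ⟨ht.1.le, ht.2⟩)
      rwa [abs_of_pos (show 0 < Θ.t (j + 1) - Θ.t j from hstep)] at h4
    rw [add_sub_add_comm]
    refine (norm_add_le _ _).trans ((add_le_add h1 h2).trans (le_of_eq ?_))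
    rw [Θ.t_succ]; ring

end TimeSet

/-! ### Discretized implicit evolution systems -/

/-- A system `d/dt P(y, v) = Q(y, v)`, `dy/dt = v`, with momenta `P` strongly monotone in the
velocity and forces `Q` of linear growth. -/
structure ImplicitSystem (E : Type*) [NormedAddCommGroup E] [NormedSpace ℝ E] where
  P : E × E → E →L[ℝ] ℝ
  Q : E × E → E →L[ℝ] ℝ
  c : ℝ
  L : ℝ
  c_pos : 0 < c
  L_nonneg : 0 ≤ L
  monotone_P : ∀ y v w, c * ‖v - w‖ ^ 2 ≤ (P (y, v) - P (y, w)) (v - w)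
  lipschitz_P : ∀ z z', ‖P z - P z'‖ ≤ L * ‖z - z'‖
  continuous_Q : Continuous Q
  growth_Q : ∀ z, ‖Q z‖ ≤ L * (1 + ‖z‖)
  lipschitz_Q : ∀ y v w, ‖Q (y, v) - Q (y, w)‖ ≤ L * ‖v - w‖

namespace ImplicitSystem

variable {E : Type*} [NormedAddCommGroup E] [NormedSpace ℝ E] (S : ImplicitSystem E)

/-- The discrete equations for nodal values `y` and velocities `v`. -/
def IsDiscrete {t₀ tf : ℝ} (Θ : TimeSet t₀ tf) (y v : ℕ → E) : Prop :=
  (∀ i < Θ.N, y (i + 1) = y i + Θ.step i • v i) ∧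
  ∀ i, i + 1 < Θ.N →
    S.P (y (i + 1), v (i + 1)) - Θ.step (i + 1) • S.Q (y (i + 1), v (i + 1)) = S.P (y i, v i)

/-- Strong monotonicity divided by `‖v - w‖`: at a fixed position the velocity is a Lipschitz
function of the momentum. -/
theorem norm_sub_le_momentum (y v w : E) : S.c * ‖v - w‖ ≤ ‖S.P (y, v) - S.P (y, w)‖ := by
  rcases eq_or_ne v w with rfl | h
  · simp
  · have h0 : 0 < ‖v - w‖ := norm_pos_iff.2 (sub_ne_zero.2 h)
    have h1 := (S.monotone_P y v w).trans ((le_abs_self _).trans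
      ((S.P (y, v) - S.P (y, w)).le_opNorm (v - w)))
    refine le_of_mul_le_mul_right ?_ h0
    calc S.c * ‖v - w‖ * ‖v - w‖ = S.c * ‖v - w‖ ^ 2 := by ring
      _ ≤ _ := h1

/-- For small time steps, the implicit equation for the velocity has exactly one solution. -/
theorem existsUnique_velocity [FiniteDimensional ℝ E] {h : ℝ} (h0 : 0 ≤ h) (hc : h * S.L < S.c)
    (y : E) (f : E →L[ℝ] ℝ) : ∃! v, S.P (y, v) - h • S.Q (y, v) = f := by
  -- The implicit force can spoil at most `h * S.L` of the monotonicity constant, which is where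
  -- smallness of the step enters.
  have hmono : ∀ v w, (S.c - h * S.L) * ‖v - w‖ ^ 2 ≤
      ((S.P (y, v) - h • S.Q (y, v)) - (S.P (y, w) - h • S.Q (y, w))) (v - w) := by
    intro v w
    have h1 := S.monotone_P y v w
    have h2 : (S.Q (y, v) - S.Q (y, w)) (v - w) ≤ S.L * ‖v - w‖ ^ 2 := by
      refine (le_abs_self _).trans (((S.Q (y, v) - S.Q (y, w)).le_opNorm (v - w)).trans ?_)
      rw [sq, ← mul_assoc]
      exact mul_le_mul_of_nonneg_right (S.lipschitz_Q y v w) (norm_nonneg _)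
    have h3 : ((S.P (y, v) - h • S.Q (y, v)) - (S.P (y, w) - h • S.Q (y, w))) (v - w)
        = (S.P (y, v) - S.P (y, w)) (v - w) - h * (S.Q (y, v) - S.Q (y, w)) (v - w) := by
      simp only [sub_apply, smul_apply, smul_eq_mul, map_sub]
      ring
    rw [h3]
    have h4 := mul_le_mul_of_nonneg_left h2 h0
    linarith
  have hpos : 0 < S.c - h * S.L := by linarith
  obtain ⟨v, hv⟩ := exists_eq_of_strongly_monotone_dual (L := S.L + h * S.L) hpos hmono
    (fun v w => by
      have h1 := S.lipschitz_P (y, v) (y, w)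
      have h2 := S.lipschitz_Q y v w
      have h3 : ‖((y, v) : E × E) - (y, w)‖ = ‖v - w‖ := by simp [Prod.norm_def]
      rw [h3] at h1
      calc ‖(S.P (y, v) - h • S.Q (y, v)) - (S.P (y, w) - h • S.Q (y, w))‖
          = ‖(S.P (y, v) - S.P (y, w)) - h • (S.Q (y, v) - S.Q (y, w))‖ := by
            rw [smul_sub]; congr 1; abel
        _ ≤ ‖S.P (y, v) - S.P (y, w)‖ + h * ‖S.Q (y, v) - S.Q (y, w)‖ := by
            refine (norm_sub_le _ _).trans (le_of_eq ?_)
            rw [norm_smul, Real.norm_of_nonneg h0]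
        _ ≤ S.L * ‖v - w‖ + h * (S.L * ‖v - w‖) :=
            add_le_add h1 (mul_le_mul_of_nonneg_left h2 h0)
        _ = _ := by ring) f
  refine ⟨v, hv, fun w hw => ?_⟩
  have h1 := hmono w v
  simp only at hv hw
  rw [hw, hv, sub_self, zero_apply] at h1
  have h2 : ‖w - v‖ ^ 2 ≤ 0 := nonpos_of_mul_nonpos_right h1 hpos
  have h3 : ‖w - v‖ = 0 := by nlinarith [norm_nonneg (w - v), sq_nonneg ‖w - v‖]
  exact sub_eq_zero.1 (norm_eq_zero.1 h3)

theorem exists_isDiscrete [FiniteDimensional ℝ E] {t₀ tf : ℝ} (Θ : TimeSet t₀ tf)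
    (hΘ : Θ.size * S.L < S.c) (y₀ v₀ : E) :
    ∃ y v : ℕ → E, S.IsDiscrete Θ y v ∧ y 0 = y₀ ∧ v 0 = v₀ := by
  have hstep : ∀ i < Θ.N, Θ.step i * S.L < S.c := fun i hi =>
    (mul_le_mul_of_nonneg_right (Θ.step_le_size hi) S.L_nonneg).trans_lt hΘ
  -- The velocity is made a total function of the index and the current pair, with the value 0
  -- beyond the last cell, so that the solution is a plain recursion.
  have hex : ∀ (i : ℕ) (z : E × E), ∃ v, i + 1 < Θ.N →
      S.P (z.1 + Θ.step i • z.2, v) - Θ.step (i + 1) • S.Q (z.1 + Θ.step i • z.2, v) = S.P z := by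
    intro i z
    by_cases hi : i + 1 < Θ.N
    · obtain ⟨v, hv, -⟩ := S.existsUnique_velocity (Θ.step_pos hi).le (hstep _ hi)
        (z.1 + Θ.step i • z.2) (S.P z)
      exact ⟨v, fun _ => hv⟩
    · exact ⟨0, fun h => absurd h hi⟩
  choose next hnext using hex
  let z : ℕ → E × E := fun n => Nat.rec (y₀, v₀) (fun i z => (z.1 + Θ.step i • z.2, next i z)) n
  refine ⟨fun i => (z i).1, fun i => (z i).2, ⟨fun i _ => rfl, fun i hi => hnext i (z i) hi⟩,
    rfl, rfl⟩

/-- Induction on the node: equal pairs give equal new positions, and then the implicit equation has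
one velocity. The claim stops before `Θ.N` because the scheme leaves `v Θ.N` free. -/
theorem IsDiscrete.eq [FiniteDimensional ℝ E] {t₀ tf : ℝ} {Θ : TimeSet t₀ tf}
    (hΘ : Θ.size * S.L < S.c) {y v y' v' : ℕ → E} (h : S.IsDiscrete Θ y v)
    (h' : S.IsDiscrete Θ y' v') (hy : y 0 = y' 0) (hv : v 0 = v' 0) {i : ℕ} (hi : i < Θ.N) :
    y i = y' i ∧ v i = v' i := by
  induction i with
  | zero => exact ⟨hy, hv⟩
  | succ i ih =>
    obtain ⟨h1, h2⟩ := ih (by omega)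
    have h3 : y (i + 1) = y' (i + 1) := by
      rw [h.1 i (by omega), h'.1 i (by omega), h1, h2]
    refine ⟨h3, ?_⟩
    have h4 := h.2 i hi
    have h5 := h'.2 i hi
    rw [← h1, ← h2, ← h3] at h5
    exact (S.existsUnique_velocity (Θ.step_pos hi).le
      ((mul_le_mul_of_nonneg_right (Θ.step_le_size hi) S.L_nonneg).trans_lt hΘ) _ _).unique h4 h5

/-- The scheme propagates momenta, not velocities; comparing `P (y, v)` with `P (y, 0)` recovers a
bound on the velocity. -/
theorem norm_velocity_le (y v : E) :
    ‖v‖ ≤ (1 + ‖S.P 0‖ + S.L) / S.c * (1 + ‖y‖ + ‖S.P (y, v)‖) := by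
  have hc := S.c_pos
  have h1 := S.norm_sub_le_momentum y v 0
  rw [sub_zero] at h1
  have h2 := S.lipschitz_P (y, 0) 0
  have h3 : ‖((y, 0) : E × E) - 0‖ = ‖y‖ := by simp [Prod.norm_def]
  rw [h3] at h2
  have h4 : ‖S.P (y, 0)‖ ≤ ‖S.P 0‖ + S.L * ‖y‖ := by
    have := norm_le_insert' (S.P (y, 0)) (S.P 0)
    linarith
  have h5 := norm_sub_le (S.P (y, v)) (S.P (y, 0))
  rw [div_mul_eq_mul_div, le_div_iff₀ hc]
  have h6 := norm_nonneg (S.P 0)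
  have h7 := S.L_nonneg
  have h8 := norm_nonneg y
  have h9 := norm_nonneg (S.P (y, v))
  nlinarith [mul_nonneg h6 h8, mul_nonneg h6 h9, mul_nonneg h7 h9]

theorem norm_force_le (y v : E) :
    ‖S.Q (y, v)‖ ≤ S.L * (1 + (1 + ‖S.P 0‖ + S.L) / S.c) * (1 + ‖y‖ + ‖S.P (y, v)‖) := by
  have h1 := S.growth_Q (y, v)
  have h2 : ‖((y, v) : E × E)‖ ≤ ‖y‖ + ‖v‖ := by
    rw [Prod.norm_def]
    exact max_le_add_of_nonneg (norm_nonneg _) (norm_nonneg _)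
  have h3 := S.norm_velocity_le y v
  refine h1.trans ?_
  rw [mul_assoc]
  refine mul_le_mul_of_nonneg_left ?_ S.L_nonneg
  have h9 := norm_nonneg (S.P (y, v))
  rw [add_mul, one_mul]
  linarith

/-- Used to absorb the implicit term in the Gronwall recursion: `1 / (1 - x)` is at most `exp (2 x)`
for small `x`. -/
theorem one_le_one_sub_mul_exp {x : ℝ} (h0 : 0 ≤ x) (h1 : x ≤ 1 / 2) :
    1 ≤ (1 - x) * Real.exp (2 * x) := by
  have h2 := Real.add_one_le_exp (2 * x)
  have h3 := mul_le_mul_of_nonneg_left h2 (show (0 : ℝ) ≤ 1 - x by linarith)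
  nlinarith

variable {S} in
-- Position jumps are a step times a bounded velocity. For velocity jumps, insert `P (y (i + 1), v
-- i)`: the momentum changes by a step times a bounded force, and changing its position argument
-- costs `S.L` times the position jump.
theorem IsDiscrete.norm_jump_le {t₀ tf : ℝ} {Θ : TimeSet t₀ tf} {y v : ℕ → E}
    (hd : S.IsDiscrete Θ y v) {K : ℝ} (hK : 0 ≤ K) (hvK : ∀ i < Θ.N, ‖v i‖ ≤ K)
    (hQK : ∀ i < Θ.N, ‖S.Q (y i, v i)‖ ≤ K) : ∀ i, i + 1 < Θ.N →
    ‖(y (i + 1), v (i + 1)) - (y i, v i)‖ ≤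
      (K + (K + S.L * K) / S.c) * (Θ.step i + Θ.step (i + 1)) := by
  intro i hi
  have hs := (Θ.step_pos (show i < Θ.N by omega)).le
  have hs' := (Θ.step_pos hi).le
  have h1 : ‖y (i + 1) - y i‖ ≤ Θ.step i * K := by
    rw [hd.1 i (by omega), add_sub_cancel_left, norm_smul, Real.norm_of_nonneg hs]
    exact mul_le_mul_of_nonneg_left (hvK i (by omega)) hs
  have h2 : S.c * ‖v (i + 1) - v i‖ ≤ Θ.step (i + 1) * K + S.L * (Θ.step i * K) := by
    refine (S.norm_sub_le_momentum (y (i + 1)) _ _).trans ?_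
    have h3 : S.P (y (i + 1), v (i + 1)) - S.P (y (i + 1), v i)
        = Θ.step (i + 1) • S.Q (y (i + 1), v (i + 1))
          + (S.P (y i, v i) - S.P (y (i + 1), v i)) := by
      rw [← hd.2 i hi]; abel
    rw [h3]
    refine (norm_add_le _ _).trans (add_le_add ?_ ?_)
    · rw [norm_smul, Real.norm_of_nonneg hs']
      exact mul_le_mul_of_nonneg_left (hQK _ hi) hs'
    · refine (S.lipschitz_P _ _).trans (mul_le_mul_of_nonneg_left ?_ S.L_nonneg)
      have h4 : ‖((y i, v i) : E × E) - (y (i + 1), v i)‖ = ‖y (i + 1) - y i‖ := by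
        rw [norm_sub_rev]
        simp [Prod.norm_def]
      rw [h4]; exact h1
  have h5 : ‖v (i + 1) - v i‖ ≤ (K + S.L * K) / S.c * (Θ.step i + Θ.step (i + 1)) := by
    rw [div_mul_eq_mul_div, le_div_iff₀ S.c_pos]
    have h6 : 0 ≤ S.L * K := mul_nonneg S.L_nonneg hK
    nlinarith
  have hc := S.c_pos
  have hL := S.L_nonneg
  have h7 : 0 ≤ (K + S.L * K) / S.c := by positivity
  rw [Prod.mk_sub_mk, Prod.norm_def]
  refine max_le (h1.trans ?_) (h5.trans ?_)
  · nlinarith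
  · nlinarith

variable {S} in
theorem IsDiscrete.norm_sub_le {t₀ tf : ℝ} {Θ : TimeSet t₀ tf} {y v : ℕ → E}
    (hd : S.IsDiscrete Θ y v) {K : ℝ} (hK : 0 ≤ K) (hvK : ∀ i < Θ.N, ‖v i‖ ≤ K)
    (hQK : ∀ i < Θ.N, ‖S.Q (y i, v i)‖ ≤ K) : ∀ i j, i ≤ j → j < Θ.N →
    ‖(y j, v j) - (y i, v i)‖ ≤
      2 * (K + (K + S.L * K) / S.c) * (Θ.t (j + 1) - Θ.t i) := by
  have hc := S.c_pos
  have hL := S.L_nonneg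
  set K₃ : ℝ := K + (K + S.L * K) / S.c with hK₃
  have hK₃0 : 0 ≤ K₃ := by positivity
  have hjump := hd.norm_jump_le hK hvK hQK
  rw [← hK₃] at hjump
  intro i j hij
  -- Each jump involves two adjacent steps, so telescoping runs over the interval twice, once
  -- shifted by one cell; this explains the factor 2 and the node `j + 1` in the conclusion.
  have hsum : j < Θ.N → ‖(y j, v j) - (y i, v i)‖ ≤
      K₃ * ((Θ.t j - Θ.t i) + (Θ.t (j + 1) - Θ.t i)) := by
    induction j, hij using Nat.le_induction with
    | base =>
      intro h
      rw [sub_self, norm_zero, sub_self, zero_add]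
      exact mul_nonneg hK₃0 (Θ.step_pos h).le
    | succ j hj ih =>
      intro h
      have h1 := ih (by omega)
      have h2 := hjump j h
      have h3 : (y (j + 1), v (j + 1)) - (y i, v i)
          = ((y (j + 1), v (j + 1)) - (y j, v j)) + ((y j, v j) - (y i, v i)) := by abel
      rw [h3]
      refine (norm_add_le _ _).trans ((add_le_add h2 h1).trans (le_of_eq ?_))
      simp only [TimeSet.step]
      ring
  intro hj
  refine (hsum hj).trans ?_
  have h1 := (Θ.step_pos hj).le
  have h2 := Θ.t_le_t hij hj.le
  simp only [TimeSet.step] at h1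
  nlinarith

/-- A priori bounds for the discrete equations, uniform with respect to the time set. -/
theorem exists_bound {t₀ tf : ℝ} (M : ℝ) :
    ∃ K δ : ℝ, 0 ≤ K ∧ 0 < δ ∧ ∀ (Θ : TimeSet t₀ tf) (y v : ℕ → E), Θ.size ≤ δ → ‖y 0‖ ≤ M →
      ‖v 0‖ ≤ M → S.IsDiscrete Θ y v →
      (∀ i < Θ.N, ‖y i‖ ≤ K ∧ ‖v i‖ ≤ K ∧ ‖S.Q (y i, v i)‖ ≤ K) ∧
      ∀ i j, i ≤ j → j < Θ.N → ‖(y j, v j) - (y i, v i)‖ ≤ K * (Θ.t (j + 1) - Θ.t i) := by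
  set C₁ : ℝ := (1 + ‖S.P 0‖ + S.L) / S.c with hC₁
  set C₂ : ℝ := S.L * (1 + C₁) with hC₂
  have hL := S.L_nonneg
  have hc := S.c_pos
  have hC₁0 : 0 < C₁ := by
    have := norm_nonneg (S.P 0)
    positivity
  have hC₂0 : 0 ≤ C₂ := by positivity
  set C : ℝ := C₁ + C₂ with hC
  have hC0 : 0 < C := by positivity
  -- A bound for `A i` below: the Gronwall factor, with `2 * C` from the implicit and `C` from the
  -- explicit term, times a bound for `A 0`.
  set K₁ : ℝ := Real.exp (3 * C * (tf - t₀)) * (1 + |M| + (‖S.P 0‖ + S.L * |M|)) with hK₁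
  have hK₁0 : 0 ≤ K₁ := by
    have := norm_nonneg (S.P 0)
    positivity
  set K₂ : ℝ := K₁ + C₁ * K₁ + C₂ * K₁ with hK₂
  have hK₂0 : 0 ≤ K₂ := by positivity
  set K₃ : ℝ := K₂ + (K₂ + S.L * K₂) / S.c with hK₃
  have hK₃0 : 0 ≤ K₃ := by positivity
  -- The threshold ensures `C * Θ.step i ≤ 1 / 2`, as needed to absorb the implicit term.
  refine ⟨K₂ + 2 * K₃, 1 / (2 * C), by positivity, by positivity, ?_⟩
  intro Θ y v hsize hy hv hd
  -- The Gronwall quantity contains the momentum in place of the velocity, since that is what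
  -- changes by a multiple of the step.
  let A : ℕ → ℝ := fun i => 1 + ‖y i‖ + ‖S.P (y i, v i)‖
  have hA0 : ∀ i, 0 ≤ A i := fun i => by positivity
  have hvA : ∀ i, ‖v i‖ ≤ C₁ * A i := fun i => S.norm_velocity_le _ _
  have hQA : ∀ i, ‖S.Q (y i, v i)‖ ≤ C₂ * A i := fun i => S.norm_force_le _ _
  have hstep : ∀ i < Θ.N, C * Θ.step i ≤ 1 / 2 := fun i hi => by
    have h1 := mul_le_mul_of_nonneg_left ((Θ.step_le_size hi).trans hsize) hC0.le
    refine h1.trans (le_of_eq ?_)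
    field_simp
  have hrec : ∀ i, i + 1 < Θ.N →
      A (i + 1) ≤ Real.exp (2 * (C * Θ.step (i + 1)) + C * Θ.step i) * A i := by
    intro i hi
    have hs := (Θ.step_pos (show i < Θ.N by omega)).le
    have hs' := (Θ.step_pos hi).le
    have h1 : ‖y (i + 1)‖ ≤ ‖y i‖ + Θ.step i * (C₁ * A i) := by
      rw [hd.1 i (by omega)]
      refine (norm_add_le _ _).trans (add_le_add le_rfl ?_)
      rw [norm_smul, Real.norm_of_nonneg hs]
      exact mul_le_mul_of_nonneg_left (hvA i) hs
    have h2 : ‖S.P (y (i + 1), v (i + 1))‖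
        ≤ ‖S.P (y i, v i)‖ + Θ.step (i + 1) * (C₂ * A (i + 1)) := by
      rw [← sub_add_cancel (S.P (y (i + 1), v (i + 1)))
        (Θ.step (i + 1) • S.Q (y (i + 1), v (i + 1))), hd.2 i hi]
      refine (norm_add_le _ _).trans (add_le_add le_rfl ?_)
      rw [norm_smul, Real.norm_of_nonneg hs']
      exact mul_le_mul_of_nonneg_left (hQA _) hs'
    -- The force is taken at the new node and the velocity at the old one, hence one factor on each
    -- side.
    have h3 : (1 - C * Θ.step (i + 1)) * A (i + 1) ≤ (1 + C * Θ.step i) * A i := by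
      have h4 : A (i + 1) ≤ A i + Θ.step i * (C₁ * A i) + Θ.step (i + 1) * (C₂ * A (i + 1)) := by
        simp only [A] at h1 h2 ⊢
        linarith
      have h5 : 0 ≤ Θ.step i * (C₂ * A i) := mul_nonneg hs (mul_nonneg hC₂0 (hA0 i))
      have h6 : 0 ≤ Θ.step (i + 1) * (C₁ * A (i + 1)) :=
        mul_nonneg hs' (mul_nonneg hC₁0.le (hA0 _))
      rw [hC]
      nlinarith
    have h7 := one_le_one_sub_mul_exp (mul_nonneg hC0.le hs') (hstep _ hi)
    have h8 := Real.add_one_le_exp (C * Θ.step i)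
    rw [Real.exp_add]
    calc A (i + 1) ≤ ((1 - C * Θ.step (i + 1)) * Real.exp (2 * (C * Θ.step (i + 1)))) * A (i + 1) :=
          le_mul_of_one_le_left (hA0 _) h7
      _ = Real.exp (2 * (C * Θ.step (i + 1))) * ((1 - C * Θ.step (i + 1)) * A (i + 1)) := by ring
      _ ≤ Real.exp (2 * (C * Θ.step (i + 1))) * ((1 + C * Θ.step i) * A i) :=
          mul_le_mul_of_nonneg_left h3 (Real.exp_pos _).le
      _ ≤ Real.exp (2 * (C * Θ.step (i + 1))) * (Real.exp (C * Θ.step i) * A i) := by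
          refine mul_le_mul_of_nonneg_left (mul_le_mul_of_nonneg_right ?_ (hA0 _))
            (Real.exp_pos _).le
          linarith
      _ = _ := by ring
  have hgron : ∀ i < Θ.N,
      A i ≤ Real.exp (2 * C * (Θ.t (i + 1) - t₀) + C * (Θ.t i - t₀)) * A 0 := by
    intro i
    induction i with
    | zero =>
      intro h0
      refine le_mul_of_one_le_left (hA0 _) (Real.one_le_exp ?_)
      have h1 := (Θ.step_pos h0).le
      simp only [TimeSet.step, Θ.t_zero] at h1
      rw [Θ.t_zero]
      have := mul_nonneg hC0.le h1
      linarith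
    | succ i ih =>
      intro hi
      refine (hrec i hi).trans ((mul_le_mul_of_nonneg_left (ih (by omega))
        (Real.exp_pos _).le).trans (le_of_eq ?_))
      rw [← mul_assoc, ← Real.exp_add]
      congr 2
      simp only [TimeSet.step]
      ring
  have hAK : ∀ i < Θ.N, A i ≤ K₁ := by
    intro i hi
    refine (hgron i hi).trans ?_
    have h1 := (Θ.t_mem_Icc (show i + 1 ≤ Θ.N from hi)).2
    have h2 := (Θ.t_mem_Icc hi.le).2
    refine mul_le_mul (Real.exp_le_exp.2 ?_) ?_ (hA0 _) (Real.exp_pos _).le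
    · nlinarith
    · have h3 := S.lipschitz_P (y 0, v 0) 0
      have h4 : ‖((y 0, v 0) : E × E) - 0‖ ≤ |M| := by
        rw [sub_zero, Prod.norm_def]
        exact max_le (hy.trans (le_abs_self _)) (hv.trans (le_abs_self _))
      have h5 := norm_le_insert' (S.P (y 0, v 0)) (S.P 0)
      have h6 := mul_le_mul_of_nonneg_left h4 hL
      have h7 := hy.trans (le_abs_self M)
      simp only [A]
      linarith
  have hyK : ∀ i < Θ.N, ‖y i‖ ≤ K₂ := fun i hi => by
    have h1 := hAK i hi
    have h2 := norm_nonneg (S.P (y i, v i))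
    have h3 : 0 ≤ C₁ * K₁ := by positivity
    have h4 : 0 ≤ C₂ * K₁ := by positivity
    simp only [A] at h1
    linarith
  have hvK : ∀ i < Θ.N, ‖v i‖ ≤ K₂ := fun i hi => by
    have h1 := (hvA i).trans (mul_le_mul_of_nonneg_left (hAK i hi) hC₁0.le)
    have h4 : 0 ≤ C₂ * K₁ := by positivity
    linarith
  have hQK : ∀ i < Θ.N, ‖S.Q (y i, v i)‖ ≤ K₂ := fun i hi => by
    have h1 := (hQA i).trans (mul_le_mul_of_nonneg_left (hAK i hi) hC₂0)
    have h4 : 0 ≤ C₁ * K₁ := by positivity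
    linarith
  refine ⟨fun i hi => ⟨by linarith [hyK i hi], by linarith [hvK i hi], by linarith [hQK i hi]⟩, ?_⟩
  intro i j hij hj
  refine (hd.norm_sub_le hK₂0 hvK hQK i j hij hj).trans ?_
  rw [← hK₃]
  have h1 := Θ.t_le_t (show i ≤ j + 1 by omega) (show j + 1 ≤ Θ.N from hj)
  exact mul_le_mul_of_nonneg_right (by linarith) (sub_nonneg.2 h1)

end ImplicitSystem

/-! ### Limits of the discretized systems -/

/-- The nodal sequences `a n` converge uniformly to `g`. -/
def NodalLimit {F : Type*} [NormedAddCommGroup F] {t₀ tf : ℝ} (Θ : ℕ → TimeSet t₀ tf)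
    (a : ℕ → ℕ → F) (g : ℝ → F) : Prop :=
  ∀ ε > 0, ∀ᶠ n in atTop, ∀ i < (Θ n).N, ∀ t ∈ Icc ((Θ n).t i) ((Θ n).t (i + 1)),
    ‖a n i - g t‖ ≤ ε

/-- Eventually all nodal values lie in the ball of radius one more than the bound of `g`, and `Ψ` is
uniformly continuous on that compact ball. -/
theorem NodalLimit.comp {F F' : Type*} [NormedAddCommGroup F] [ProperSpace F]
    [NormedAddCommGroup F'] {t₀ tf : ℝ} {Θ : ℕ → TimeSet t₀ tf} {a : ℕ → ℕ → F} {g : ℝ → F}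
    (h : NodalLimit Θ a g) (hg : Continuous g) {Ψ : F → F'} (hΨ : Continuous Ψ) :
    NodalLimit Θ (fun n i => Ψ (a n i)) (fun t => Ψ (g t)) := by
  intro ε hε
  obtain ⟨R, hR⟩ := (isCompact_Icc.image hg).isBounded.exists_norm_le (s := g '' Icc t₀ tf)
  have hR' : ∀ t ∈ Icc t₀ tf, ‖g t‖ ≤ R := fun t ht => hR _ (mem_image_of_mem g ht)
  have hu := (isCompact_closedBall (0 : F) (R + 1)).uniformContinuousOn_of_continuous
    hΨ.continuousOn
  rw [Metric.uniformContinuousOn_iff_le] at hu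
  obtain ⟨δ, hδ, hu⟩ := hu ε hε
  filter_upwards [h (min δ 1) (by positivity)] with n hn i hi t ht
  have h1 := hn i hi t ht
  have h2 := hR' t ((Θ n).Icc_subset_Icc hi ht)
  have h3 : ‖a n i‖ ≤ R + 1 := by
    have h4 := norm_le_insert' (a n i) (g t)
    linarith [min_le_right δ (1 : ℝ)]
  have h5 := hu (a n i) (by simpa using h3) (g t) (by
    rw [mem_closedBall_zero_iff]; linarith) (by
      rw [dist_eq_norm]; exact h1.trans (min_le_left _ _))
  rwa [dist_eq_norm] at h5

/-- Passage to the limit in a summed difference equation. The equation may fail by an error tending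
to zero, which leaves room for boundary terms of the size of a step. -/
theorem NodalLimit.eq_add_integral {F : Type*} [NormedAddCommGroup F] [NormedSpace ℝ F]
    [CompleteSpace F] {t₀ tf : ℝ} (htime : t₀ < tf) {Θ : ℕ → TimeSet t₀ tf}
    (hsize : Tendsto (fun n => (Θ n).size) atTop (𝓝 0)) {w a : ℕ → ℕ → F} {φ g : ℝ → F}
    (hw : NodalLimit Θ w φ) (ha : NodalLimit Θ a g) (hg : Continuous g)
    (hsum : ∀ ε > 0, ∀ᶠ n in atTop, ∀ j < (Θ n).N,
      ‖w n j - w n 0 - ∑ l ∈ Finset.range j, (Θ n).step l • a n l‖ ≤ ε) {t : ℝ}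
    (ht : t ∈ Icc t₀ tf) : φ t = φ t₀ + ∫ s in t₀..t, g s := by
  obtain ⟨G, hG⟩ := (isCompact_Icc.image hg).isBounded.exists_norm_le (s := g '' Icc t₀ tf)
  have hG' : ∀ t ∈ Icc t₀ tf, ‖g t‖ ≤ G := fun t ht => hG _ (mem_image_of_mem g ht)
  have hG0 : 0 ≤ G := (norm_nonneg _).trans (hG' t ht)
  -- Four errors of size `ε` (values at both ends, defect of the sum, integral over the incomplete
  -- last cell), plus the Riemann sum error over at most `tf - t₀`.
  have key : ∀ ε > 0, ‖φ t - φ t₀ - ∫ s in t₀..t, g s‖ ≤ (4 + (tf - t₀)) * ε := by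
    intro ε hε
    have h0 : ∀ᶠ n in atTop, G * (Θ n).size ≤ ε := by
      have h1 : Tendsto (fun n => G * (Θ n).size) atTop (𝓝 (G * 0)) := hsize.const_mul G
      rw [mul_zero] at h1
      exact (h1.eventually_lt_const hε).mono fun _ h => h.le
    obtain ⟨n, h1, h2, h3, h4⟩ := (h0.and ((hw ε hε).and ((ha ε hε).and (hsum ε hε)))).exists
    obtain ⟨j, hj, htj⟩ := (Θ n).exists_mem_Icc_step htime ht
    have e1 := h2 j hj t htj
    have e2 := h2 0 ((Θ n).N_pos htime) t₀ ⟨(Θ n).t_zero.le,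
      (Θ n).t_zero.symm.trans_le ((Θ n).t_le_t (Nat.zero_le _) ((Θ n).N_pos htime))⟩
    have e3 := h4 j hj
    have e4 := (Θ n).norm_sum_sub_integral_le hg h3 hj.le
    have e5 : ‖∫ s in (Θ n).t j..t, g s‖ ≤ ε := by
      have h5 := intervalIntegral.norm_integral_le_of_norm_le_const
        (f := g) (a := (Θ n).t j) (b := t) (C := G) (fun s hs => by
          rw [uIoc_of_le htj.1] at hs
          exact hG' s ((Θ n).Icc_subset_Icc hj ⟨hs.1.le, hs.2.trans htj.2⟩))
      rw [abs_of_nonneg (sub_nonneg.2 htj.1)] at h5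
      refine h5.trans ((mul_le_mul_of_nonneg_left ?_ hG0).trans h1)
      have h6 := (Θ n).step_le_size hj
      simp only [TimeSet.step] at h6
      linarith [htj.2]
    have e6 : ε * ((Θ n).t j - t₀) ≤ ε * (tf - t₀) :=
      mul_le_mul_of_nonneg_left (by linarith [((Θ n).t_mem_Icc hj.le).2]) hε.le
    have e7 : φ t - φ t₀ - ∫ s in t₀..t, g s = -(w n j - φ t) + (w n 0 - φ t₀)
        + (w n j - w n 0 - ∑ l ∈ Finset.range j, (Θ n).step l • a n l)
        + (∑ l ∈ Finset.range j, (Θ n).step l • a n l - ∫ s in t₀..(Θ n).t j, g s)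
        - ∫ s in (Θ n).t j..t, g s := by
      rw [← intervalIntegral.integral_add_adjacent_intervals
        (hg.intervalIntegrable t₀ ((Θ n).t j)) (hg.intervalIntegrable ((Θ n).t j) t)]
      abel
    rw [e7]
    refine (norm_sub_le _ _).trans ?_
    have e8 := norm_add₃_le (a := -(w n j - φ t)) (b := w n 0 - φ t₀)
      (c := w n j - w n 0 - ∑ l ∈ Finset.range j, (Θ n).step l • a n l)
    rw [norm_neg] at e8
    have e9 := norm_add_le (-(w n j - φ t) + (w n 0 - φ t₀)
        + (w n j - w n 0 - ∑ l ∈ Finset.range j, (Θ n).step l • a n l))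
        (∑ l ∈ Finset.range j, (Θ n).step l • a n l - ∫ s in t₀..(Θ n).t j, g s)
    linarith
  have hT : 0 < 4 + (tf - t₀) := by linarith
  have h1 : ‖φ t - φ t₀ - ∫ s in t₀..t, g s‖ ≤ 0 := by
    refine le_of_forall_pos_le_add fun ε hε => ?_
    have h2 := key (ε / (4 + (tf - t₀))) (by positivity)
    rw [mul_div_cancel₀ _ hT.ne'] at h2
    linarith
  have h2 := norm_le_zero_iff.1 h1
  rw [sub_sub] at h2
  exact sub_eq_zero.1 h2

namespace ImplicitSystem

variable {E : Type*} [NormedAddCommGroup E] [NormedSpace ℝ E] (S : ImplicitSystem E)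

theorem continuous_P : Continuous S.P :=
  (LipschitzWith.of_dist_le_mul (K := S.L.toNNReal) fun z z' => by
    rw [dist_eq_norm, dist_eq_norm, Real.coe_toNNReal _ S.L_nonneg]
    exact S.lipschitz_P z z').continuous

variable {S} in
theorem IsDiscrete.sub_sum_velocity {t₀ tf : ℝ} {Θ : TimeSet t₀ tf} {y v : ℕ → E}
    (hd : S.IsDiscrete Θ y v) {j : ℕ} (hj : j < Θ.N) :
    y j - y 0 - ∑ l ∈ Finset.range j, Θ.step l • v l = 0 := by
  induction j with
  | zero => simp
  | succ j ih =>
    rw [Finset.sum_range_succ, hd.1 j (by omega), ← ih (by omega)]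
    abel

variable {S} in
-- The momentum equation sums forces over the nodes 1 to `j`, while a left Riemann sum uses 0 to `j
-- - 1`; the two end terms make up the difference and vanish with the step.
theorem IsDiscrete.sub_sum_force {t₀ tf : ℝ} {Θ : TimeSet t₀ tf} {y v : ℕ → E}
    (hd : S.IsDiscrete Θ y v) {j : ℕ} (hj : j < Θ.N) :
    S.P (y j, v j) - S.P (y 0, v 0) - ∑ l ∈ Finset.range j, Θ.step l • S.Q (y l, v l)
      = Θ.step j • S.Q (y j, v j) - Θ.step 0 • S.Q (y 0, v 0) := by
  induction j with
  | zero => simp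
  | succ j ih =>
    have h1 := ih (by omega)
    rw [← hd.2 j hj] at h1
    rw [Finset.sum_range_succ]
    linear_combination (norm := module) h1

/-- Compactness: discrete solutions with bounded initial data converge, together with their
velocities and up to a subsequence, to a solution of the implicit system. -/
theorem exists_limit [FiniteDimensional ℝ E] {t₀ tf : ℝ} (htime : t₀ < tf)
    {Θ : ℕ → TimeSet t₀ tf} (hsize : Tendsto (fun n => (Θ n).size) atTop (𝓝 0))
    {y v : ℕ → ℕ → E} {M : ℝ}
    (hd : ∀ᶠ n in atTop, ‖y n 0‖ ≤ M ∧ ‖v n 0‖ ≤ M ∧ S.IsDiscrete (Θ n) (y n) (v n)) :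
    ∃ (z : ℝ → E × E) (σ : ℕ → ℕ) (C : NNReal), StrictMono σ ∧ LipschitzWith C z ∧
      NodalLimit (fun n => Θ (σ n)) (fun n i => (y (σ n) i, v (σ n) i)) z ∧
      (∀ t ∈ Icc t₀ tf, (z t).1 = (z t₀).1 + ∫ s in t₀..t, (z s).2) ∧
      ∀ t ∈ Icc t₀ tf, S.P (z t) = S.P (z t₀) + ∫ s in t₀..t, S.Q (z s) := by
  have : ProperSpace E := FiniteDimensional.proper ℝ E
  -- The bounds hold only once the steps are below `δ`; from the index `H` on they are available,
  -- and the sequence is shifted by `H` below.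
  obtain ⟨K, δ, hK, hδ, hbd⟩ := S.exists_bound (t₀ := t₀) (tf := tf) M
  obtain ⟨H, hH⟩ := eventually_atTop.1 (hd.and (hsize.eventually_le_const hδ))
  have hB := fun n (hn : H ≤ n) =>
    hbd (Θ n) (y n) (v n) (hH n hn).2 (hH n hn).1.1 (hH n hn).1.2.1 (hH n hn).1.2.2
  have hidx : ∀ n, ∀ t, ∃ i, t ∈ Icc t₀ tf → i < (Θ n).N ∧
      t ∈ Icc ((Θ n).t i) ((Θ n).t (i + 1)) := by
    intro n t
    by_cases ht : t ∈ Icc t₀ tf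
    · obtain ⟨i, hi, hti⟩ := (Θ n).exists_mem_Icc_step htime ht
      exact ⟨i, fun _ => ⟨hi, hti⟩⟩
    · exact ⟨0, fun h => absurd h ht⟩
  choose idx hidx using hidx
  -- The two cells may be arbitrary cells containing `s` and `t`; a node lies in two of them, and
  -- the estimate does not depend on the choice. Each cell adds at most one step to `|s - t|`.
  have hclose : ∀ n, H ≤ n → ∀ i < (Θ n).N, ∀ j < (Θ n).N,
      ∀ s ∈ Icc ((Θ n).t i) ((Θ n).t (i + 1)), ∀ t ∈ Icc ((Θ n).t j) ((Θ n).t (j + 1)),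
      ‖(y n i, v n i) - (y n j, v n j)‖ ≤ K * |s - t| + 2 * K * (Θ n).size := by
    have aux : ∀ n, H ≤ n → ∀ i < (Θ n).N, ∀ j < (Θ n).N, i ≤ j →
        ∀ s ∈ Icc ((Θ n).t i) ((Θ n).t (i + 1)), ∀ t ∈ Icc ((Θ n).t j) ((Θ n).t (j + 1)),
        ‖(y n j, v n j) - (y n i, v n i)‖ ≤ K * |s - t| + 2 * K * (Θ n).size := by
      intro n hn i hi j hj hij s hs t ht
      have h1 := (hB n hn).2 i j hij hj
      have h2 := (Θ n).step_le_size hi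
      have h3 := (Θ n).step_le_size hj
      simp only [TimeSet.step] at h2 h3
      have h4 : (Θ n).t (j + 1) - (Θ n).t i ≤ |s - t| + 2 * (Θ n).size := by
        have h5 := neg_abs_le (s - t)
        linarith [hs.2, ht.1]
      have h6 := mul_le_mul_of_nonneg_left h4 hK
      linarith
    intro n hn i hi j hj s hs t ht
    rcases le_total i j with hij | hij
    · rw [norm_sub_rev]
      exact aux n hn i hi j hj hij s hs t ht
    · rw [abs_sub_comm]
      exact aux n hn j hj i hi hij t ht s hs
  have hε : Tendsto (fun n => 2 * K * (Θ (n + H)).size) atTop (𝓝 0) := by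
    have h1 := ((tendsto_add_atTop_iff_nat H).2 hsize).const_mul (2 * K)
    rwa [mul_zero] at h1
  obtain ⟨z, σ, hσ, hz, hlim⟩ := exists_subseq_tendsto_of_almost_lipschitz htime.le
    (f := fun n t => (y (n + H) (idx (n + H) t), v (n + H) (idx (n + H) t))) (M := K) (K := K)
    hε hK (fun n t ht => by
      have h1 := (hB (n + H) (Nat.le_add_left _ _)).1 _ (hidx (n + H) t ht).1
      rw [Prod.norm_def]
      exact max_le h1.1 h1.2.1) (fun n s hs t ht =>
      hclose (n + H) (Nat.le_add_left _ _) _ (hidx (n + H) s hs).1 _ (hidx (n + H) t ht).1 s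
        (hidx (n + H) s hs).2 t (hidx (n + H) t ht).2)
  have hσ' : StrictMono fun n => σ n + H := fun a b hab => Nat.add_lt_add_right (hσ hab) H
  have hsize' : Tendsto (fun n => (Θ (σ n + H)).size) atTop (𝓝 0) :=
    hsize.comp hσ'.tendsto_atTop
  have hnodal : NodalLimit (fun n => Θ (σ n + H))
      (fun n i => (y (σ n + H) i, v (σ n + H) i)) z := by
    intro ε hε0
    have h1 := Metric.tendstoUniformlyOn_iff.1 hlim (ε / 2) (by positivity)
    have h2 := (hε.comp hσ.tendsto_atTop).eventually_le_const (half_pos hε0)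
    filter_upwards [h1, h2] with n hn1 hn2 i hi t ht
    have ht' := (Θ (σ n + H)).Icc_subset_Icc hi ht
    have h3 := hn1 t ht'
    -- With both times equal, the estimate replaces the cell selected by `idx` by any other cell
    -- containing `t`.
    have h4 := hclose (σ n + H) (Nat.le_add_left _ _) i hi _ (hidx _ t ht').1 t ht t
      (hidx _ t ht').2
    rw [sub_self, abs_zero, mul_zero, zero_add] at h4
    rw [dist_comm, dist_eq_norm] at h3
    simp only [Function.comp] at hn2
    refine (norm_sub_le_norm_sub_add_norm_sub _ _ _).trans ((add_le_add h4 h3.le).trans ?_)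
    linarith
  have hzc : Continuous z := hz.continuous
  refine ⟨z, fun n => σ n + H, K.toNNReal, hσ', hz, hnodal, fun t ht => ?_, fun t ht => ?_⟩
  · refine NodalLimit.eq_add_integral htime hsize' (hnodal.comp hzc continuous_fst)
      (hnodal.comp hzc continuous_snd) (continuous_snd.comp hzc) (fun ε hε0 => ?_) ht
    refine Eventually.of_forall fun n j hj => ?_
    rw [(hH (σ n + H) (Nat.le_add_left _ _)).1.2.2.sub_sum_velocity hj, norm_zero]
    exact hε0.le
  · refine NodalLimit.eq_add_integral htime hsize' (hnodal.comp hzc S.continuous_P)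
      (hnodal.comp hzc S.continuous_Q) (S.continuous_Q.comp hzc) (fun ε hε0 => ?_) ht
    filter_upwards [(hε.comp hσ.tendsto_atTop).eventually_le_const hε0] with n hn j hj
    have hn' : H ≤ σ n + H := Nat.le_add_left _ _
    have hN : 0 < (Θ (σ n + H)).N := (Nat.zero_le _).trans_lt hj
    rw [(hH _ hn').1.2.2.sub_sum_force hj]
    have aux : ∀ i < (Θ (σ n + H)).N, ‖(Θ (σ n + H)).step i • S.Q (y (σ n + H) i, v (σ n + H) i)‖
        ≤ (Θ (σ n + H)).size * K := by
      intro i hi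
      rw [norm_smul, Real.norm_of_nonneg ((Θ _).step_pos hi).le]
      exact mul_le_mul ((Θ _).step_le_size hi) ((hB _ hn').1 i hi).2.2 (norm_nonneg _)
        (Θ _).size_nonneg
    refine (norm_sub_le _ _).trans ((add_le_add (aux j hj) (aux 0 hN)).trans ?_)
    simp only [Function.comp] at hn
    linarith

end ImplicitSystem

/-! ### Integral functionals -/

theorem _root_.MeasureTheory.MemLp.exists_ae_norm_le {X F : Type*} [MeasurableSpace X]
    [NormedAddCommGroup F] {μ : Measure X} {f : X → F} (hf : MemLp f ⊤ μ) :
    ∃ C : ℝ, 0 ≤ C ∧ ∀ᵐ x ∂μ, ‖f x‖ ≤ C := by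
  refine ⟨(eLpNorm f ⊤ μ).toReal, ENNReal.toReal_nonneg, ?_⟩
  have h1 : ∀ᵐ x ∂μ, ‖f x‖ₑ ≤ eLpNorm f ⊤ μ := by
    rw [eLpNorm_exponent_top]; exact ae_le_eLpNormEssSup
  filter_upwards [h1] with x hx
  have h2 := ENNReal.toReal_mono hf.2.ne hx
  rwa [toReal_enorm] at h2

section Nemytskii

variable {X : Type*} [MeasurableSpace X] {μ : Measure X}
  {S Z : Type*} [NormedAddCommGroup S] [NormedSpace ℝ S] [NormedAddCommGroup Z] [NormedSpace ℝ Z]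

/-- The derivative of the functional `y ↦ ∫ g (ℓ x y)`. -/
def integralFDeriv (μ : Measure X) (g : Z → ℝ) (ℓ : X → S →L[ℝ] Z) (y : S) : S →L[ℝ] ℝ :=
  ∫ x, (fderiv ℝ g (ℓ x y)).comp (ℓ x) ∂μ

omit [NormedSpace ℝ Z] in
theorem exists_bound_of_continuous {F : Type*} [NormedAddCommGroup F] [ProperSpace Z]
    {G : Z → F} (hG : Continuous G) (r : ℝ) : ∃ K, 0 ≤ K ∧ ∀ z, ‖z‖ ≤ r → ‖G z‖ ≤ K := by
  obtain ⟨K, hK⟩ := (isCompact_closedBall (0 : Z) r).exists_bound_of_continuousOn hG.continuousOn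
  exact ⟨max K 0, le_max_right _ _, fun z hz => (hK z (by simpa using hz)).trans (le_max_left _ _)⟩

omit [NormedSpace ℝ Z] in
-- A bounded field stays in a compact ball, where `G` is bounded. Hence densities need no growth
-- condition to be integrable along finite element fields on a body of finite measure.
theorem memLp_top_comp [ProperSpace Z] {F : Type*} [NormedAddCommGroup F] {G : Z → F}
    (hG : Continuous G) {f : X → Z} (hf : MemLp f ⊤ μ) : MemLp (fun x => G (f x)) ⊤ μ := by
  obtain ⟨C, -, hC⟩ := hf.exists_ae_norm_le
  obtain ⟨K, -, hK⟩ := exists_bound_of_continuous hG C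
  exact memLp_top_of_bound (hG.comp_aestronglyMeasurable hf.1) K (hC.mono fun x hx => hK _ hx)

theorem memLp_top_apply {ℓ : X → S →L[ℝ] Z} (hℓ : MemLp ℓ ⊤ μ) (y : S) :
    MemLp (fun x => ℓ x y) ⊤ μ :=
  (ContinuousLinearMap.apply ℝ Z y).comp_memLp' hℓ

theorem memLp_top_clm_apply {ℓ : X → S →L[ℝ] Z} {m : X → S} (hℓ : MemLp ℓ ⊤ μ) (hm : MemLp m ⊤ μ) :
    MemLp (fun x => ℓ x (m x)) ⊤ μ := by
  obtain ⟨C, hC0, hC⟩ := hℓ.exists_ae_norm_le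
  obtain ⟨K, -, hK⟩ := hm.exists_ae_norm_le
  refine memLp_top_of_bound (isBoundedBilinearMap_apply.continuous.comp_aestronglyMeasurable
    (hℓ.1.prodMk hm.1)) (C * K) ?_
  filter_upwards [hC, hK] with x h1 h2
  exact ((ℓ x).le_opNorm _).trans (mul_le_mul h1 h2 (norm_nonneg _) hC0)

theorem memLp_top_clm_comp {W : Type*} [NormedAddCommGroup W] [NormedSpace ℝ W]
    {ℓ : X → S →L[ℝ] Z} {m : X → W →L[ℝ] S} (hℓ : MemLp ℓ ⊤ μ) (hm : MemLp m ⊤ μ) :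
    MemLp (fun x => (ℓ x).comp (m x)) ⊤ μ := by
  have h1 := memLp_top_clm_apply ((ContinuousLinearMap.compL ℝ W S Z).comp_memLp' hℓ) hm
  exact h1

theorem memLp_top_clm_comp_const {W : Type*} [NormedAddCommGroup W] [NormedSpace ℝ W]
    {ℓ : X → S →L[ℝ] Z} (hℓ : MemLp ℓ ⊤ μ) (A : W →L[ℝ] S) :
    MemLp (fun x => (ℓ x).comp A) ⊤ μ :=
  ((ContinuousLinearMap.compL ℝ W S Z).flip A).comp_memLp' hℓ

theorem memLp_top_clm_prod {W : Type*} [NormedAddCommGroup W] [NormedSpace ℝ W]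
    {ℓ : X → S →L[ℝ] Z} {m : X → S →L[ℝ] W} (hℓ : MemLp ℓ ⊤ μ) (hm : MemLp m ⊤ μ) :
    MemLp (fun x => (ℓ x).prod (m x)) ⊤ μ := by
  obtain ⟨C, -, hC⟩ := hℓ.exists_ae_norm_le
  obtain ⟨K, -, hK⟩ := hm.exists_ae_norm_le
  refine memLp_top_of_bound ((ContinuousLinearMap.prodₗᵢ (𝕜 := ℝ) (E := S) (F := Z) (G := W)
    ℝ).continuous.comp_aestronglyMeasurable (hℓ.1.prodMk hm.1)) (max C K) ?_
  filter_upwards [hC, hK] with x h1 h2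
  rw [ContinuousLinearMap.opNorm_prod]
  exact max_le_max h1 h2

theorem memLp_top_clm_map {F G : Type*} [NormedAddCommGroup F] [NormedSpace ℝ F]
    [NormedAddCommGroup G] [NormedSpace ℝ G] (T : F →L[ℝ] G) {f : X → F} (hf : MemLp f ⊤ μ) :
    MemLp (fun x => T (f x)) ⊤ μ :=
  T.comp_memLp' hf

theorem memLp_top_clm_map₂ {V W : Type*} [NormedAddCommGroup V] [NormedSpace ℝ V]
    [NormedAddCommGroup W] [NormedSpace ℝ W] (T : V →L[ℝ] S →L[ℝ] W →L[ℝ] Z)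
    {f : X → V} (hf : MemLp f ⊤ μ) : MemLp (fun x => T (f x)) ⊤ μ :=
  memLp_top_clm_map (G := S →L[ℝ] W →L[ℝ] Z) T hf

/-- The tensor product of a linear form and a vector. -/
def tensorCLM {W : Type*} [NormedAddCommGroup W] [NormedSpace ℝ W] :
    (W →L[ℝ] ℝ) →L[ℝ] Z →L[ℝ] W →L[ℝ] Z :=
  ContinuousLinearMap.smulRightL ℝ W Z

theorem tensorCLM_apply {W : Type*} [NormedAddCommGroup W] [NormedSpace ℝ W] (L : W →L[ℝ] ℝ)
    (z : Z) : tensorCLM L z = L.smulRight z := rfl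

theorem memLp_top_tensorCLM {W : Type*} [NormedAddCommGroup W] [NormedSpace ℝ W]
    {L : X → W →L[ℝ] ℝ} (hL : MemLp L ⊤ μ) :
    MemLp (fun x => tensorCLM (Z := Z) (L x)) ⊤ μ :=
  memLp_top_clm_map₂ tensorCLM hL

theorem memLp_top_sum {ι G : Type*} [Fintype ι] [NormedAddCommGroup G] {f : ι → X → G}
    (hf : ∀ a, MemLp (f a) ⊤ μ) : MemLp (fun x => ∑ a, f a x) ⊤ μ :=
  memLp_finsetSum Finset.univ fun a _ => hf a

/-- Finite linear combinations of the entries of a family, as a linear map. -/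
def sumSMulCLM {ι : Type*} [Fintype ι] (f : ι → ℝ) : (ι → Z) →L[ℝ] Z :=
  ∑ a, f a • ContinuousLinearMap.proj a

theorem memLp_top_sumSMulCLM {ι : Type*} [Fintype ι] {f : ι → X → ℝ}
    (hf : ∀ a, MemLp (f a) ⊤ μ) :
    MemLp (fun x => sumSMulCLM (Z := Z) (fun a => f a x)) ⊤ μ := by
  have h1 : ∀ a, MemLp (fun x => f a x • (ContinuousLinearMap.proj a : (ι → Z) →L[ℝ] Z)) ⊤ μ :=
    fun a => memLp_top_clm_map (ContinuousLinearMap.toSpanSingleton ℝ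
      (ContinuousLinearMap.proj a : (ι → Z) →L[ℝ] Z)) (hf a)
  exact memLp_top_sum (G := (ι → Z) →L[ℝ] Z) h1

/-- Finite sums of tensor products with the entries of a family, as a linear map. -/
def sumTensorCLM {ι : Type*} [Fintype ι] {W : Type*} [NormedAddCommGroup W] [NormedSpace ℝ W]
    (L : ι → W →L[ℝ] ℝ) : (ι → Z) →L[ℝ] W →L[ℝ] Z :=
  ∑ a, (tensorCLM (L a)).comp (ContinuousLinearMap.proj a)

theorem memLp_top_sumTensorCLM {ι : Type*} [Fintype ι] {W : Type*} [NormedAddCommGroup W]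
    [NormedSpace ℝ W] {L : ι → X → W →L[ℝ] ℝ} (hL : ∀ a, MemLp (L a) ⊤ μ) :
    MemLp (fun x => sumTensorCLM (Z := Z) (fun a => L a x)) ⊤ μ := by
  have h1 : ∀ a, MemLp (fun x => (tensorCLM (L a x)).comp
      (ContinuousLinearMap.proj a : (ι → Z) →L[ℝ] Z)) ⊤ μ :=
    fun a => memLp_top_clm_comp_const (memLp_top_tensorCLM (hL a)) _
  exact memLp_top_sum (G := (ι → Z) →L[ℝ] W →L[ℝ] Z) h1

variable [ProperSpace Z] [IsFiniteMeasure μ] {g : Z → ℝ} {ℓ : X → S →L[ℝ] Z}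

omit [IsFiniteMeasure μ] in
theorem memLp_fderiv_comp (hg : ContDiff ℝ 1 g) (hℓ : MemLp ℓ ⊤ μ) (y : S) :
    MemLp (fun x => (fderiv ℝ g (ℓ x y)).comp (ℓ x)) ⊤ μ :=
  memLp_top_clm_comp (memLp_top_comp (hg.continuous_fderiv one_ne_zero) (memLp_top_apply hℓ y)) hℓ

theorem integralFDeriv_apply (hg : ContDiff ℝ 1 g) (hℓ : MemLp ℓ ⊤ μ) (y δ : S) :
    integralFDeriv μ g ℓ y δ = ∫ x, fderiv ℝ g (ℓ x y) (ℓ x δ) ∂μ :=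
  ContinuousLinearMap.integral_apply ((memLp_fderiv_comp hg hℓ y).integrable le_top) δ

theorem integrable_fderiv_apply (hg : ContDiff ℝ 1 g) (hℓ : MemLp ℓ ⊤ μ) (y : S) {m : X → Z}
    (hm : MemLp m ⊤ μ) : Integrable (fun x => fderiv ℝ g (ℓ x y) (m x)) μ :=
  (memLp_top_clm_apply (memLp_top_comp (hg.continuous_fderiv one_ne_zero)
    (memLp_top_apply hℓ y)) hm).integrable le_top

theorem integralFDeriv_apply_add (hg : ContDiff ℝ 1 g) (hℓ : MemLp ℓ ⊤ μ) (y δ : S) {m m' : X → Z}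
    (hm : MemLp m ⊤ μ) (hm' : MemLp m' ⊤ μ) (h : ∀ x, ℓ x δ = m x + m' x) :
    integralFDeriv μ g ℓ y δ
      = ∫ x, fderiv ℝ g (ℓ x y) (m x) ∂μ + ∫ x, fderiv ℝ g (ℓ x y) (m' x) ∂μ := by
  rw [integralFDeriv_apply hg hℓ, ← integral_add (integrable_fderiv_apply hg hℓ y hm)
    (integrable_fderiv_apply hg hℓ y hm')]
  simp only [h, map_add]

/-- Differentiation under the integral with a constant majorant: for `z` in the unit ball around
`y`, the points `ℓ x z` stay in one ball, where the derivative of `g` is bounded. -/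
theorem hasFDerivAt_integral_comp (hg : ContDiff ℝ 1 g) (hℓ : MemLp ℓ ⊤ μ) (y : S) :
    HasFDerivAt (fun y => ∫ x, g (ℓ x y) ∂μ) (integralFDeriv μ g ℓ y) y := by
  obtain ⟨C, hC0, hC⟩ := hℓ.exists_ae_norm_le
  obtain ⟨K, hK0, hK⟩ := exists_bound_of_continuous (hg.continuous_fderiv one_ne_zero)
    (C * (‖y‖ + 1))
  refine hasFDerivAt_integral_of_dominated_of_fderiv_le (bound := fun _ => K * C)
    (F' := fun y x => (fderiv ℝ g (ℓ x y)).comp (ℓ x))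
    (Metric.ball_mem_nhds y one_pos) (Eventually.of_forall fun z =>
      (memLp_top_comp hg.continuous (memLp_top_apply hℓ z)).1)
    ((memLp_top_comp hg.continuous (memLp_top_apply hℓ y)).integrable le_top)
    (memLp_fderiv_comp hg hℓ y).1 ?_ (integrable_const _) ?_
  · filter_upwards [hC] with x hx z hz
    have h1 : ‖z‖ ≤ ‖y‖ + 1 := by
      have h2 := norm_le_insert' z y
      have h3 := (mem_ball_iff_norm.1 hz).le
      linarith
    refine (ContinuousLinearMap.opNorm_comp_le _ _).trans
      (mul_le_mul (hK _ ?_) hx (norm_nonneg _) hK0)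
    exact ((ℓ x).le_opNorm z).trans (mul_le_mul hx h1 (norm_nonneg _) hC0)
  · exact Eventually.of_forall fun x z _ =>
      ((hg.differentiable one_ne_zero) (ℓ x z)).hasFDerivAt.comp z (ℓ x).hasFDerivAt

theorem continuous_integralFDeriv (hg : ContDiff ℝ 1 g) (hℓ : MemLp ℓ ⊤ μ) :
    Continuous (integralFDeriv μ g ℓ) := by
  obtain ⟨C, hC0, hC⟩ := hℓ.exists_ae_norm_le
  have hg' := hg.continuous_fderiv one_ne_zero
  refine continuous_iff_continuousAt.2 fun y => ?_
  obtain ⟨K, hK0, hK⟩ := exists_bound_of_continuous hg' (C * (‖y‖ + 1))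
  refine continuousAt_of_dominated (bound := fun _ => K * C)
    (Eventually.of_forall fun z => (memLp_fderiv_comp hg hℓ z).1) ?_ (integrable_const _) ?_
  · filter_upwards [Metric.ball_mem_nhds y one_pos] with z hz
    filter_upwards [hC] with x hx
    have h1 : ‖z‖ ≤ ‖y‖ + 1 := by
      have h2 := norm_le_insert' z y
      have h3 := (mem_ball_iff_norm.1 hz).le
      linarith
    refine (ContinuousLinearMap.opNorm_comp_le _ _).trans
      (mul_le_mul (hK _ ?_) hx (norm_nonneg _) hK0)
    exact ((ℓ x).le_opNorm z).trans (mul_le_mul hx h1 (norm_nonneg _) hC0)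
  · exact Eventually.of_forall fun x =>
      ((hg'.comp (ℓ x).continuous).clm_comp continuous_const).continuousAt

omit [ProperSpace Z] in
theorem exists_norm_integralFDeriv_le (hℓ : MemLp ℓ ⊤ μ) {K : ℝ} (hK : 0 ≤ K)
    (hgK : ∀ z, ‖fderiv ℝ g z‖ ≤ K * (1 + ‖z‖)) :
    ∃ C, 0 ≤ C ∧ ∀ y, ‖integralFDeriv μ g ℓ y‖ ≤ C * (1 + ‖y‖) := by
  obtain ⟨C, hC0, hC⟩ := hℓ.exists_ae_norm_le
  refine ⟨K * (1 + C) * C * μ.real univ, by positivity, fun y => ?_⟩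
  have h1 : ‖integralFDeriv μ g ℓ y‖ ≤ (K * ((1 + C) * (1 + ‖y‖)) * C) * μ.real univ := by
    refine norm_integral_le_of_norm_le_const ?_
    filter_upwards [hC] with x hx
    refine (ContinuousLinearMap.opNorm_comp_le _ _).trans
      (mul_le_mul ((hgK _).trans ?_) hx (norm_nonneg _) (by positivity))
    refine mul_le_mul_of_nonneg_left ?_ hK
    have h2 := ((ℓ x).le_opNorm y).trans (mul_le_mul_of_nonneg_right hx (norm_nonneg _))
    nlinarith [norm_nonneg y]
  exact h1.trans (le_of_eq (by ring))

theorem exists_lipschitz_integralFDeriv (hg : ContDiff ℝ 1 g) (hℓ : MemLp ℓ ⊤ μ) {K : ℝ}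
    (hK : 0 ≤ K) (hgK : ∀ z z', ‖fderiv ℝ g z - fderiv ℝ g z'‖ ≤ K * ‖z - z'‖) :
    ∃ C, 0 ≤ C ∧ ∀ y y', ‖integralFDeriv μ g ℓ y - integralFDeriv μ g ℓ y'‖ ≤ C * ‖y - y'‖ := by
  obtain ⟨C, hC0, hC⟩ := hℓ.exists_ae_norm_le
  refine ⟨K * C * C * μ.real univ, by positivity, fun y y' => ?_⟩
  have h1 : ‖integralFDeriv μ g ℓ y - integralFDeriv μ g ℓ y'‖
      ≤ (K * (C * ‖y - y'‖) * C) * μ.real univ := by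
    rw [integralFDeriv, integralFDeriv,
      ← integral_sub ((memLp_fderiv_comp hg hℓ y).integrable le_top)
        ((memLp_fderiv_comp hg hℓ y').integrable le_top)]
    refine norm_integral_le_of_norm_le_const ?_
    filter_upwards [hC] with x hx
    rw [← ContinuousLinearMap.sub_comp]
    refine (ContinuousLinearMap.opNorm_comp_le _ _).trans
      (mul_le_mul ((hgK _ _).trans ?_) hx (norm_nonneg _) (by positivity))
    refine mul_le_mul_of_nonneg_left ?_ hK
    rw [← map_sub]
    exact ((ℓ x).le_opNorm _).trans (mul_le_mul_of_nonneg_right hx (norm_nonneg _))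
  exact h1.trans (le_of_eq (by ring))

end Nemytskii

/-! ### Piecewise affine functions -/

namespace Triangulation

variable {d : ℕ} (T : Triangulation d)

theorem isCompact_space : IsCompact T.toSimplicialComplex.space :=
  T.finite_faces.isCompact_biUnion fun s _ => s.finite_toSet.isCompact_convexHull ℝ

theorem domain_subset_space : T.domain ⊆ T.toSimplicialComplex.space := interior_subset

theorem frontier_domain_subset_space : frontier T.domain ⊆ T.toSimplicialComplex.space :=
  frontier_subset_closure.trans
    (closure_minimal T.domain_subset_space T.isCompact_space.isClosed)

theorem isOpen_domain : IsOpen T.domain := isOpen_interior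

theorem volume_domain_lt_top : volume T.domain < ⊤ :=
  (measure_mono T.domain_subset_space).trans_lt T.isCompact_space.measure_lt_top

instance isFiniteMeasure_domain : IsFiniteMeasure (volume.restrict T.domain) :=
  ⟨by rw [Measure.restrict_apply_univ]; exact T.volume_domain_lt_top⟩

/-- Boundaries of convex sets are null sets. This also discards lower-dimensional faces, whose hulls
have empty interior and so lie in their own frontier. -/
theorem ae_exists_mem_interior : ∀ᵐ x ∂(volume : Measure (Vec d)),
    x ∈ T.toSimplicialComplex.space →
      ∃ s ∈ T.faces, x ∈ interior (convexHull ℝ (s : Set (Vec d))) := by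
  have h1 : ∀ᵐ x ∂(volume : Measure (Vec d)), ∀ s ∈ T.faces,
      x ∉ frontier (convexHull ℝ (s : Set (Vec d))) := by
    rw [ae_ball_iff T.finite_faces.countable]
    intro s _
    exact measure_eq_zero_iff_ae_notMem.1 ((convex_convexHull ℝ _).addHaar_frontier volume)
  filter_upwards [h1] with x hx hxs
  obtain ⟨s, hs, hxs⟩ := Geometry.SimplicialComplex.mem_space_iff.1 hxs
  refine ⟨s, hs, ?_⟩
  by_contra h2
  exact hx s hs ⟨subset_closure hxs, h2⟩

variable {T}

/-- Inside an element the function agrees with an affine one near the point, so the gradient takes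
almost everywhere one of finitely many values. -/
theorem PiecewiseAffine.ae_differentiableAt {f : Vec d → ℝ} (hf : T.PiecewiseAffine f) :
    ∃ C : ℝ, ∀ᵐ x ∂volume.restrict T.domain, DifferentiableAt ℝ f x ∧ ‖fderiv ℝ f x‖ ≤ C := by
  have h1 : ∀ s, ∃ g : Vec d →ᵃ[ℝ] ℝ, s ∈ T.faces →
      EqOn f g (convexHull ℝ (s : Set (Vec d))) := by
    intro s
    by_cases hs : s ∈ T.faces
    · obtain ⟨g, hg⟩ := hf.2 s hs
      exact ⟨g, fun _ => hg⟩
    · exact ⟨0, fun h => absurd h hs⟩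
  choose g hg using h1
  obtain ⟨C, hC⟩ := (T.finite_faces.image
    fun s => ‖LinearMap.toContinuousLinearMap (g s).linear‖).bddAbove
  refine ⟨C, ?_⟩
  filter_upwards [ae_restrict_of_ae T.ae_exists_mem_interior,
    ae_restrict_mem T.isOpen_domain.measurableSet] with x hx hxT
  obtain ⟨s, hs, hxs⟩ := hx (T.domain_subset_space hxT)
  have h2 : HasFDerivAt f (LinearMap.toContinuousLinearMap (g s).linear) x := by
    have h3 : HasFDerivAt (fun y => LinearMap.toContinuousLinearMap (g s).linear y + g s 0)
        (LinearMap.toContinuousLinearMap (g s).linear) x :=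
      (ContinuousLinearMap.hasFDerivAt _).add_const _
    refine h3.congr_of_eventuallyEq ?_
    filter_upwards [mem_interior_iff_mem_nhds.1 hxs] with y hy
    rw [hg s hs hy, AffineMap.decomp (g s)]
    simp
  refine ⟨h2.differentiableAt, ?_⟩
  rw [h2.fderiv]
  exact hC (mem_image_of_mem _ hs)

theorem PiecewiseAffine.memLp_top {f : Vec d → ℝ} (hf : T.PiecewiseAffine f) (μ : Measure (Vec d))
    {s : Set (Vec d)} (hs : MeasurableSet s) (hsT : s ⊆ T.toSimplicialComplex.space) :
    MemLp f ⊤ (μ.restrict s) := by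
  obtain ⟨C, hC⟩ := T.isCompact_space.exists_bound_of_continuousOn hf.1
  exact memLp_top_of_bound ((hf.1.mono hsT).aestronglyMeasurable hs) C
    ((ae_restrict_mem hs).mono fun x hx => hC x (hsT hx))

theorem PiecewiseAffine.memLp_top_fderiv {f : Vec d → ℝ} (hf : T.PiecewiseAffine f) :
    MemLp (fderiv ℝ f) ⊤ (volume.restrict T.domain) := by
  obtain ⟨C, hC⟩ := hf.ae_differentiableAt
  exact memLp_top_of_bound (measurable_fderiv ℝ f).aestronglyMeasurable C
    (hC.mono fun x hx => hx.2)

end Triangulation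

/-- A quadratic form is half its polar form on the diagonal; in finite dimension the polar form is
continuous, so the derivative is linear in the point. -/
theorem exists_contDiff_of_quadraticForm {Z : Type*} [NormedAddCommGroup Z] [NormedSpace ℝ Z]
    [FiniteDimensional ℝ Z] (Q : QuadraticForm ℝ Z) :
    ContDiff ℝ 1 Q ∧ ∃ K, 0 ≤ K ∧ ∀ z, ‖fderiv ℝ Q z‖ ≤ K * (1 + ‖z‖) := by
  let A : Z →ₗ[ℝ] Z →L[ℝ] ℝ :=
    (LinearMap.toContinuousLinearMap (𝕜 := ℝ) (E := Z) (F' := ℝ)).toLinearMap.comp Q.polarBilin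
  let A' : Z →L[ℝ] Z →L[ℝ] ℝ := LinearMap.toContinuousLinearMap A
  have hQ : (Q : Z → ℝ) = fun z => (1 / 2 : ℝ) * A' z z := by
    funext z
    have h1 : A' z z = QuadraticMap.polar Q z z := rfl
    rw [h1, QuadraticMap.polar_self]
    simp
  have hd : ∀ z, HasFDerivAt (fun z => (1 / 2 : ℝ) * A' z z)
      ((1 / 2 : ℝ) • (A' z + A'.flip z)) z := by
    intro z
    have h1 := (A'.hasFDerivAt (x := z)).clm_apply (hasFDerivAt_id z)
    refine (h1.const_mul (1 / 2 : ℝ)).congr_fderiv ?_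
    ext y
    simp
  refine ⟨?_, ‖A'‖, norm_nonneg A', fun z => ?_⟩
  · rw [hQ]
    exact contDiff_const.mul (A'.contDiff.clm_apply contDiff_id)
  · rw [hQ, (hd z).fderiv, norm_smul]
    have h1 : ‖A' z + A'.flip z‖ ≤ ‖A'‖ * ‖z‖ + ‖A'‖ * ‖z‖ := by
      refine (norm_add_le _ _).trans (add_le_add (A'.le_opNorm z) ?_)
      have h2 := A'.flip.le_opNorm z
      rwa [A'.opNorm_flip] at h2
    have h2 := norm_nonneg A'
    rw [Real.norm_of_nonneg (by norm_num)]
    linarith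

/-- The gradient of a function with Hessian bounded from below is strongly monotone. -/
theorem le_fderiv_sub_fderiv_apply {Z : Type*} [NormedAddCommGroup Z] [NormedSpace ℝ Z]
    {f : Z → ℝ} (hf : ContDiff ℝ 2 f) {γ : ℝ}
    (h : ∀ ζ ξ, γ * ‖ξ‖ ^ 2 ≤ fderiv ℝ (fderiv ℝ f) ζ ξ ξ) (z z' : Z) :
    γ * ‖z - z'‖ ^ 2 ≤ (fderiv ℝ f z - fderiv ℝ f z') (z - z') := by
  have hd : Differentiable ℝ (fderiv ℝ f) :=
    (hf.fderiv_right (m := 1) (by norm_num)).differentiable one_ne_zero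
  have hderiv : ∀ s : ℝ, HasDerivAt (fun s : ℝ => fderiv ℝ f (z' + s • (z - z')) (z - z'))
      (fderiv ℝ (fderiv ℝ f) (z' + s • (z - z')) (z - z') (z - z')) s := by
    intro s
    have h1 : HasDerivAt (fun s : ℝ => z' + s • (z - z')) (z - z') s := by
      simpa using ((hasDerivAt_id s).smul_const (z - z')).const_add z'
    have h2 := (hd (z' + s • (z - z'))).hasFDerivAt.comp_hasDerivAt s h1
    simpa using h2.clm_apply (hasDerivAt_const s (z - z'))
  -- Mean value theorem for the gradient paired with `z - z'` along the segment.
  obtain ⟨s, -, hs⟩ := exists_hasDerivAt_eq_slope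
    (fun s : ℝ => fderiv ℝ f (z' + s • (z - z')) (z - z')) _ one_pos
    (fun s _ => (hderiv s).continuousAt.continuousWithinAt) (fun s _ => hderiv s)
  have h3 := h (z' + s • (z - z')) (z - z')
  rw [hs] at h3
  simpa using h3

namespace Body

variable {d k : ℕ} (B : Body d k)

/-! ### Fields as linear functions of the nodal values -/

/-- The value at `x` of the field with given nodal values, as a linear map. -/
def fieldCLM {n : ℕ} (x : Vec d) : (B.Node → Vec n) →L[ℝ] Vec n :=
  sumSMulCLM fun a => B.shape a x

/-- The gradient at `x` of the field with given nodal values, as a linear map. -/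
def gradCLM {n : ℕ} (x : Vec d) : (B.Node → Vec n) →L[ℝ] Grad d n :=
  sumTensorCLM fun a => fderiv ℝ (B.shape a) x

/-- The strain variables at `x`, as a linear function of the nodal values. -/
def strainCLM (x : Vec d) : B.State →L[ℝ] Grad d d × Vec k × Grad d k :=
  ((B.gradCLM x).comp (ContinuousLinearMap.fst ℝ _ _)).prod
    (((B.fieldCLM x).comp (ContinuousLinearMap.snd ℝ _ _)).prod
      ((B.gradCLM x).comp (ContinuousLinearMap.snd ℝ _ _)))

/-- The values at `x` of a pair of fields, as a linear function of the nodal values. -/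
def pairCLM {n m : ℕ} (x : Vec d) :
    (B.Node → Vec n) × (B.Node → Vec m) →L[ℝ] Vec n × Vec m :=
  ((B.fieldCLM x).comp (ContinuousLinearMap.fst ℝ _ _)).prod
    ((B.fieldCLM x).comp (ContinuousLinearMap.snd ℝ _ _))

theorem fieldCLM_apply {n : ℕ} (x : Vec d) (c : B.Node → Vec n) :
    B.fieldCLM x c = B.field c x := by
  simp [fieldCLM, sumSMulCLM, field]

theorem pairCLM_apply {n m : ℕ} (x : Vec d) (s : (B.Node → Vec n) × (B.Node → Vec m)) :
    B.pairCLM x s = (B.field s.1 x, B.field s.2 x) := by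
  simp [pairCLM, fieldCLM_apply]

open Classical in
theorem fieldCLM_single {n : ℕ} (x : Vec d) (a : B.Node) (ξ : Vec n) :
    B.fieldCLM x (Pi.single a ξ) = B.shape a x • ξ := by
  rw [fieldCLM_apply, field, Finset.sum_eq_single a]
  · simp
  · intro b _ hb; simp [hb]
  · simp

open Classical in
theorem gradCLM_single {n : ℕ} (x : Vec d) (a : B.Node) (ξ : Vec n) :
    B.gradCLM x (Pi.single a ξ) = B.tensorShape a ξ x := by
  rw [gradCLM, sumTensorCLM, _root_.sum_apply, Finset.sum_eq_single a]
  · simp [tensorShape, tensorCLM_apply]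
  · intro b _ hb; simp [hb]
  · simp

variable {B}

theorem Standing.memLp_fieldCLM (hB : B.Standing) {n : ℕ} (μ : Measure (Vec d)) {s : Set (Vec d)}
    (hs : MeasurableSet s) (hsB : s ⊆ B.mesh.toSimplicialComplex.space) :
    MemLp (fun x => B.fieldCLM (n := n) x) ⊤ (μ.restrict s) :=
  memLp_top_sumSMulCLM fun a => (hB.shape_pa a).memLp_top μ hs hsB

theorem Standing.memLp_gradCLM (hB : B.Standing) {n : ℕ} :
    MemLp (fun x => B.gradCLM (n := n) x) ⊤ (volume.restrict B.domain) :=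
  memLp_top_sumTensorCLM fun a => (hB.shape_pa a).memLp_top_fderiv

theorem Standing.memLp_fieldCLM_domain (hB : B.Standing) {n : ℕ} :
    MemLp (fun x => B.fieldCLM (n := n) x) ⊤ (volume.restrict B.domain) :=
  hB.memLp_fieldCLM volume B.mesh.isOpen_domain.measurableSet B.mesh.domain_subset_space

theorem Standing.memLp_strainCLM (hB : B.Standing) :
    MemLp B.strainCLM ⊤ (volume.restrict B.domain) :=
  memLp_top_clm_prod (memLp_top_clm_comp_const hB.memLp_gradCLM _)
    (memLp_top_clm_prod (memLp_top_clm_comp_const hB.memLp_fieldCLM_domain _)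
      (memLp_top_clm_comp_const hB.memLp_gradCLM _))

theorem Standing.memLp_pairCLM (hB : B.Standing) {n m : ℕ} :
    MemLp (fun x => B.pairCLM (n := n) (m := m) x) ⊤ (volume.restrict B.domain) :=
  memLp_top_clm_prod (memLp_top_clm_comp_const hB.memLp_fieldCLM_domain _)
    (memLp_top_clm_comp_const hB.memLp_fieldCLM_domain _)

/-- Gradients defined by `fderiv` are linear in the nodal values only where all shape functions are
differentiable. The exceptional null set is the same for all states. -/
theorem Standing.ae_strain_eq (hB : B.Standing) :
    ∀ᵐ x ∂volume.restrict B.domain, ∀ s : B.State, B.strain s x = B.strainCLM x s := by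
  have h1 : ∀ᵐ x ∂volume.restrict B.domain, ∀ a, DifferentiableAt ℝ (B.shape a) x := by
    rw [ae_all_iff]
    intro a
    obtain ⟨C, hC⟩ := (hB.shape_pa a).ae_differentiableAt
    exact hC.mono fun x hx => hx.1
  filter_upwards [h1] with x hx s
  have hgrad : ∀ {n : ℕ} (c : B.Node → Vec n), B.grad c x = B.gradCLM x c := by
    intro n c
    have h2 : HasFDerivAt (B.field c) (∑ a, (fderiv ℝ (B.shape a) x).smulRight (c a)) x :=
      HasFDerivAt.fun_sum fun a _ => (hx a).hasFDerivAt.smul_const (c a)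
    rw [grad, h2.fderiv, gradCLM, sumTensorCLM, _root_.sum_apply]
    simp [tensorCLM_apply]
  simp only [strain, strainCLM, hgrad, ← fieldCLM_apply]
  rfl

/-! ### Partial derivatives of the densities -/

theorem deF_eq (h : Differentiable ℝ B.e) (z : Grad d d × Vec k × Grad d k) (U : Grad d d) :
    B.deF z U = fderiv ℝ B.e z (U, 0, 0) := by
  have h1 : HasFDerivAt (fun F => B.e (F, z.2.1, z.2.2))
      ((fderiv ℝ B.e z).comp (ContinuousLinearMap.inl ℝ _ _)) z.1 :=
    (h z).hasFDerivAt.comp (f := fun F => (F, z.2.1, z.2.2)) z.1 (hasFDerivAt_prodMk_left _ _)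
  rw [deF, h1.fderiv]
  rfl

theorem deNu_eq (h : Differentiable ℝ B.e) (z : Grad d d × Vec k × Grad d k) (n : Vec k) :
    B.deNu z n = fderiv ℝ B.e z (0, n, 0) := by
  have h1 : HasFDerivAt (fun n => B.e (z.1, n, z.2.2))
      ((fderiv ℝ B.e z).comp ((ContinuousLinearMap.inr ℝ _ _).comp
        (ContinuousLinearMap.inl ℝ _ _))) z.2.1 :=
    (h z).hasFDerivAt.comp (f := fun n => (z.1, n, z.2.2)) z.2.1
      ((hasFDerivAt_prodMk_right z.1 (z.2.1, z.2.2)).comp (f := fun n => (n, z.2.2)) z.2.1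
        (hasFDerivAt_prodMk_left _ _))
  rw [deNu, h1.fderiv]
  rfl

theorem deN_eq (h : Differentiable ℝ B.e) (z : Grad d d × Vec k × Grad d k) (N : Grad d k) :
    B.deN z N = fderiv ℝ B.e z (0, 0, N) := by
  have h1 : HasFDerivAt (fun N => B.e (z.1, z.2.1, N))
      ((fderiv ℝ B.e z).comp ((ContinuousLinearMap.inr ℝ _ _).comp
        (ContinuousLinearMap.inr ℝ _ _))) z.2.2 :=
    (h z).hasFDerivAt.comp (f := fun N => (z.1, z.2.1, N)) z.2.2
      ((hasFDerivAt_prodMk_right z.1 (z.2.1, z.2.2)).comp (f := fun N => (z.2.1, N)) z.2.2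
        (hasFDerivAt_prodMk_right _ _))
  rw [deN, h1.fderiv]
  rfl

theorem dwU_eq (h : Differentiable ℝ B.w) (u ξ : Vec d) (n : Vec k) :
    B.dwU u n ξ = fderiv ℝ B.w (u, n) (ξ, 0) := by
  have h1 := (h (u, n)).hasFDerivAt.comp (f := fun y => (y, n)) u (hasFDerivAt_prodMk_left u n)
  have h2 : B.dwU u n = _ := h1.fderiv
  rw [h2]
  rfl

theorem dwNu_eq (h : Differentiable ℝ B.w) (u : Vec d) (n ξ : Vec k) :
    B.dwNu u n ξ = fderiv ℝ B.w (u, n) (0, ξ) := by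
  have h1 := (h (u, n)).hasFDerivAt.comp (f := fun y => (u, y)) n (hasFDerivAt_prodMk_right u n)
  have h2 : B.dwNu u n = _ := h1.fderiv
  rw [h2]
  rfl

theorem dchiNu_eq (h : Differentiable ℝ B.chi) (n ζ ξ : Vec k) :
    B.dchiNu n ζ ξ = fderiv ℝ B.chi (n, ζ) (ξ, 0) := by
  have h1 := (h (n, ζ)).hasFDerivAt.comp (f := fun y => (y, ζ)) n (hasFDerivAt_prodMk_left n ζ)
  have h2 : B.dchiNu n ζ = _ := h1.fderiv
  rw [h2]
  rfl

theorem dchiRate_eq (h : Differentiable ℝ B.chi) (n ζ ξ : Vec k) :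
    B.dchiRate n ζ ξ = fderiv ℝ B.chi (n, ζ) (0, ξ) := by
  have h1 := (h (n, ζ)).hasFDerivAt.comp (f := fun y => (n, y)) ζ (hasFDerivAt_prodMk_right n ζ)
  have h2 : B.dchiRate n ζ = _ := h1.fderiv
  rw [h2]
  rfl

/-! ### The potential energy -/

variable (B) in
/-- The work of the traction, as a linear function of the nodal displacements. -/
def tractionCLM : (B.Node → Vec d) →L[ℝ] ℝ :=
  ∫ x in B.tractionSet, (innerSL ℝ (B.traction x)).comp (B.fieldCLM x) ∂B.surface

theorem Standing.isFiniteMeasure_surface (hB : B.Standing) : IsFiniteMeasure B.surface :=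
  ⟨hB.boundary_finite⟩

/-- On a boundary of finite area an `L²` traction is `L¹`, and it is paired with bounded shape
functions. -/
theorem Standing.integrable_traction (hB : B.Standing) (h3 : B.A3) :
    Integrable (fun x => (innerSL ℝ (B.traction x)).comp (B.fieldCLM (n := d) x))
      (B.surface.restrict B.tractionSet) := by
  have := hB.isFiniteMeasure_surface
  have h1 : Integrable B.traction B.surface := h3.1.integrable (by norm_num)
  have h2 : MemLp (fun x => B.fieldCLM (n := d) x) ⊤ B.surface :=
    hB.memLp_fieldCLM _ isClosed_frontier.measurableSet B.mesh.frontier_domain_subset_space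
  obtain ⟨C, hC0, hC⟩ := h2.exists_ae_norm_le
  refine Integrable.restrict ?_
  refine (h1.norm.mul_const C).mono' ?_ ?_
  · have h4 : AEStronglyMeasurable (fun x => innerSL ℝ (B.traction x)) B.surface :=
      (innerSL ℝ).continuous.comp_aestronglyMeasurable h1.1
    exact isBoundedBilinearMap_comp.continuous.comp_aestronglyMeasurable (h4.prodMk h2.1)
  · filter_upwards [hC] with x hx
    refine (ContinuousLinearMap.opNorm_comp_le _ _).trans ?_
    rw [innerSL_apply_norm]
    exact mul_le_mul_of_nonneg_left hx (norm_nonneg _)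

theorem Standing.tractionCLM_apply (hB : B.Standing) (h3 : B.A3) (u : B.Node → Vec d) :
    B.tractionCLM u = ∫ x in B.tractionSet, inner ℝ (B.traction x) (B.field u x) ∂B.surface := by
  rw [tractionCLM, ContinuousLinearMap.integral_apply (hB.integrable_traction h3)]
  simp [fieldCLM_apply]

theorem A1.contDiff (h1 : B.A1) : ContDiff ℝ 1 B.e ∧
    ∃ K, 0 ≤ K ∧ ∀ z, ‖fderiv ℝ B.e z‖ ≤ K * (1 + ‖z‖) := by
  obtain ⟨-, ⟨Q, hQ⟩, -⟩ := h1
  have h2 : B.e = Q := funext hQ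
  rw [h2]
  exact exists_contDiff_of_quadraticForm Q

variable (B) in
/-- The derivative of the potential energy. -/
def potentialD (s : B.State) : B.State →L[ℝ] ℝ :=
  integralFDeriv (volume.restrict B.domain) B.e B.strainCLM s
    + integralFDeriv (volume.restrict B.domain) B.w (fun x => B.pairCLM x) s
    - B.tractionCLM.comp (ContinuousLinearMap.fst ℝ _ _)

theorem Standing.hasFDerivAt_potential (hB : B.Standing) (h1 : B.A1) (h2 : B.A2) (h3 : B.A3)
    (s : B.State) : HasFDerivAt B.potential (B.potentialD s) s := by
  have he := h1.contDiff.1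
  have h4 : B.potential = fun s => (∫ x in B.domain, B.e (B.strainCLM x s))
      + (∫ x in B.domain, B.w (B.pairCLM x s)) - B.tractionCLM s.1 := by
    funext s
    rw [potential, hB.tractionCLM_apply h3, ← integral_add
      ((memLp_top_comp he.continuous (memLp_top_apply hB.memLp_strainCLM s)).integrable le_top)
      ((memLp_top_comp h2.1.continuous (memLp_top_apply hB.memLp_pairCLM s)).integrable le_top)]
    congr 1
    refine integral_congr_ae ?_
    filter_upwards [hB.ae_strain_eq] with x hx
    rw [hx, pairCLM_apply]
  have h5 : HasFDerivAt (fun s : B.State => B.tractionCLM s.1)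
      (B.tractionCLM.comp (ContinuousLinearMap.fst ℝ _ _)) s :=
    B.tractionCLM.hasFDerivAt.comp s hasFDerivAt_fst
  rw [h4]
  exact ((hasFDerivAt_integral_comp he hB.memLp_strainCLM s).add
    (hasFDerivAt_integral_comp h2.1 hB.memLp_pairCLM s)).sub h5

theorem Standing.continuous_potentialD (hB : B.Standing) (h1 : B.A1) (h2 : B.A2) :
    Continuous B.potentialD :=
  ((continuous_integralFDeriv h1.contDiff.1 hB.memLp_strainCLM).add
    (continuous_integralFDeriv h2.1 hB.memLp_pairCLM)).sub continuous_const

theorem Standing.exists_norm_potentialD_le (hB : B.Standing) (h1 : B.A1) (h2 : B.A2) :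
    ∃ C, 0 ≤ C ∧ ∀ s, ‖B.potentialD s‖ ≤ C * (1 + ‖s‖) := by
  obtain ⟨-, K, hK, he⟩ := h1.contDiff
  obtain ⟨-, -, Xi, hXi, hw⟩ := h2
  obtain ⟨C₁, hC₁, hb₁⟩ := exists_norm_integralFDeriv_le hB.memLp_strainCLM hK he
  -- The factor 2 bounds the sum of the norms of the two components by the maximum norm of the pair.
  obtain ⟨C₂, hC₂, hb₂⟩ := exists_norm_integralFDeriv_le (g := B.w) (K := 2 * Xi)
    (hB.memLp_pairCLM (n := d) (m := k)) (by positivity) (fun z => by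
      refine (hw z.1 z.2).trans ?_
      have h3 := norm_fst_le z
      have h4 := norm_snd_le z
      rw [mul_comm 2 Xi, mul_assoc]
      exact mul_le_mul_of_nonneg_left (by linarith [norm_nonneg z.1]) hXi.le)
  set A := B.tractionCLM.comp (ContinuousLinearMap.fst ℝ (B.Node → Vec d) (B.Node → Vec k))
  refine ⟨C₁ + C₂ + ‖A‖, by positivity, fun s => ?_⟩
  refine (norm_sub_le _ _).trans ((add_le_add (norm_add_le _ _) le_rfl).trans ?_)
  have h5 : ‖A‖ ≤ ‖A‖ * (1 + ‖s‖) := by nlinarith [norm_nonneg A, norm_nonneg s]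
  have h6 := hb₁ s
  have h7 := hb₂ s
  change _ + _ + ‖A‖ ≤ _
  linarith

open Classical in
theorem pairCLM_inr_single {n m : ℕ} (x : Vec d) (a : B.Node) (ξ : Vec m) :
    B.pairCLM x ((0, Pi.single a ξ) : (B.Node → Vec n) × (B.Node → Vec m))
      = (0, B.shape a x • ξ) := by
  simp [pairCLM, fieldCLM_single]

open Classical in
theorem pairCLM_inl_single {n m : ℕ} (x : Vec d) (a : B.Node) (ξ : Vec n) :
    B.pairCLM x ((Pi.single a ξ, 0) : (B.Node → Vec n) × (B.Node → Vec m))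
      = (B.shape a x • ξ, 0) := by
  simp [pairCLM, fieldCLM_single]

open Classical in
-- The nodal load is the derivative of the potential energy in the direction of one shape function,
-- which links the strong-form integrals to the abstract force.
theorem Standing.loadU_eq (hB : B.Standing) (h1 : B.A1) (h2 : B.A2) (h3 : B.A3) (a : B.Node)
    (s : B.State) (ξ : Vec d) : B.loadU a s ξ = B.potentialD s (Pi.single a ξ, 0) := by
  have he := h1.contDiff.1
  have e1 : integralFDeriv (volume.restrict B.domain) B.e B.strainCLM s (Pi.single a ξ, 0)
      = ∫ x in B.domain, B.deF (B.strain s x) (B.tensorShape a ξ x) := by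
    rw [integralFDeriv_apply he hB.memLp_strainCLM]
    refine integral_congr_ae ?_
    filter_upwards [hB.ae_strain_eq] with x hx
    have h4 : B.strainCLM x (Pi.single a ξ, 0) = (B.tensorShape a ξ x, 0, 0) := by
      simp [strainCLM, gradCLM_single]
    rw [h4, deF_eq (he.differentiable one_ne_zero), hx]
  have e2 : integralFDeriv (volume.restrict B.domain) B.w (fun x => B.pairCLM x) s
      (Pi.single a ξ, 0)
      = ∫ x in B.domain, B.dwU (B.field s.1 x) (B.field s.2 x) (B.shape a x • ξ) := by
    rw [integralFDeriv_apply h2.1 hB.memLp_pairCLM]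
    congr 1
    funext x
    rw [pairCLM_inl_single, dwU_eq (h2.1.differentiable one_ne_zero), pairCLM_apply]
  have e3 : B.tractionCLM (Pi.single a ξ)
      = ∫ x in B.tractionSet, inner ℝ (B.shape a x • B.traction x) ξ ∂B.surface := by
    rw [hB.tractionCLM_apply h3]
    congr 1
    funext x
    rw [← fieldCLM_apply, fieldCLM_single, real_inner_smul_left, real_inner_smul_right]
  rw [loadU, ← e1, ← e2, ← e3]
  rfl

theorem Standing.memLp_shape_smul (hB : B.Standing) {n : ℕ} (a : B.Node) (ξ : Vec n) :
    MemLp (fun x => B.shape a x • ξ) ⊤ (volume.restrict B.domain) := by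
  classical
  have h1 := memLp_top_apply (hB.memLp_fieldCLM_domain (n := n)) (Pi.single a ξ)
  simpa only [fieldCLM_single] using h1

theorem Standing.memLp_tensorShape (hB : B.Standing) {n : ℕ} (a : B.Node) (ξ : Vec n) :
    MemLp (fun x => B.tensorShape a ξ x) ⊤ (volume.restrict B.domain) := by
  classical
  have h1 := memLp_top_apply (hB.memLp_gradCLM (n := n)) (Pi.single a ξ)
  simpa only [gradCLM_single] using h1

theorem Standing.integral_deN (hB : B.Standing) (h1 : B.A1) (a : B.Node) (s : B.State)
    (ξ : Vec k) : (∫ x in B.domain, B.deN (B.strain s x) (B.tensorShape a ξ x))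
      = ∫ x in B.domain, fderiv ℝ B.e (B.strainCLM x s) (0, 0, B.tensorShape a ξ x) := by
  refine integral_congr_ae ?_
  filter_upwards [hB.ae_strain_eq] with x hx
  rw [hx, deN_eq (h1.contDiff.1.differentiable one_ne_zero)]

theorem Standing.memLp_shape_smul_strain (hB : B.Standing) (a : B.Node) (ξ : Vec k) :
    MemLp (fun x => ((0, B.shape a x • ξ, 0) : Grad d d × Vec k × Grad d k)) ⊤
      (volume.restrict B.domain) :=
  ((ContinuousLinearMap.inr ℝ (Grad d d) (Vec k × Grad d k)).comp
    (ContinuousLinearMap.inl ℝ (Vec k) (Grad d k))).comp_memLp' (hB.memLp_shape_smul a ξ)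

theorem Standing.memLp_tensorShape_strain (hB : B.Standing) (a : B.Node) (ξ : Vec k) :
    MemLp (fun x => ((0, 0, B.tensorShape a ξ x) : Grad d d × Vec k × Grad d k)) ⊤
      (volume.restrict B.domain) :=
  ((ContinuousLinearMap.inr ℝ (Grad d d) (Vec k × Grad d k)).comp
    (ContinuousLinearMap.inr ℝ (Vec k) (Grad d k))).comp_memLp' (hB.memLp_tensorShape a ξ)

theorem Standing.memLp_shape_smul_pair (hB : B.Standing) {n m : ℕ} (a : B.Node) (ξ : Vec m) :
    MemLp (fun x => ((0, B.shape a x • ξ) : Vec n × Vec m)) ⊤ (volume.restrict B.domain) :=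
  (ContinuousLinearMap.inr ℝ (Vec n) (Vec m)).comp_memLp' (hB.memLp_shape_smul a ξ)

open Classical in
theorem strainCLM_inr_single (x : Vec d) (a : B.Node) (ξ : Vec k) :
    B.strainCLM x (0, Pi.single a ξ) = (0, 0, B.tensorShape a ξ x) + (0, B.shape a x • ξ, 0) := by
  simp [strainCLM, gradCLM_single, fieldCLM_single]

theorem Standing.integral_deNu_add_dwNu (hB : B.Standing) (h1 : B.A1) (h2 : B.A2) (a : B.Node)
    (s : B.State) (ξ : Vec k) : (∫ x in B.domain, (B.deNu (B.strain s x) (B.shape a x • ξ)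
        + B.dwNu (B.field s.1 x) (B.field s.2 x) (B.shape a x • ξ)))
      = (∫ x in B.domain, fderiv ℝ B.e (B.strainCLM x s) (0, B.shape a x • ξ, 0))
        + ∫ x in B.domain, fderiv ℝ B.w (B.pairCLM x s) (0, B.shape a x • ξ) := by
  have he := h1.contDiff.1
  rw [← integral_add
    (integrable_fderiv_apply he hB.memLp_strainCLM s (hB.memLp_shape_smul_strain a ξ))
    (integrable_fderiv_apply h2.1 hB.memLp_pairCLM s (hB.memLp_shape_smul_pair a ξ))]
  refine integral_congr_ae ?_
  filter_upwards [hB.ae_strain_eq] with x hx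
  rw [hx, deNu_eq (he.differentiable one_ne_zero), dwNu_eq (h2.1.differentiable one_ne_zero),
    pairCLM_apply]

open Classical in
theorem Standing.loadNu_eq (hB : B.Standing) (h1 : B.A1) (h2 : B.A2) (a : B.Node)
    (s : B.State) (ξ : Vec k) : B.loadNu a s ξ = B.potentialD s (0, Pi.single a ξ) := by
  have e1 := integralFDeriv_apply_add h1.contDiff.1 hB.memLp_strainCLM s (0, Pi.single a ξ)
    (hB.memLp_tensorShape_strain a ξ) (hB.memLp_shape_smul_strain a ξ)
    (fun x => strainCLM_inr_single x a ξ)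
  have e2 : integralFDeriv (volume.restrict B.domain) B.w (fun x => B.pairCLM x) s
      (0, Pi.single a ξ) = ∫ x in B.domain, fderiv ℝ B.w (B.pairCLM x s) (0, B.shape a x • ξ) := by
    rw [integralFDeriv_apply h2.1 hB.memLp_pairCLM]
    simp only [pairCLM_inr_single]
  have e5 : B.potentialD s (0, Pi.single a ξ) =
      integralFDeriv (volume.restrict B.domain) B.e B.strainCLM s (0, Pi.single a ξ)
      + integralFDeriv (volume.restrict B.domain) B.w (fun x => B.pairCLM x) s
        (0, Pi.single a ξ) := by
    simp [potentialD]
  rw [loadNu, hB.integral_deN h1, hB.integral_deNu_add_dwNu h1 h2, e5, e1, e2, add_assoc]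

end Body

/-! ### Systems derived from a Lagrangian -/

section Lagrangian

variable {U N : Type*} [NormedAddCommGroup U] [NormedSpace ℝ U] [NormedAddCommGroup N]
  [NormedSpace ℝ N]

/-- The momentum of a Lagrangian with kinetic energy of derivative `A` in the first component and
co-energy of derivative `D` in the second one. -/
def lagrangianMomentum (A : U →L[ℝ] U →L[ℝ] ℝ) (D : N × N → N × N →L[ℝ] ℝ)
    (z : (U × N) × (U × N)) : U × N →L[ℝ] ℝ :=
  (A z.2.1).comp (ContinuousLinearMap.fst ℝ U N)
    + ((D (z.1.2, z.2.2)).comp (ContinuousLinearMap.inr ℝ N N)).comp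
      (ContinuousLinearMap.snd ℝ U N)

/-- The force of a Lagrangian with co-energy of derivative `D`, potential of derivative `V` and
dissipation `H`. -/
def lagrangianForce (D : N × N → N × N →L[ℝ] ℝ) (H : N →L[ℝ] N →L[ℝ] ℝ)
    (V : U × N → U × N →L[ℝ] ℝ) (z : (U × N) × (U × N)) : U × N →L[ℝ] ℝ :=
  (((D (z.1.2, z.2.2)).comp (ContinuousLinearMap.inl ℝ N N)) + H z.2.2).comp
      (ContinuousLinearMap.snd ℝ U N) - V z.1

theorem lagrangianMomentum_apply (A : U →L[ℝ] U →L[ℝ] ℝ) (D : N × N → N × N →L[ℝ] ℝ)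
    (z : (U × N) × (U × N)) (ρ : U × N) :
    lagrangianMomentum A D z ρ = A z.2.1 ρ.1 + D (z.1.2, z.2.2) (0, ρ.2) := by
  simp [lagrangianMomentum]

theorem lagrangianForce_apply (D : N × N → N × N →L[ℝ] ℝ) (H : N →L[ℝ] N →L[ℝ] ℝ)
    (V : U × N → U × N →L[ℝ] ℝ) (z : (U × N) × (U × N)) (δ : U × N) :
    lagrangianForce D H V z δ = D (z.1.2, z.2.2) (δ.2, 0) + H z.2.2 δ.2 - V z.1 δ := by
  simp [lagrangianForce]

variable {A : U →L[ℝ] U →L[ℝ] ℝ} {D : N × N → N × N →L[ℝ] ℝ} {H : N →L[ℝ] N →L[ℝ] ℝ}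
  {V : U × N → U × N →L[ℝ] ℝ}

theorem norm_comp_inr_comp_snd_le (L : N × N →L[ℝ] ℝ) :
    ‖(L.comp (ContinuousLinearMap.inr ℝ N N)).comp (ContinuousLinearMap.snd ℝ U N)‖ ≤ ‖L‖ := by
  refine ContinuousLinearMap.opNorm_le_bound _ (norm_nonneg _) fun δ => ?_
  simp only [ContinuousLinearMap.comp_apply, ContinuousLinearMap.coe_snd',
    ContinuousLinearMap.inr_apply]
  refine (L.le_opNorm _).trans (mul_le_mul_of_nonneg_left ?_ (norm_nonneg _))
  rw [Prod.norm_def, norm_zero, max_eq_right (norm_nonneg _)]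
  exact norm_snd_le δ

theorem norm_comp_inl_add_comp_snd_le (L : N × N →L[ℝ] ℝ) (l : N →L[ℝ] ℝ) :
    ‖(L.comp (ContinuousLinearMap.inl ℝ N N) + l).comp (ContinuousLinearMap.snd ℝ U N)‖
      ≤ ‖L‖ + ‖l‖ := by
  refine ContinuousLinearMap.opNorm_le_bound _ (by positivity) fun δ => ?_
  simp only [ContinuousLinearMap.comp_apply, ContinuousLinearMap.coe_snd',
    ContinuousLinearMap.inl_apply, add_apply]
  refine (norm_add_le _ _).trans ?_
  rw [add_mul]
  refine add_le_add ((L.le_opNorm _).trans (mul_le_mul_of_nonneg_left ?_ (norm_nonneg _)))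
    ((l.le_opNorm _).trans (mul_le_mul_of_nonneg_left (norm_snd_le δ) (norm_nonneg _)))
  rw [Prod.norm_def, norm_zero, max_eq_left (norm_nonneg _)]
  exact norm_snd_le δ

omit [NormedSpace ℝ U] [NormedSpace ℝ N] in
theorem norm_pair_snd_le (z : (U × N) × (U × N)) : ‖((z.1.2, z.2.2) : N × N)‖ ≤ ‖z‖ :=
  max_le ((norm_snd_le z.1).trans (norm_fst_le z)) ((norm_snd_le z.2).trans (norm_snd_le z))

theorem lipschitz_lagrangianMomentum {C : ℝ} (hC : 0 ≤ C)
    (hD : ∀ z z', ‖D z - D z'‖ ≤ C * ‖z - z'‖) (z z' : (U × N) × (U × N)) :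
    ‖lagrangianMomentum A D z - lagrangianMomentum A D z'‖ ≤ (‖A‖ + C) * ‖z - z'‖ := by
  have h1 : lagrangianMomentum A D z - lagrangianMomentum A D z'
      = (A (z.2.1 - z'.2.1)).comp (ContinuousLinearMap.fst ℝ U N)
        + ((D (z.1.2, z.2.2) - D (z'.1.2, z'.2.2)).comp (ContinuousLinearMap.inr ℝ N N)).comp
          (ContinuousLinearMap.snd ℝ U N) := by
    refine ContinuousLinearMap.ext fun δ => ?_
    simp only [sub_apply, lagrangianMomentum_apply, ContinuousLinearMap.comp_apply, add_apply,
      ContinuousLinearMap.coe_fst', ContinuousLinearMap.coe_snd', ContinuousLinearMap.inr_apply,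
      map_sub]
    ring
  rw [h1, add_mul]
  refine (norm_add_le _ _).trans (add_le_add ?_ ((norm_comp_inr_comp_snd_le _).trans
    ((hD _ _).trans (mul_le_mul_of_nonneg_left (norm_pair_snd_le (z - z')) hC))))
  refine (ContinuousLinearMap.opNorm_comp_le _ _).trans ?_
  have h2 : ‖A (z.2.1 - z'.2.1)‖ ≤ ‖A‖ * ‖z - z'‖ :=
    (A.le_opNorm _).trans (mul_le_mul_of_nonneg_left
      ((norm_fst_le (z - z').2).trans (norm_snd_le (z - z'))) (norm_nonneg _))
  exact (mul_le_of_le_one_right (norm_nonneg _) (ContinuousLinearMap.norm_fst_le ℝ U N)).trans h2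

/-- At a common position, displacement and descriptor rates decouple: the mass matrix controls one
part and the co-energy the other; the squared maximum norm is at most the sum of the squares. -/
theorem lagrangianMomentum_monotone {c : ℝ} (hc : 0 ≤ c) (hA : ∀ u, c * ‖u‖ ^ 2 ≤ A u u)
    (hDm : ∀ n r r', c * ‖r - r'‖ ^ 2 ≤ (D (n, r) - D (n, r')) (0, r - r')) (y v w : U × N) :
    c * ‖v - w‖ ^ 2 ≤ (lagrangianMomentum A D (y, v) - lagrangianMomentum A D (y, w)) (v - w) := by
  have h1 : (lagrangianMomentum A D (y, v) - lagrangianMomentum A D (y, w)) (v - w)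
      = A (v.1 - w.1) (v.1 - w.1) + (D (y.2, v.2) - D (y.2, w.2)) (0, v.2 - w.2) := by
    rw [sub_apply, lagrangianMomentum_apply, lagrangianMomentum_apply, A.map_sub, sub_apply,
      sub_apply, Prod.fst_sub, Prod.snd_sub]
    ring
  rw [h1]
  have h2 := hA (v.1 - w.1)
  have h3 := hDm y.2 v.2 w.2
  have h4 : ‖v - w‖ ^ 2 ≤ ‖v.1 - w.1‖ ^ 2 + ‖v.2 - w.2‖ ^ 2 := by
    rw [Prod.norm_def, Prod.fst_sub, Prod.snd_sub]
    rcases max_choice ‖v.1 - w.1‖ ‖v.2 - w.2‖ with h | h <;> rw [h] <;>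
      nlinarith [sq_nonneg ‖v.1 - w.1‖, sq_nonneg ‖v.2 - w.2‖]
  have h5 := mul_le_mul_of_nonneg_left h4 hc
  rw [mul_add] at h5
  linarith

theorem norm_lagrangianForce_le {C K : ℝ} (hC : 0 ≤ C)
    (hD : ∀ z z', ‖D z - D z'‖ ≤ C * ‖z - z'‖) (hK : 0 ≤ K) (hV : ∀ y, ‖V y‖ ≤ K * (1 + ‖y‖))
    (z : (U × N) × (U × N)) :
    ‖lagrangianForce D H V z‖ ≤ (‖D 0‖ + C + ‖H‖ + K) * (1 + ‖z‖) := by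
  have h1 : ‖D (z.1.2, z.2.2)‖ ≤ ‖D 0‖ + C * ‖z‖ := by
    have h2 := norm_le_insert' (D (z.1.2, z.2.2)) (D 0)
    have h3 := hD (z.1.2, z.2.2) 0
    rw [sub_zero] at h3
    have h4 := mul_le_mul_of_nonneg_left (norm_pair_snd_le z) hC
    linarith
  have h5 : ‖H z.2.2‖ ≤ ‖H‖ * ‖z‖ := (H.le_opNorm _).trans
    (mul_le_mul_of_nonneg_left ((norm_snd_le z.2).trans (norm_snd_le z)) (norm_nonneg _))
  have h6 : ‖V z.1‖ ≤ K * (1 + ‖z‖) :=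
    (hV _).trans (mul_le_mul_of_nonneg_left (by linarith [norm_fst_le z]) hK)
  have h7 := norm_comp_inl_add_comp_snd_le (U := U) (D (z.1.2, z.2.2)) (H z.2.2)
  refine (norm_sub_le _ _).trans ((add_le_add h7 h6).trans ?_)
  have h8 := mul_nonneg (norm_nonneg (D 0)) (norm_nonneg z)
  have h9 := norm_nonneg H
  nlinarith

/-- The potential depends on the position alone and cancels, so a potential that is merely `C¹` is
enough here. -/
theorem lipschitz_lagrangianForce {C : ℝ}
    (hD : ∀ z z', ‖D z - D z'‖ ≤ C * ‖z - z'‖) (hC : 0 ≤ C) (y v w : U × N) :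
    ‖lagrangianForce D H V (y, v) - lagrangianForce D H V (y, w)‖ ≤ (C + ‖H‖) * ‖v - w‖ := by
  have h1 : lagrangianForce D H V (y, v) - lagrangianForce D H V (y, w)
      = ((D (y.2, v.2) - D (y.2, w.2)).comp (ContinuousLinearMap.inl ℝ N N)
        + H (v.2 - w.2)).comp (ContinuousLinearMap.snd ℝ U N) := by
    refine ContinuousLinearMap.ext fun δ => ?_
    simp only [sub_apply, lagrangianForce_apply, ContinuousLinearMap.comp_apply, add_apply,
      ContinuousLinearMap.coe_snd', ContinuousLinearMap.inl_apply, map_sub]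
    ring
  rw [h1]
  have h2 : ‖((y.2, v.2) : N × N) - (y.2, w.2)‖ ≤ ‖v - w‖ := by
    rw [Prod.mk_sub_mk, sub_self, Prod.norm_def, norm_zero, max_eq_right (norm_nonneg _)]
    exact norm_snd_le (v - w)
  rw [add_mul]
  refine (norm_comp_inl_add_comp_snd_le _ _).trans (add_le_add
    ((hD _ _).trans (mul_le_mul_of_nonneg_left h2 hC)) ((H.le_opNorm _).trans
      (mul_le_mul_of_nonneg_left (norm_snd_le (v - w)) (norm_nonneg _))))

theorem continuous_lagrangianForce (hD : Continuous D) (hV : Continuous V) :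
    Continuous (lagrangianForce D H V) := by
  have h1 : Continuous fun z : (U × N) × (U × N) => D (z.1.2, z.2.2) := hD.comp (by fun_prop)
  have h2 : Continuous fun z : (U × N) × (U × N) => H z.2.2 := H.continuous.comp (by fun_prop)
  exact (((h1.clm_comp continuous_const).add h2).clm_comp continuous_const).sub
    (hV.comp continuous_fst)

/-- The implicit evolution system given by a Lagrangian with dissipation. -/
theorem exists_lagrangianSystem {c C K : ℝ} (hc : 0 < c) (hA : ∀ u, c * ‖u‖ ^ 2 ≤ A u u)
    (hDm : ∀ n r r', c * ‖r - r'‖ ^ 2 ≤ (D (n, r) - D (n, r')) (0, r - r'))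
    (hC : 0 ≤ C) (hD : ∀ z z', ‖D z - D z'‖ ≤ C * ‖z - z'‖) (hK : 0 ≤ K)
    (hV : ∀ y, ‖V y‖ ≤ K * (1 + ‖y‖)) (hVc : Continuous V) :
    ∃ S : ImplicitSystem (U × N), S.P = lagrangianMomentum A D ∧ S.Q = lagrangianForce D H V := by
  have hDc : Continuous D :=
    (LipschitzWith.of_dist_le_mul (K := C.toNNReal) fun z z' => by
      rw [dist_eq_norm, dist_eq_norm, Real.coe_toNNReal _ hC]
      exact hD z z').continuous
  have hA0 := norm_nonneg A
  have hH0 := norm_nonneg H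
  have hD0 := norm_nonneg (D 0)
  refine ⟨⟨lagrangianMomentum A D, lagrangianForce D H V, c, ‖A‖ + (‖D 0‖ + C + ‖H‖ + K), hc,
    by positivity, lagrangianMomentum_monotone hc.le hA hDm, fun z z' => ?_,
    continuous_lagrangianForce hDc hVc, fun z => ?_, fun y v w => ?_⟩, rfl, rfl⟩
  · refine (lipschitz_lagrangianMomentum hC hD z z').trans
      (mul_le_mul_of_nonneg_right ?_ (norm_nonneg _))
    linarith
  · refine (norm_lagrangianForce_le hC hD hK hV z).trans
      (mul_le_mul_of_nonneg_right ?_ (by positivity))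
    linarith
  · refine (lipschitz_lagrangianForce hD hC y v w).trans
      (mul_le_mul_of_nonneg_right ?_ (norm_nonneg _))
    linarith

theorem hasDerivAt_add_smul {Z : Type*} [NormedAddCommGroup Z] [NormedSpace ℝ Z] (a b : Z) :
    HasDerivAt (fun ε : ℝ => a + ε • b) b 0 := by
  simpa using ((hasDerivAt_id (0 : ℝ)).smul_const b).const_add a

/-- The first variation of a Lagrangian. -/
theorem hasDerivAt_lagrangian {T : U → ℝ} {X : N × N → ℝ} {W : U × N → ℝ} {y v : U × N}
    (hT : HasFDerivAt T (A v.1) v.1) (hX : HasFDerivAt X (D (y.2, v.2)) (y.2, v.2))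
    (hW : HasFDerivAt W (V y) y) (δ ρ : U × N) :
    HasDerivAt (fun ε : ℝ => T (v + ε • ρ).1 + X ((y + ε • δ).2, (v + ε • ρ).2) - W (y + ε • δ))
      (lagrangianMomentum A D (y, v) ρ + (lagrangianForce D H V (y, v) δ - H v.2 δ.2)) 0 := by
  have e1 : HasDerivAt (fun ε : ℝ => T (v.1 + ε • ρ.1)) (A v.1 ρ.1) 0 := by
    refine HasFDerivAt.comp_hasDerivAt (0 : ℝ) ?_ (hasDerivAt_add_smul v.1 ρ.1)
    rwa [zero_smul, add_zero]
  have e2 : HasDerivAt (fun ε : ℝ => X ((y.2, v.2) + ε • (δ.2, ρ.2)))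
      (D (y.2, v.2) (δ.2, ρ.2)) 0 := by
    refine HasFDerivAt.comp_hasDerivAt (0 : ℝ) ?_ (hasDerivAt_add_smul (y.2, v.2) (δ.2, ρ.2))
    rwa [zero_smul, add_zero]
  have e3 : HasDerivAt (fun ε : ℝ => W (y + ε • δ)) (V y δ) 0 := by
    refine HasFDerivAt.comp_hasDerivAt (0 : ℝ) ?_ (hasDerivAt_add_smul y δ)
    rwa [zero_smul, add_zero]
  have h1 : lagrangianMomentum A D (y, v) ρ + (lagrangianForce D H V (y, v) δ - H v.2 δ.2)
      = A v.1 ρ.1 + D (y.2, v.2) (δ.2, ρ.2) - V y δ := by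
    -- The co-energy derivative splits into a force part and a momentum part; `H` is subtracted
    -- because the force already includes the dissipation.
    have h2 : ((δ.2, ρ.2) : N × N) = (δ.2, 0) + (0, ρ.2) := by simp
    rw [lagrangianMomentum_apply, lagrangianForce_apply, h2, map_add]
    ring
  rw [h1]
  exact (e1.add e2).sub e3

/-- The weighted inner product of families of vectors. -/
def sumInner {ι F : Type*} [Fintype ι] [NormedAddCommGroup F] [InnerProductSpace ℝ F] (m : ι → ℝ) :
    (ι → F) →L[ℝ] (ι → F) →L[ℝ] ℝ :=
  ∑ a, m a • (innerSL ℝ : F →L[ℝ] F →L[ℝ] ℝ).bilinearComp (ContinuousLinearMap.proj a)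
    (ContinuousLinearMap.proj a)

theorem sumInner_apply {ι F : Type*} [Fintype ι] [NormedAddCommGroup F] [InnerProductSpace ℝ F]
    (m : ι → ℝ) (u v : ι → F) : sumInner (F := F) m u v = ∑ a, m a * inner ℝ (u a) (v a) := by
  simp [sumInner]

theorem hasFDerivAt_sum_norm_sq {ι F : Type*} [Fintype ι] [NormedAddCommGroup F]
    [InnerProductSpace ℝ F] (m : ι → ℝ) (u : ι → F) :
    HasFDerivAt (fun u : ι → F => ∑ a, m a / 2 * ‖u a‖ ^ 2) (sumInner (F := F) m u) u := by
  have h1 : ∀ a, HasFDerivAt (fun u : ι → F => m a / 2 * ‖u a‖ ^ 2)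
      ((m a / 2) • (2 • (innerSL ℝ (u a)).comp
        (ContinuousLinearMap.proj a : (ι → F) →L[ℝ] F))) u := fun a =>
    (HasFDerivAt.norm_sq (f := fun u : ι → F => u a)
      (f' := (ContinuousLinearMap.proj a : (ι → F) →L[ℝ] F)) (hasFDerivAt_apply a u)).const_mul _
  refine (HasFDerivAt.fun_sum fun a _ => h1 a).congr_fderiv ?_
  refine ContinuousLinearMap.ext fun v => ?_
  rw [sumInner_apply, _root_.sum_apply]
  refine Finset.sum_congr rfl fun a _ => ?_
  simp
  ring

end Lagrangian

/-! ### Restriction of a system to a subspace, and finite families -/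

namespace ImplicitSystem

variable {F : Type*} [NormedAddCommGroup F] [NormedSpace ℝ F]

/-- Restriction of states, velocities and test functions to a subspace. -/
def restrict (S : ImplicitSystem F) (E : Submodule ℝ F) : ImplicitSystem E where
  P z := (S.P (z.1, z.2)).comp E.subtypeL
  Q z := (S.Q (z.1, z.2)).comp E.subtypeL
  c := S.c
  L := S.L
  c_pos := S.c_pos
  L_nonneg := S.L_nonneg
  monotone_P y v w := S.monotone_P y v w
  lipschitz_P z z' := by
    rw [← ContinuousLinearMap.sub_comp]
    refine (ContinuousLinearMap.opNorm_comp_le _ _).trans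
      ((mul_le_of_le_one_right (norm_nonneg _) E.norm_subtypeL_le).trans ?_)
    exact S.lipschitz_P _ _
  continuous_Q := by
    have h1 : Continuous fun z : E × E => S.Q (z.1, z.2) := S.continuous_Q.comp (by fun_prop)
    exact h1.clm_comp continuous_const
  growth_Q z := by
    refine (ContinuousLinearMap.opNorm_comp_le _ _).trans
      ((mul_le_of_le_one_right (norm_nonneg _) E.norm_subtypeL_le).trans ?_)
    exact S.growth_Q _
  lipschitz_Q y v w := by
    rw [← ContinuousLinearMap.sub_comp]
    refine (ContinuousLinearMap.opNorm_comp_le _ _).trans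
      ((mul_le_of_le_one_right (norm_nonneg _) E.norm_subtypeL_le).trans ?_)
    exact S.lipschitz_Q _ _ _

end ImplicitSystem

/-- Families carry the maximum norm, whereas masses and orthonormality produce Euclidean sums. -/
theorem norm_sq_le_sum_norm_sq {ι F : Type*} [Fintype ι] [NormedAddCommGroup F] (u : ι → F) :
    ‖u‖ ^ 2 ≤ ∑ a, ‖u a‖ ^ 2 := by
  have h0 : 0 ≤ ∑ a, ‖u a‖ ^ 2 := Finset.sum_nonneg fun a _ => sq_nonneg _
  have h1 : ‖u‖ ≤ Real.sqrt (∑ a, ‖u a‖ ^ 2) := by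
    rw [pi_norm_le_iff_of_nonneg (Real.sqrt_nonneg _)]
    intro a
    refine Real.le_sqrt_of_sq_le ?_
    exact Finset.single_le_sum (f := fun a => ‖u a‖ ^ 2) (fun a _ => sq_nonneg _)
      (Finset.mem_univ a)
  calc ‖u‖ ^ 2 ≤ Real.sqrt (∑ a, ‖u a‖ ^ 2) ^ 2 := pow_le_pow_left₀ (norm_nonneg _) h1 2
    _ = _ := Real.sq_sqrt h0

theorem exists_pos_le_finite {ι : Type*} [Finite ι] {m : ι → ℝ} (hm : ∀ a, 0 < m a) {γ : ℝ}
    (hγ : 0 < γ) : ∃ c, 0 < c ∧ c ≤ γ ∧ ∀ a, c ≤ m a := by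
  rcases isEmpty_or_nonempty ι with h | h
  · exact ⟨γ, hγ, le_rfl, fun a => isEmptyElim a⟩
  · obtain ⟨a₀, ha₀⟩ := Finite.exists_min m
    exact ⟨min γ (m a₀), lt_min hγ (hm a₀), min_le_left _ _,
      fun a => (min_le_right _ _).trans (ha₀ a)⟩

namespace Body

variable {d k : ℕ} (B : Body d k)

/-! ### The kinetic co-energy -/

/-- The kinetic co-energy of nodal values and rates. -/
def coenergy (z : (B.Node → Vec k) × (B.Node → Vec k)) : ℝ :=
  ∫ x in B.domain, B.chi (B.field z.1 x, B.field z.2 x)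

/-- The derivative of the kinetic co-energy. -/
def coenergyD (z : (B.Node → Vec k) × (B.Node → Vec k)) :
    (B.Node → Vec k) × (B.Node → Vec k) →L[ℝ] ℝ :=
  integralFDeriv (volume.restrict B.domain) B.chi (fun x => B.pairCLM x) z

/-- The generalized momentum. -/
def momentum (z : B.State × B.State) : B.State →L[ℝ] ℝ :=
  lagrangianMomentum (sumInner B.mass) B.coenergyD z

/-- The generalized force. -/
def force (z : B.State × B.State) : B.State →L[ℝ] ℝ :=
  lagrangianForce B.coenergyD (sumInner fun _ => B.eta) B.potentialD z

variable {B}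

theorem A4.contDiff_one (h4 : B.A4) : ContDiff ℝ 1 B.chi := h4.1.of_le (by norm_num)

theorem Standing.hasFDerivAt_coenergy (hB : B.Standing) (h4 : B.A4)
    (z : (B.Node → Vec k) × (B.Node → Vec k)) : HasFDerivAt B.coenergy (B.coenergyD z) z := by
  have h1 := hasFDerivAt_integral_comp h4.contDiff_one (hB.memLp_pairCLM (n := k) (m := k)) z
  simp only [pairCLM_apply] at h1
  exact h1

theorem Standing.exists_lipschitz_coenergyD (hB : B.Standing) (h4 : B.A4) :
    ∃ C, 0 ≤ C ∧ ∀ z z', ‖B.coenergyD z - B.coenergyD z'‖ ≤ C * ‖z - z'‖ := by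
  obtain ⟨h1, -, Xi, hXi, h2⟩ := id h4
  refine exists_lipschitz_integralFDeriv h4.contDiff_one hB.memLp_pairCLM hXi.le fun z z' => ?_
  exact convex_univ.norm_image_sub_le_of_norm_fderiv_le (𝕜 := ℝ)
    (fun y _ => ((h1.fderiv_right (m := 1) (by norm_num)).differentiable one_ne_zero) y)
    (fun y _ => h2 y) (mem_univ z') (mem_univ z)

/-- Parseval's identity for the orthonormal shape functions. -/
theorem Standing.integral_norm_field_sq (hB : B.Standing) {n : ℕ} (c : B.Node → Vec n) :
    ∫ x in B.domain, ‖B.field c x‖ ^ 2 = ∑ a, ‖c a‖ ^ 2 := by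
  have hint : ∀ a b, Integrable (fun x => B.shape a x * B.shape b x * inner ℝ (c a) (c b))
      (volume.restrict B.domain) := by
    intro a b
    have h1 : ∀ a, MemLp (B.shape a) ⊤ (volume.restrict B.domain) := fun a =>
      (hB.shape_pa a).memLp_top volume B.mesh.isOpen_domain.measurableSet
        B.mesh.domain_subset_space
    exact Integrable.mul_const (((h1 a).mul (h1 b) (r := ⊤)).integrable le_top |>.congr
      (Eventually.of_forall fun x => by simp [mul_comm])) _
  have h2 : ∀ x, ‖B.field c x‖ ^ 2
      = ∑ a, ∑ b, B.shape a x * B.shape b x * inner ℝ (c a) (c b) := by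
    intro x
    rw [← real_inner_self_eq_norm_sq, field, sum_inner]
    refine Finset.sum_congr rfl fun a _ => ?_
    rw [inner_sum]
    refine Finset.sum_congr rfl fun b _ => ?_
    rw [real_inner_smul_left, real_inner_smul_right]
    ring
  simp only [h2]
  rw [integral_finsetSum _ fun a _ => integrable_finsetSum _ fun b _ => hint a b]
  refine Finset.sum_congr rfl fun a _ => ?_
  rw [integral_finsetSum _ fun b _ => hint a b, Finset.sum_eq_single a]
  · rw [integral_mul_const, hB.shape_orthonormal, if_pos rfl, one_mul, real_inner_self_eq_norm_sq]
  · intro b _ hb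
    rw [integral_mul_const, hB.shape_orthonormal, if_neg fun h => hb (Subtype.ext h.symm), zero_mul]
  · simp

/-- Pointwise strong monotonicity of the rate derivative of `χ`, integrated over the body, gives the
`L²` norm of the difference of the rate fields; Parseval's identity turns it into nodal values. -/
theorem Standing.coenergyD_monotone (hB : B.Standing) (h4 : B.A4) {gam : ℝ}
    (h5 : ∀ n ζ ξ : Vec k,
      gam * ‖ξ‖ ^ 2 ≤ fderiv ℝ (fderiv ℝ (fun z => B.chi (n, z))) ζ ξ ξ)
    (n r r' : B.Node → Vec k) :
    gam * ∑ a, ‖r a - r' a‖ ^ 2 ≤ (B.coenergyD (n, r) - B.coenergyD (n, r')) (0, r - r') := by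
  have hpair : ∀ x, B.pairCLM x ((0, r - r') : (B.Node → Vec k) × (B.Node → Vec k))
      = (0, B.field r x - B.field r' x) := by
    intro x
    simp [pairCLM, ← fieldCLM_apply]
  have hm : MemLp (fun x => B.pairCLM x ((0, r - r') : (B.Node → Vec k) × (B.Node → Vec k))) ⊤
      (volume.restrict B.domain) := memLp_top_apply hB.memLp_pairCLM _
  have hi := fun y => integrable_fderiv_apply h4.contDiff_one
    (hB.memLp_pairCLM (n := k) (m := k)) y hm
  have hcd : ∀ n, ContDiff ℝ 2 fun z => B.chi (n, z) := fun n =>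
    h4.1.comp (contDiff_const.prodMk contDiff_id)
  have hd : Differentiable ℝ B.chi := h4.contDiff_one.differentiable one_ne_zero
  have h1 : ∑ a, ‖r a - r' a‖ ^ 2 = ∫ x in B.domain, ‖B.field r x - B.field r' x‖ ^ 2 := by
    have h2 := hB.integral_norm_field_sq (r - r')
    simp only [Pi.sub_apply] at h2
    rw [← h2]
    simp only [← fieldCLM_apply, map_sub]
  have hfield : MemLp (fun x => B.fieldCLM x (r - r')) ⊤ (volume.restrict B.domain) :=
    memLp_top_apply hB.memLp_fieldCLM_domain _
  have hi2 : Integrable (fun x => gam * ‖B.field r x - B.field r' x‖ ^ 2)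
      (volume.restrict B.domain) := by
    refine Integrable.const_mul ?_ gam
    have h3 := (memLp_top_comp (G := fun v : Vec k => ‖v‖ ^ 2) (by fun_prop) hfield).integrable
      le_top
    simpa only [map_sub, fieldCLM_apply] using h3
  rw [h1, ← integral_const_mul, sub_apply, coenergyD, coenergyD,
    integralFDeriv_apply h4.contDiff_one hB.memLp_pairCLM,
    integralFDeriv_apply h4.contDiff_one hB.memLp_pairCLM, ← integral_sub (hi _) (hi _)]
  refine integral_mono hi2 ((hi _).sub (hi _)) fun x => ?_
  have h6 := le_fderiv_sub_fderiv_apply (hcd (B.field n x)) (h5 (B.field n x))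
    (B.field r x) (B.field r' x)
  have h7 : ∀ ζ ξ, fderiv ℝ (fun z => B.chi (B.field n x, z)) ζ ξ
      = fderiv ℝ B.chi (B.field n x, ζ) (0, ξ) := fun ζ ξ => dchiRate_eq hd (B.field n x) ζ ξ
  rw [sub_apply, h7, h7] at h6
  have h8 : ∀ r : B.Node → Vec k, B.pairCLM x (n, r) = (B.field n x, B.field r x) :=
    fun r => pairCLM_apply B x _
  simp only [hpair, h8]
  exact h6

theorem Standing.exists_system (hB : B.Standing) (h1 : B.A1) (h2 : B.A2) (h4 : B.A4)
    (h5 : B.A5) : ∃ S : ImplicitSystem B.State, S.P = B.momentum ∧ S.Q = B.force := by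
  obtain ⟨gam, hgam, h5⟩ := h5
  obtain ⟨c, hc, hcγ, hcm⟩ := exists_pos_le_finite hB.mass_pos hgam
  obtain ⟨C, hC, hD⟩ := hB.exists_lipschitz_coenergyD h4
  obtain ⟨K, hK, hV⟩ := hB.exists_norm_potentialD_le h1 h2
  refine exists_lagrangianSystem hc (fun u => ?_) (fun n r r' => ?_) hC hD hK hV
    (hB.continuous_potentialD h1 h2)
  · rw [sumInner_apply]
    refine (mul_le_mul_of_nonneg_left (norm_sq_le_sum_norm_sq u) hc.le).trans ?_
    rw [Finset.mul_sum]
    refine Finset.sum_le_sum fun a _ => ?_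
    rw [real_inner_self_eq_norm_sq]
    exact mul_le_mul_of_nonneg_right (hcm a) (sq_nonneg _)
  · refine le_trans ?_ (hB.coenergyD_monotone h4 h5 n r r')
    exact mul_le_mul hcγ (norm_sq_le_sum_norm_sq (r - r')) (sq_nonneg _) hgam.le

/-! ### Momentum and force at a node -/

open Classical in
theorem momentum_inl_single (z : B.State × B.State) (a : B.Node) (ξ : Vec d) :
    B.momentum z (Pi.single a ξ, 0) = B.mass a * inner ℝ (z.2.1 a) ξ := by
  rw [momentum, lagrangianMomentum_apply, sumInner_apply, Finset.sum_eq_single a]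
  · simp [← Prod.zero_eq_mk]
  · intro b _ hb; simp [hb]
  · simp

open Classical in
theorem Standing.force_inl_single (hB : B.Standing) (h1 : B.A1) (h2 : B.A2) (h3 : B.A3)
    (z : B.State × B.State) (a : B.Node) (ξ : Vec d) :
    B.force z (Pi.single a ξ, 0) = - B.loadU a z.1 ξ := by
  rw [force, lagrangianForce_apply, hB.loadU_eq h1 h2 h3]
  simp [← Prod.zero_eq_mk]

open Classical in
theorem Standing.momentum_inr_single (hB : B.Standing) (h4 : B.A4) (z : B.State × B.State)
    (a : B.Node) (ξ : Vec k) : B.momentum z (0, Pi.single a ξ) =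
      ∫ x in B.domain, B.dchiRate (B.field z.1.2 x) (B.field z.2.2 x) (B.shape a x • ξ) := by
  have hd : Differentiable ℝ B.chi := h4.contDiff_one.differentiable one_ne_zero
  rw [momentum, lagrangianMomentum_apply, map_zero, zero_add, coenergyD,
    integralFDeriv_apply h4.contDiff_one hB.memLp_pairCLM]
  simp only [dchiRate_eq hd, pairCLM_inr_single]
  simp only [pairCLM_apply]

open Classical in
theorem Standing.coenergyD_inl_single (hB : B.Standing) (h4 : B.A4)
    (z : (B.Node → Vec k) × (B.Node → Vec k)) (a : B.Node) (ξ : Vec k) :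
    B.coenergyD z (Pi.single a ξ, 0) =
      ∫ x in B.domain, B.dchiNu (B.field z.1 x) (B.field z.2 x) (B.shape a x • ξ) := by
  have hd : Differentiable ℝ B.chi := h4.contDiff_one.differentiable one_ne_zero
  rw [coenergyD, integralFDeriv_apply h4.contDiff_one hB.memLp_pairCLM]
  simp only [dchiNu_eq hd, pairCLM_inl_single]
  simp only [pairCLM_apply]

open Classical in
theorem Standing.force_inr_single (hB : B.Standing) (h1 : B.A1) (h2 : B.A2) (h4 : B.A4)
    (z : B.State × B.State) (a : B.Node) (ξ : Vec k) :
    B.force z (0, Pi.single a ξ) =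
      (∫ x in B.domain, B.dchiNu (B.field z.1.2 x) (B.field z.2.2 x) (B.shape a x • ξ))
        + B.eta * inner ℝ (z.2.2 a) ξ - B.loadNu a z.1 ξ := by
  rw [force, lagrangianForce_apply, hB.loadNu_eq h1 h2, sumInner_apply,
    Finset.sum_eq_single a]
  · simp only [hB.coenergyD_inl_single h4, Pi.single_eq_same]
  · intro b _ hb; simp [hb]
  · simp

variable (B) in
/-- The subspace of admissible states. -/
def admissible : Submodule ℝ B.State where
  carrier := {s | B.Admissible s}
  add_mem' {s s'} h h' := ⟨fun a ha => by simp [h.1 a ha, h'.1 a ha],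
    fun a ha => by simp [h.2 a ha, h'.2 a ha]⟩
  zero_mem' := ⟨fun _ _ => rfl, fun _ _ => rfl⟩
  smul_mem' c s h := ⟨fun a ha => by simp [h.1 a ha], fun a ha => by simp [h.2 a ha]⟩

open Classical in
theorem single_inl_mem_admissible {a : B.Node} (ha : (a : Vec d) ∉ B.displacementSet) (ξ : Vec d) :
    ((Pi.single a ξ, 0) : B.State) ∈ B.admissible := by
  refine ⟨fun b hb => ?_, fun _ _ => rfl⟩
  have h1 : b ≠ a := fun h => ha (h ▸ hb)
  simp [h1]

open Classical in
theorem single_inr_mem_admissible {a : B.Node} (ha : (a : Vec d) ∉ B.descriptorSet) (ξ : Vec k) :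
    ((0, Pi.single a ξ) : B.State) ∈ B.admissible := by
  refine ⟨fun _ _ => rfl, fun b hb => ?_⟩
  have h1 : b ≠ a := fun h => ha (h ▸ hb)
  simp [h1]

end Body

namespace TimeSet

variable {t₀ tf : ℝ} (Θ : TimeSet t₀ tf) {F : Type*} [AddCommGroup F] [Module ℝ F]

/-! ### Piecewise affine functions of time -/

/-- The continuous function with value `a` at the initial time and slope `v i` on the `i`-th time
interval. -/
def interp (a : F) (v : ℕ → F) (t : ℝ) : F :=
  a + ∑ i ∈ Finset.range Θ.N, (min (max t (Θ.t i)) (Θ.t (i + 1)) - Θ.t i) • v i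

/-- Each summand of `interp` is clamped to its cell: cells left of `t` contribute a full step, the
current cell `t - Θ.t j`, later cells nothing. -/
theorem interp_eq {y v : ℕ → F} (h : ∀ i < Θ.N, y (i + 1) = y i + Θ.step i • v i) {j : ℕ}
    (hj : j < Θ.N) {t : ℝ} (ht : t ∈ Icc (Θ.t j) (Θ.t (j + 1))) :
    Θ.interp (y 0) v t = y j + (t - Θ.t j) • v j := by
  have h1 : ∀ n ≤ Θ.N, y 0 + ∑ i ∈ Finset.range n,
      (min (max t (Θ.t i)) (Θ.t (i + 1)) - Θ.t i) • v i
      = if n ≤ j then y n else y j + (t - Θ.t j) • v j := by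
    intro n
    induction n with
    | zero => simp
    | succ n ih =>
      intro hn
      rw [Finset.sum_range_succ, ← add_assoc, ih (by omega)]
      have hlt : Θ.t n ≤ Θ.t (n + 1) := Θ.t_le_t (Nat.le_succ n) hn
      rcases lt_trichotomy n j with h2 | h2 | h2
      · have h3 : Θ.t (n + 1) ≤ t := (Θ.t_le_t (show n + 1 ≤ j from h2) hj.le).trans ht.1
        rw [if_pos h2.le, if_pos (show n + 1 ≤ j from h2), max_eq_left (hlt.trans h3),
          min_eq_right h3, h n (by omega)]
        rfl
      · subst h2
        rw [if_pos le_rfl, if_neg (by omega), max_eq_left ht.1, min_eq_left ht.2]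
      · have h3 : t ≤ Θ.t n := ht.2.trans (Θ.t_le_t (show j + 1 ≤ n from h2) (by omega))
        rw [if_neg (by omega), if_neg (by omega), max_eq_right h3, min_eq_left hlt, sub_self,
          zero_smul, add_zero]
  rw [interp, h1 Θ.N le_rfl, if_neg (by omega)]

theorem interp_t {y v : ℕ → F} (h : ∀ i < Θ.N, y (i + 1) = y i + Θ.step i • v i) {j : ℕ}
    (hj : j ≤ Θ.N) : Θ.interp (y 0) v (Θ.t j) = y j := by
  rcases hj.lt_or_eq with h1 | h1
  · rw [Θ.interp_eq h h1 ⟨le_rfl, Θ.t_le_t (Nat.le_succ j) h1⟩, sub_self, zero_smul, add_zero]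
  -- The last node is the left end of no cell, so it is reached from the right end of the previous
  -- one.
  · rcases j with _ | j
    · simp [interp, ← h1]
    · rw [Θ.interp_eq h (show j < Θ.N by omega) ⟨Θ.t_le_t (Nat.le_succ j) hj, le_rfl⟩,
        h j (by omega)]
      rfl

theorem rate_of_eq {f : ℝ → F} {i : ℕ} (hi : i < Θ.N) {v : F}
    (h : f (Θ.t (i + 1)) = f (Θ.t i) + Θ.step i • v) : Θ.rate f i = v := by
  rw [rate, h, add_sub_cancel_left, inv_smul_smul₀ (Θ.step_pos hi).ne']

theorem rate_interp {y v : ℕ → F} (h : ∀ i < Θ.N, y (i + 1) = y i + Θ.step i • v i) {i : ℕ}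
    (hi : i < Θ.N) : Θ.rate (Θ.interp (y 0) v) i = v i :=
  Θ.rate_of_eq hi (by rw [Θ.interp_t h hi, Θ.interp_t h hi.le, h i hi])

theorem step_smul_rate (f : ℝ → F) {i : ℕ} (hi : i < Θ.N) :
    Θ.step i • Θ.rate f i = f (Θ.t (i + 1)) - f (Θ.t i) := by
  rw [rate, smul_inv_smul₀ (Θ.step_pos hi).ne']

theorem velocity_eq (f : ℝ → F) {j : ℕ} (hj : j < Θ.N) {t : ℝ}
    (ht : t ∈ Ico (Θ.t j) (Θ.t (j + 1))) : Θ.velocity f t = Θ.rate f j := by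
  rw [velocity, Finset.sum_eq_single j]
  · rw [indicator_of_mem ht]
  · intro i hi hij
    refine indicator_of_notMem (fun h => ?_) _
    have hi' := Finset.mem_range.1 hi
    rcases lt_or_gt_of_ne hij with h1 | h1
    · exact absurd (h.2.trans_le (Θ.t_le_t (show i + 1 ≤ j from h1) hj.le)) (not_lt.2 ht.1)
    · exact absurd (ht.2.trans_le (Θ.t_le_t (show j + 1 ≤ i from h1) hi'.le)) (not_lt.2 h.1)
  · intro h; exact absurd (Finset.mem_range.2 hj) h

theorem velocity_t_zero (h : t₀ < tf) (f : ℝ → F) : Θ.velocity f t₀ = Θ.rate f 0 := by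
  have hN := Θ.N_pos h
  refine Θ.velocity_eq f hN ⟨Θ.t_zero.le, ?_⟩
  have h1 := Θ.step_pos hN
  simp only [step, Θ.t_zero] at h1
  linarith

end TimeSet

/-- Discrete integration by parts. -/
theorem sum_range_by_parts {G : Type*} [AddCommGroup G] (P Q : ℕ → G →+ ℝ) (q : ℕ → G) (n : ℕ) :
    ∑ i ∈ Finset.range (n + 1), (P i (q (i + 1) - q i) + Q i (q i))
      = P n (q (n + 1))
        + ∑ i ∈ Finset.range n, (P i (q (i + 1)) - (P (i + 1) (q (i + 1)) - Q (i + 1) (q (i + 1))))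
        + (Q 0 (q 0) - P 0 (q 0)) := by
  induction n with
  | zero => simp; ring
  | succ n ih =>
    rw [Finset.sum_range_succ, ih, Finset.sum_range_succ]
    simp only [map_sub]
    ring

namespace Body

variable {d k : ℕ} {B : Body d k} {t₀ tf : ℝ} {Θ : TimeSet t₀ tf}

/-! ### The discrete principle as a recurrence -/

theorem action_eq (p : ℝ → B.State) : B.action Θ p = ∑ i ∈ Finset.range Θ.N, Θ.step i *
    ((∑ a, B.mass a / 2 * ‖(Θ.rate p i).1 a‖ ^ 2) + B.coenergy ((p (Θ.t i)).2, (Θ.rate p i).2)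
      - B.potential (p (Θ.t i))) := rfl

theorem Standing.hasDerivAt_action (hB : B.Standing) (h1 : B.A1) (h2 : B.A2) (h3 : B.A3)
    (h4 : B.A4) (p q : ℝ → B.State) :
    HasDerivAt (fun ε : ℝ => B.action Θ fun t => p t + ε • q t)
      (∑ i ∈ Finset.range Θ.N, Θ.step i * (B.momentum (p (Θ.t i), Θ.rate p i) (Θ.rate q i)
        + (B.force (p (Θ.t i), Θ.rate p i) (q (Θ.t i))
          - sumInner (F := Vec k) (fun _ => B.eta) (Θ.rate p i).2 (q (Θ.t i)).2))) 0 := by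
  have hrate : ∀ (ε : ℝ) i, Θ.rate (fun t => p t + ε • q t) i = Θ.rate p i + ε • Θ.rate q i := by
    intro ε i
    simp only [TimeSet.rate]
    module
  simp only [action_eq, hrate]
  refine HasDerivAt.fun_sum fun i _ => HasDerivAt.const_mul _ ?_
  exact hasDerivAt_lagrangian (T := fun u => ∑ a, B.mass a / 2 * ‖u a‖ ^ 2) (X := B.coenergy)
    (W := B.potential) (H := sumInner fun _ => B.eta) (hasFDerivAt_sum_norm_sq _ _)
    (hB.hasFDerivAt_coenergy h4 _) (hB.hasFDerivAt_potential h1 h2 h3 _) _ _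

/-- An increment is a step times a rate, so the dissipation has the form of the action sum; added to
the first variation it cancels the subtracted `sumInner` term and leaves the full force. -/
theorem dissipation_eq (p q : ℝ → B.State) : B.dissipation Θ p q =
    ∑ i ∈ Finset.range Θ.N, Θ.step i *
      sumInner (F := Vec k) (fun _ => B.eta) (Θ.rate p i).2 (q (Θ.t i)).2 := by
  rw [dissipation, Finset.sum_comm, Finset.mul_sum]
  refine Finset.sum_congr rfl fun i hi => ?_
  rw [sumInner_apply, ← Finset.mul_sum, mul_left_comm, Finset.mul_sum (a := Θ.step i)]
  congr 1
  refine Finset.sum_congr rfl fun a _ => ?_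
  rw [← real_inner_smul_left, ← Pi.smul_apply, ← Prod.smul_snd,
    Θ.step_smul_rate p (Finset.mem_range.1 hi)]
  rfl

theorem Standing.discretePrinciple_iff (hB : B.Standing) (h1 : B.A1) (h2 : B.A2) (h3 : B.A3)
    (h4 : B.A4) (p : ℝ → B.State) : B.DiscretePrinciple Θ p ↔
      ∀ q : ℝ → B.State, B.InY Θ q → q t₀ = 0 → q tf = 0 →
        ∑ i ∈ Finset.range Θ.N, (B.momentum (p (Θ.t i), Θ.rate p i) (q (Θ.t (i + 1)) - q (Θ.t i))
          + Θ.step i * B.force (p (Θ.t i), Θ.rate p i) (q (Θ.t i))) = 0 := by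
  have key : ∀ q : ℝ → B.State,
      (∑ i ∈ Finset.range Θ.N, Θ.step i * (B.momentum (p (Θ.t i), Θ.rate p i) (Θ.rate q i)
        + (B.force (p (Θ.t i), Θ.rate p i) (q (Θ.t i))
          - sumInner (F := Vec k) (fun _ => B.eta) (Θ.rate p i).2 (q (Θ.t i)).2)))
        + B.dissipation Θ p q
      = ∑ i ∈ Finset.range Θ.N, (B.momentum (p (Θ.t i), Θ.rate p i) (q (Θ.t (i + 1)) - q (Θ.t i))
          + Θ.step i * B.force (p (Θ.t i), Θ.rate p i) (q (Θ.t i))) := by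
    intro q
    rw [dissipation_eq, ← Finset.sum_add_distrib]
    refine Finset.sum_congr rfl fun i hi => ?_
    rw [← Θ.step_smul_rate q (Finset.mem_range.1 hi), map_smul, smul_eq_mul]
    ring
  constructor
  · intro h q hq h0 hf
    obtain ⟨δA, hδ, hsum⟩ := h q hq h0 hf
    rw [← key q, ← hδ.unique (hB.hasDerivAt_action h1 h2 h3 h4 p q)]
    exact hsum
  · intro h q hq h0 hf
    exact ⟨_, hB.hasDerivAt_action h1 h2 h3 h4 p q, (key q).trans (h q hq h0 hf)⟩

theorem InY.mem {p : ℝ → B.State} (hp : B.InY Θ p) {i : ℕ} (hi : i ≤ Θ.N) :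
    p (Θ.t i) ∈ B.admissible := hp.2 _ (Θ.t_mem_Icc hi)

theorem InY.rate_mem {p : ℝ → B.State} (hp : B.InY Θ p) {i : ℕ} (hi : i < Θ.N) :
    Θ.rate p i ∈ B.admissible :=
  B.admissible.smul_mem _ (B.admissible.sub_mem (hp.mem hi) (hp.mem hi.le))

theorem inY_interp {y v : ℕ → B.State} (h : ∀ i < Θ.N, y (i + 1) = y i + Θ.step i • v i)
    (hy : y 0 ∈ B.admissible) (hv : ∀ i < Θ.N, v i ∈ B.admissible) :
    B.InY Θ (Θ.interp (y 0) v) := by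
  refine ⟨fun i hi t ht => ?_, fun t _ => ?_⟩
  · rw [Θ.interp_eq h hi ht, Θ.interp_t h hi.le, Θ.rate_interp h hi]
  · exact B.admissible.add_mem hy (B.admissible.sum_mem fun i hi =>
      B.admissible.smul_mem _ (hv i (Finset.mem_range.1 hi)))

/-- Summation by parts collects the coefficient of the test value at each interior node; test
functions with arbitrary admissible values at one node separate these coefficients. -/
theorem Standing.discretePrinciple_iff_recurrence (hB : B.Standing) (h1 : B.A1) (h2 : B.A2)
    (h3 : B.A3) (h4 : B.A4) (htime : t₀ < tf) (p : ℝ → B.State) : B.DiscretePrinciple Θ p ↔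
      ∀ i, i + 1 < Θ.N → ∀ s ∈ B.admissible,
        B.momentum (p (Θ.t (i + 1)), Θ.rate p (i + 1)) s
          - Θ.step (i + 1) * B.force (p (Θ.t (i + 1)), Θ.rate p (i + 1)) s
        = B.momentum (p (Θ.t i), Θ.rate p i) s := by
  rw [hB.discretePrinciple_iff h1 h2 h3 h4]
  obtain ⟨n, hn⟩ : ∃ n, Θ.N = n + 1 := ⟨Θ.N - 1, by have := Θ.N_pos htime; omega⟩
  have hparts : ∀ q : ℝ → B.State, q t₀ = 0 → q tf = 0 →
      ∑ i ∈ Finset.range Θ.N, (B.momentum (p (Θ.t i), Θ.rate p i) (q (Θ.t (i + 1)) - q (Θ.t i))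
          + Θ.step i * B.force (p (Θ.t i), Θ.rate p i) (q (Θ.t i)))
      = ∑ i ∈ Finset.range n, (B.momentum (p (Θ.t i), Θ.rate p i) (q (Θ.t (i + 1)))
        - (B.momentum (p (Θ.t (i + 1)), Θ.rate p (i + 1)) (q (Θ.t (i + 1)))
          - Θ.step (i + 1) * B.force (p (Θ.t (i + 1)), Θ.rate p (i + 1)) (q (Θ.t (i + 1))))) := by
    intro q hq0 hqf
    have h5 := sum_range_by_parts
      (fun i => ((B.momentum (p (Θ.t i), Θ.rate p i) : B.State →ₗ[ℝ] ℝ)).toAddMonoidHom)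
      (fun i => ((Θ.step i • B.force (p (Θ.t i), Θ.rate p i) :
        B.State →L[ℝ] ℝ) : B.State →ₗ[ℝ] ℝ).toAddMonoidHom) (fun i => q (Θ.t i)) n
    have h6 : q (Θ.t (n + 1)) = 0 := by rw [← hn, Θ.t_last, hqf]
    have h7 : q (Θ.t 0) = 0 := by rw [Θ.t_zero, hq0]
    rw [h6, h7] at h5
    simpa [hn] using h5
  constructor
  · intro h i hi s hs
    -- Nodal values of the hat function with value `s` at node `i + 1`; that node is interior, so
    -- the test function vanishes at both end times.
    let y : ℕ → B.State := fun j => if j = i + 1 then s else 0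
    have hy : ∀ j, y j ∈ B.admissible := by
      intro j
      by_cases hj : j = i + 1
      · simpa [y, hj] using hs
      · simp [y, hj]
    let v : ℕ → B.State := fun j => (Θ.step j)⁻¹ • (y (j + 1) - y j)
    have hyv : ∀ j < Θ.N, y (j + 1) = y j + Θ.step j • v j := by
      intro j hj
      rw [smul_inv_smul₀ (Θ.step_pos hj).ne', add_sub_cancel]
    have hq := inY_interp hyv (hy 0)
      (fun j _ => B.admissible.smul_mem _ (B.admissible.sub_mem (hy _) (hy _)))
    have hq0 : Θ.interp (y 0) v t₀ = 0 := by
      have e := Θ.interp_t hyv (Nat.zero_le _)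
      rw [Θ.t_zero] at e
      rw [e]
      simp [y]
    have hqf : Θ.interp (y 0) v tf = 0 := by
      have e := Θ.interp_t hyv le_rfl
      rw [Θ.t_last] at e
      rw [e]
      simp only [y]
      rw [if_neg (by omega)]
    have h5 := h _ hq hq0 hqf
    rw [hparts _ hq0 hqf, Finset.sum_eq_single i] at h5
    · rw [Θ.interp_t hyv hi.le] at h5
      simp only [y, if_true] at h5
      linarith
    · intro j hj hji
      have hj' := Finset.mem_range.1 hj
      rw [Θ.interp_t hyv (by omega)]
      simp only [y]
      rw [if_neg (by omega)]
      simp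
    · intro hi'
      exact absurd (Finset.mem_range.2 (by omega)) hi'
  · intro h q hq hq0 hqf
    rw [hparts q hq0 hqf]
    refine Finset.sum_eq_zero fun i hi => ?_
    have hi' := Finset.mem_range.1 hi
    rw [h i (by omega) _ (hq.mem (by omega)), sub_self]

/-- Nodal values and rates of discrete solutions solve the discrete system. -/
theorem Standing.exists_isDiscrete_of_discreteSolution (hB : B.Standing) (h1 : B.A1) (h2 : B.A2)
    (h3 : B.A3) (h4 : B.A4) (htime : t₀ < tf) {S : ImplicitSystem B.State} (hP : S.P = B.momentum)
    (hQ : S.Q = B.force) {p₀ v₀ : B.State} {p : ℝ → B.State}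
    (hp : B.DiscreteSolution Θ p₀ v₀ p) :
    ∃ y v : ℕ → B.admissible, (S.restrict B.admissible).IsDiscrete Θ y v ∧
      (∀ i ≤ Θ.N, (y i : B.State) = p (Θ.t i)) ∧ (∀ i < Θ.N, (v i : B.State) = Θ.rate p i) ∧
      (y 0 : B.State) = p₀ ∧ (v 0 : B.State) = v₀ := by
  classical
  obtain ⟨hY, hpr, hp₀, hv₀⟩ := hp
  -- The sequences take values in the subspace for every index; 0 is only a default where
  -- admissibility may fail, and indices within the time set never use it.
  let y : ℕ → B.admissible := fun i => if h : p (Θ.t i) ∈ B.admissible then ⟨_, h⟩ else 0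
  let v : ℕ → B.admissible := fun i => if h : Θ.rate p i ∈ B.admissible then ⟨_, h⟩ else 0
  have hy : ∀ i ≤ Θ.N, (y i : B.State) = p (Θ.t i) := fun i hi => by
    simp only [y, dif_pos (hY.mem hi)]
  have hv : ∀ i < Θ.N, (v i : B.State) = Θ.rate p i := fun i hi => by
    simp only [v, dif_pos (hY.rate_mem hi)]
  have hN := Θ.N_pos htime
  refine ⟨y, v, ⟨fun i hi => ?_, fun i hi => ?_⟩, hy, hv, ?_, ?_⟩
  · refine Subtype.ext ?_
    rw [Submodule.coe_add, Submodule.coe_smul, hy _ hi, hy _ hi.le, hv _ hi, Θ.step_smul_rate p hi,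
      add_sub_cancel]
  · refine ContinuousLinearMap.ext fun s => ?_
    have h5 := (hB.discretePrinciple_iff_recurrence h1 h2 h3 h4 htime p).1 hpr i hi s s.2
    rw [← hy _ hi.le, ← hv _ hi, ← hy i (by omega), ← hv i (by omega), ← hP, ← hQ] at h5
    exact h5
  · rw [hy 0 hN.le, Θ.t_zero, hp₀]
  · rw [hv 0 hN, ← hv₀, Θ.velocity_t_zero htime]

/-- The interpolation of a solution of the discrete system is a discrete solution. -/
theorem Standing.discreteSolution_interp (hB : B.Standing) (h1 : B.A1) (h2 : B.A2)
    (h3 : B.A3) (h4 : B.A4) (htime : t₀ < tf) {S : ImplicitSystem B.State} (hP : S.P = B.momentum)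
    (hQ : S.Q = B.force) {y v : ℕ → B.admissible}
    (hd : (S.restrict B.admissible).IsDiscrete Θ y v) :
    B.DiscreteSolution Θ (y 0) (v 0)
      (Θ.interp (y 0 : B.State) fun i => (v i : B.State)) := by
  have hyv : ∀ i < Θ.N, (y (i + 1) : B.State) = y i + Θ.step i • (v i : B.State) := fun i hi => by
    rw [hd.1 i hi]
    rfl
  have hN := Θ.N_pos htime
  refine ⟨inY_interp (y := fun i => (y i : B.State)) hyv (y 0).2 fun i _ => (v i).2, ?_, ?_, ?_⟩
  · refine (hB.discretePrinciple_iff_recurrence h1 h2 h3 h4 htime _).2 fun i hi s hs => ?_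
    rw [Θ.interp_t (y := fun i => (y i : B.State)) hyv hi.le,
      Θ.interp_t (y := fun i => (y i : B.State)) hyv (show i ≤ Θ.N by omega),
      Θ.rate_interp (y := fun i => (y i : B.State)) hyv hi,
      Θ.rate_interp (y := fun i => (y i : B.State)) hyv (show i < Θ.N by omega), ← hP, ← hQ]
    exact congrArg (fun g => g ⟨s, hs⟩) (hd.2 i hi)
  · have h5 := Θ.interp_t (y := fun i => (y i : B.State)) hyv (Nat.zero_le _)
    rwa [Θ.t_zero] at h5
  · rw [Θ.velocity_t_zero htime, Θ.rate_interp (y := fun i => (y i : B.State)) hyv hN]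

/-- Existence and uniqueness of discrete solutions for small time steps. -/
theorem Standing.exists_unique_discreteSolution (hB : B.Standing) (h1 : B.A1) (h2 : B.A2)
    (h3 : B.A3) (h4 : B.A4) (htime : t₀ < tf) {S : ImplicitSystem B.State} (hP : S.P = B.momentum)
    (hQ : S.Q = B.force) (hΘ : Θ.size * S.L < S.c) {p₀ v₀ : B.State}
    (hp₀ : B.Admissible p₀) (hv₀ : B.Admissible v₀) :
    ∃ p : ℝ → B.State, B.DiscreteSolution Θ p₀ v₀ p ∧
      ∀ q : ℝ → B.State, B.DiscreteSolution Θ p₀ v₀ q → EqOn q p (Icc t₀ tf) := by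
  obtain ⟨y, v, hd, hy0, hv0⟩ := (S.restrict B.admissible).exists_isDiscrete Θ hΘ
    ⟨p₀, hp₀⟩ ⟨v₀, hv₀⟩
  have hsol := hB.discreteSolution_interp h1 h2 h3 h4 htime hP hQ hd
  refine ⟨_, ⟨hsol.1, hsol.2.1, hsol.2.2.1.trans (congrArg Subtype.val hy0),
    hsol.2.2.2.trans (congrArg Subtype.val hv0)⟩, fun q hq t ht => ?_⟩
  obtain ⟨y', v', hd', hy', hv', hy0', hv0'⟩ :=
    hB.exists_isDiscrete_of_discreteSolution h1 h2 h3 h4 htime hP hQ hq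
  obtain ⟨i, hi, hti⟩ := Θ.exists_mem_Icc_step htime ht
  -- Both functions are affine on the cell of `t`, so equality of the value and slope at its left
  -- node suffices.
  obtain ⟨e1, e2⟩ := hd.eq (S.restrict B.admissible) hΘ hd'
    (by rw [hy0]; exact Subtype.ext hy0'.symm)
    (by rw [hv0]; exact Subtype.ext hv0'.symm) hi
  rw [hq.1.1 i hi t hti, Θ.interp_eq (y := fun i => (y i : B.State))
    (fun i hi => by rw [hd.1 i hi]; rfl) hi hti, ← hy' i hi.le, ← hv' i hi, e1, e2]

end Body

/-! ### Weak derivatives and `H¹₀` test functions in time -/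

section Sobolev

variable {F : Type*} [NormedAddCommGroup F] [NormedSpace ℝ F] {t₀ tf : ℝ}

theorem hasDerivAt_of_eq_add_integral [CompleteSpace F] {f g : ℝ → F} (hg : Continuous g)
    (h : ∀ t ∈ Icc t₀ tf, f t = f t₀ + ∫ s in t₀..t, g s) {t : ℝ} (ht : t ∈ Ioo t₀ tf) :
    HasDerivAt f (g t) t := by
  have h1 : HasDerivAt (fun t => f t₀ + ∫ s in t₀..t, g s) (g t) t :=
    (intervalIntegral.integral_hasDerivAt_right (hg.intervalIntegrable _ _)
      (hg.stronglyMeasurableAtFilter _ _) hg.continuousAt).const_add _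
  refine h1.congr_of_eventuallyEq ?_
  filter_upwards [Icc_mem_nhds ht.1 ht.2] with s hs using h s hs

theorem eq_zero_of_tsupport_subset {G : Type*} [Zero G] {ψ : ℝ → G} (h : tsupport ψ ⊆ Ioo t₀ tf)
    {t : ℝ} (ht : t ∉ Ioo t₀ tf) : ψ t = 0 :=
  image_eq_zero_of_notMem_tsupport fun h' => ht (h h')

theorem integrable_clm_apply_restrict {π : ℝ → F →L[ℝ] ℝ} (hπ : Continuous π) {φ : ℝ → F}
    (hφ : MemLp φ 2 (volume.restrict (Ioo t₀ tf))) :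
    Integrable (fun t => π t (φ t)) (volume.restrict (Ioo t₀ tf)) := by
  obtain ⟨M, hM⟩ := isCompact_Icc.exists_bound_of_continuousOn (hπ.continuousOn (s := Icc t₀ tf))
  have h1 : Integrable φ (volume.restrict (Ioo t₀ tf)) := hφ.integrable one_le_two
  refine (h1.norm.const_mul M).mono'
    (isBoundedBilinearMap_apply.continuous.comp_aestronglyMeasurable
      (hπ.aestronglyMeasurable.prodMk hφ.1)) ?_
  filter_upwards [ae_restrict_mem measurableSet_Ioo] with t ht
  exact (ContinuousLinearMap.le_opNorm _ _).trans
    (mul_le_mul_of_nonneg_right (hM t (Ioo_subset_Icc_self ht)) (norm_nonneg _))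

/-- On a bounded interval `L²` convergence implies `L¹` convergence by Hölder, and `π` is bounded on
the closed interval. -/
theorem tendsto_integral_clm_apply {π : ℝ → F →L[ℝ] ℝ} (hπ : Continuous π) {φ : ℝ → F}
    {ψ : ℕ → ℝ → F} (hφ : MemLp φ 2 (volume.restrict (Ioo t₀ tf)))
    (hψ : ∀ j, MemLp (ψ j) 2 (volume.restrict (Ioo t₀ tf)))
    (h : Tendsto (fun j => eLpNorm (fun t => ψ j t - φ t) 2 (volume.restrict (Ioo t₀ tf)))
      atTop (𝓝 0)) :
    Tendsto (fun j => ∫ t in Ioo t₀ tf, π t (ψ j t)) atTop (𝓝 (∫ t in Ioo t₀ tf, π t (φ t))) := by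
  obtain ⟨M, hM⟩ := isCompact_Icc.exists_bound_of_continuousOn (hπ.continuousOn (s := Icc t₀ tf))
  refine tendsto_integral_of_L1' _ (integrable_clm_apply_restrict hπ hφ).1
    (Eventually.of_forall fun j => integrable_clm_apply_restrict hπ (hψ j)) ?_
  have hvol : volume.restrict (Ioo t₀ tf) univ ≠ ⊤ := measure_ne_top _ _
  set V := volume.restrict (Ioo t₀ tf) univ ^ (1 / (1 : ℝ≥0∞).toReal - 1 / (2 : ℝ≥0∞).toReal)
  have hV : V ≠ ⊤ := ENNReal.rpow_ne_top_of_nonneg (by norm_num) hvol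
  have h0 : Tendsto (fun j => M.toNNReal • (eLpNorm (fun t => ψ j t - φ t) 2
      (volume.restrict (Ioo t₀ tf)) * V)) atTop (𝓝 0) := by
    have h2 := ENNReal.Tendsto.const_mul (a := (M.toNNReal : ℝ≥0∞))
      (ENNReal.Tendsto.mul_const (b := V) h (Or.inr hV)) (Or.inr ENNReal.coe_ne_top)
    simpa [ENNReal.smul_def] using h2
  refine tendsto_of_tendsto_of_tendsto_of_le_of_le tendsto_const_nhds h0 (fun _ => zero_le)
    fun j => ?_
  have h3 : eLpNorm ((fun t => π t (ψ j t)) - fun t => π t (φ t)) 1 (volume.restrict (Ioo t₀ tf))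
      ≤ M.toNNReal • eLpNorm (fun t => ψ j t - φ t) 1 (volume.restrict (Ioo t₀ tf)) := by
    refine eLpNorm_le_nnreal_smul_eLpNorm_of_ae_le_mul ?_ 1
    filter_upwards [ae_restrict_mem measurableSet_Ioo] with t ht
    rw [Pi.sub_apply, ← map_sub, ← NNReal.coe_le_coe, NNReal.coe_mul, coe_nnnorm, coe_nnnorm]
    exact (ContinuousLinearMap.le_opNorm _ _).trans (mul_le_mul_of_nonneg_right
      ((hM t (Ioo_subset_Icc_self ht)).trans (Real.le_coe_toNNReal M)) (norm_nonneg _))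
  refine h3.trans ?_
  gcongr
  exact eLpNorm_le_eLpNorm_mul_rpow_measure_univ one_le_two ((hψ j).1.sub hφ.1)

/-- Weak form, tested against smooth functions, of the equation `π' = q`. -/
theorem integral_deriv_eq_neg_of_smooth {π q : ℝ → F →L[ℝ] ℝ} (htime : t₀ < tf)
    (hπ : Continuous π) (hq : Continuous q)
    (h : ∀ t ∈ Icc t₀ tf, π t = π t₀ + ∫ s in t₀..t, q s) {ψ : ℝ → F} (hψ : ContDiff ℝ ∞ ψ)
    (hsupp : tsupport ψ ⊆ Ioo t₀ tf) :
    ∫ t in Ioo t₀ tf, π t (deriv ψ t) = - ∫ t in Ioo t₀ tf, q t (ψ t) := by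
  have hψ' : Continuous (deriv ψ) := hψ.continuous_deriv (by simp)
  have hψd : Differentiable ℝ ψ := hψ.differentiable (by simp)
  have c1 : Continuous fun t => q t (ψ t) := hq.clm_apply hψ.continuous
  have c2 : Continuous fun t => π t (deriv ψ t) := hπ.clm_apply hψ'
  have h1 := intervalIntegral.integral_eq_sub_of_hasDerivAt_of_le htime.le
    (f := fun t => π t (ψ t)) (f' := fun t => q t (ψ t) + π t (deriv ψ t))
    (hπ.clm_apply hψ.continuous).continuousOn
    (fun t ht => (hasDerivAt_of_eq_add_integral hq h ht).clm_apply (hψd t).hasDerivAt)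
    ((c1.add c2).intervalIntegrable _ _)
  rw [intervalIntegral.integral_add (c1.intervalIntegrable _ _) (c2.intervalIntegrable _ _),
    eq_zero_of_tsupport_subset hsupp (t := tf) (by simp),
    eq_zero_of_tsupport_subset hsupp (t := t₀) (by simp), map_zero, map_zero, sub_zero,
    intervalIntegral.integral_of_le htime.le, intervalIntegral.integral_of_le htime.le,
    integral_Ioc_eq_integral_Ioo, integral_Ioc_eq_integral_Ioo] at h1
  linarith

/-- Weak form, tested against `H¹₀`, of the equation `π' = q`. -/
theorem MemH10.integral_eq_neg {π q : ℝ → F →L[ℝ] ℝ} (htime : t₀ < tf)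
    (hπ : Continuous π) (hq : Continuous q)
    (h : ∀ t ∈ Icc t₀ tf, π t = π t₀ + ∫ s in t₀..t, q s) {φ φ' : ℝ → F}
    (hφ : MemH10 t₀ tf φ φ') :
    ∫ t in Ioo t₀ tf, π t (φ' t) = - ∫ t in Ioo t₀ tf, q t (φ t) := by
  obtain ⟨m, m', ψ, hψ, l, l'⟩ := hφ
  have b : ∀ {f : ℝ → F}, Continuous f → HasCompactSupport f →
      MemLp f 2 (volume.restrict (Ioo t₀ tf)) := fun hf hf' => hf.memLp_of_hasCompactSupport hf'
  have h1 := tendsto_integral_clm_apply hπ m'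
    (fun j => b ((hψ j).1.continuous_deriv (by simp)) (hψ j).2.1.deriv) l'
  have h2 := (tendsto_integral_clm_apply hq m
    (fun j => b (hψ j).1.continuous (hψ j).2.1) l).neg
  refine tendsto_nhds_unique h1 (h2.congr fun j => ?_)
  exact (integral_deriv_eq_neg_of_smooth htime hπ hq h (hψ j).1 (hψ j).2.2).symm

variable [FiniteDimensional ℝ F]

/-- Lipschitz functions are weakly differentiable. -/
theorem isWeakDeriv_of_lipschitz {C : NNReal} {f : ℝ → F} (hf : LipschitzWith C f) :
    IsWeakDeriv t₀ tf f (deriv f) := by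
  have : CompleteSpace F := FiniteDimensional.complete ℝ F
  have : ProperSpace F := FiniteDimensional.proper ℝ F
  intro ψ hψ hc hsupp
  obtain ⟨D, hD⟩ := hψ.lipschitzWith_of_hasCompactSupport hc (by simp)
  have hb : ∀ s, ‖deriv f s‖ ≤ C := fun s => norm_deriv_le_of_lipschitz hf
  have i1 : IntegrableOn (fun t => deriv ψ t • f t) (Ioo t₀ tf) :=
    (((hψ.continuous_deriv (by simp)).smul hf.continuous).continuousOn.integrableOn_compact
      isCompact_Icc).mono_set Ioo_subset_Icc_self
  have i2 : IntegrableOn (fun t => ψ t • deriv f t) (Ioo t₀ tf) := by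
    have h1 : Integrable (fun t => C * ‖ψ t‖) (volume.restrict (Ioo t₀ tf)) :=
      ((hψ.continuous.integrable_of_hasCompactSupport hc).norm.const_mul _).restrict
    refine h1.mono' (hψ.continuous.aestronglyMeasurable.smul
      (stronglyMeasurable_deriv f).aestronglyMeasurable) (Eventually.of_forall fun t => ?_)
    rw [norm_smul, mul_comm]
    exact mul_le_mul_of_nonneg_right (hb t) (norm_nonneg _)
  -- Linear functionals reduce the identity to real-valued Lipschitz functions, for which
  -- integration by parts against a compactly supported Lipschitz function is applied in the
  -- direction 1.
  refine (SeparatingDual.eq_iff_forall_dual_eq (R := ℝ)).2 fun ℓ => ?_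
  have hℓ : LipschitzWith (‖ℓ‖₊ * C) (fun t => ℓ (f t)) := ℓ.lipschitz.comp hf
  have h1 := hℓ.integral_lineDeriv_mul_eq hD hc (1 : ℝ) (μ := volume)
  have h2 : ∀ g : ℝ → ℝ, ∀ t c, lineDeriv ℝ g t c = c * deriv g t := by
    intro g t c
    have h3 := deriv_comp_mul_left c (fun s => g (t + s)) 0
    rw [deriv_comp_const_add] at h3
    simpa [lineDeriv, mul_comm] using h3
  have h4 : ∀ᵐ t, deriv (fun t => ℓ (f t)) t = ℓ (deriv f t) := by
    filter_upwards [hf.ae_differentiableAt_real] with t ht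
    exact (ℓ.hasFDerivAt.comp_hasDerivAt t ht.hasDerivAt).deriv
  have e1 : ∫ t, lineDeriv ℝ (fun t => ℓ (f t)) t 1 * ψ t =
      ∫ t in Ioo t₀ tf, ψ t * ℓ (deriv f t) := by
    rw [setIntegral_eq_integral_of_forall_compl_eq_zero fun t ht => by
      rw [eq_zero_of_tsupport_subset hsupp ht, zero_mul]]
    refine integral_congr_ae ?_
    filter_upwards [h4] with t ht
    rw [h2, ht, one_mul, mul_comm]
  have e2 : ∫ t, lineDeriv ℝ ψ t (-1) * ℓ (f t) =
      - ∫ t in Ioo t₀ tf, deriv ψ t * ℓ (f t) := by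
    rw [setIntegral_eq_integral_of_forall_compl_eq_zero fun t ht => by
      rw [eq_zero_of_tsupport_subset ((tsupport_deriv_subset ..).trans hsupp) ht, zero_mul],
      ← integral_neg]
    refine integral_congr_ae (Eventually.of_forall fun t => ?_)
    simp only [h2]
    ring
  rw [e1, e2] at h1
  rw [map_neg, ← ℓ.integral_comp_comm i1, ← ℓ.integral_comp_comm i2]
  simp only [map_smul, smul_eq_mul]
  linarith

/-- Inside the interval the derivative of `x` is `v`, by the integral equation; the second weak
derivative is `deriv v`, bounded by the Lipschitz constant of `v`. -/
theorem memW2Inf_of_lipschitz {C : NNReal} {x v : ℝ → F} (hx : LipschitzWith C x)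
    (hv : LipschitzWith C v) (h : ∀ t ∈ Icc t₀ tf, x t = x t₀ + ∫ s in t₀..t, v s) :
    MemW2Inf t₀ tf x v := by
  have : CompleteSpace F := FiniteDimensional.complete ℝ F
  have hm : ∀ {f : ℝ → F}, Continuous f → MemLp f ⊤ (volume.restrict (Ioo t₀ tf)) := by
    intro f hf
    obtain ⟨M, hM⟩ := isCompact_Icc.exists_bound_of_continuousOn (hf.continuousOn (s := Icc t₀ tf))
    refine memLp_top_of_bound hf.aestronglyMeasurable M ?_
    filter_upwards [ae_restrict_mem measurableSet_Ioo] with t ht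
      using hM t (Ioo_subset_Icc_self ht)
  refine ⟨hm hx.continuous, hm hv.continuous, fun ψ hψ hc hs => ?_, deriv v,
    memLp_top_of_bound (stronglyMeasurable_deriv v).aestronglyMeasurable C
      (Eventually.of_forall fun t => norm_deriv_le_of_lipschitz hv), isWeakDeriv_of_lipschitz hv⟩
  rw [isWeakDeriv_of_lipschitz hx ψ hψ hc hs]
  congr 1
  refine setIntegral_congr_fun measurableSet_Ioo fun t ht => ?_
  rw [(hasDerivAt_of_eq_add_integral hv.continuous h ht).deriv]

end Sobolev

/-- Weak form of the equation `P(z)' = Q(z)`, tested with functions of values in a subspace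
parametrized by `J`. -/
theorem ImplicitSystem.weak_form {E F : Type*} [NormedAddCommGroup E] [NormedSpace ℝ E]
    [NormedAddCommGroup F] [NormedSpace ℝ F] (S : ImplicitSystem E) {t₀ tf : ℝ} (htime : t₀ < tf)
    {z : ℝ → E × E} (hz : Continuous z)
    (h : ∀ t ∈ Icc t₀ tf, S.P (z t) = S.P (z t₀) + ∫ s in t₀..t, S.Q (z s)) (J : F →L[ℝ] E)
    {φ φ' : ℝ → F} (hφ : MemH10 t₀ tf φ φ') :
    ∫ t in Ioo t₀ tf, S.P (z t) (J (φ' t)) = - ∫ t in Ioo t₀ tf, S.Q (z t) (J (φ t)) := by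
  have hQ : Continuous fun t => S.Q (z t) := S.continuous_Q.comp hz
  have hP : Continuous fun t => S.P (z t) := S.continuous_P.comp hz
  refine hφ.integral_eq_neg (π := fun t => (S.P (z t)).comp J) (q := fun t => (S.Q (z t)).comp J)
    htime (hP.clm_comp continuous_const) (hQ.clm_comp continuous_const) fun t ht => ?_
  have h1 := ((ContinuousLinearMap.compL ℝ F E ℝ).flip J).intervalIntegral_comp_comm
    (hQ.intervalIntegrable (μ := volume) t₀ t)
  simp only [ContinuousLinearMap.flip_apply, ContinuousLinearMap.compL_apply] at h1
  rw [h1, h t ht, ContinuousLinearMap.add_comp]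

/-! ### The semi-discrete equations at the free nodes -/

namespace Body

variable {d k : ℕ} {B : Body d k} {t₀ tf : ℝ}

open Classical in
/-- The inclusion of the displacements of a free node in the admissible states. -/
def singleInl (a : B.Node) (ha : (a : Vec d) ∉ B.displacementSet) : Vec d →L[ℝ] B.admissible :=
  ((ContinuousLinearMap.inl ℝ (B.Node → Vec d) (B.Node → Vec k)).comp
    (ContinuousLinearMap.single ℝ (fun _ : B.Node => Vec d) a)).codRestrict B.admissible
      fun ξ => single_inl_mem_admissible ha ξ

open Classical in
/-- The inclusion of the descriptors of a free node in the admissible states. -/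
def singleInr (a : B.Node) (ha : (a : Vec d) ∉ B.descriptorSet) : Vec k →L[ℝ] B.admissible :=
  ((ContinuousLinearMap.inr ℝ (B.Node → Vec d) (B.Node → Vec k)).comp
    (ContinuousLinearMap.single ℝ (fun _ : B.Node => Vec k) a)).codRestrict B.admissible
      fun ξ => single_inr_mem_admissible ha ξ

open Classical in
/-- Solutions of the implicit system satisfy the semi-discrete equations. -/
theorem Standing.semiDiscreteSolution (hB : B.Standing) (h1 : B.A1) (h2 : B.A2) (h3 : B.A3)
    (h4 : B.A4) (htime : t₀ < tf) {S : ImplicitSystem B.State} (hP : S.P = B.momentum)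
    (hQ : S.Q = B.force) {z : ℝ → B.admissible × B.admissible} (hz : Continuous z)
    (h : ∀ t ∈ Icc t₀ tf, (S.restrict B.admissible).P (z t) =
      (S.restrict B.admissible).P (z t₀) + ∫ s in t₀..t, (S.restrict B.admissible).Q (z s)) :
    B.SemiDiscreteSolution t₀ tf (fun t => ((z t).1 : B.State)) (fun t => ((z t).2 : B.State)) := by
  have hPa : ∀ t s, (S.restrict B.admissible).P (z t) s
      = B.momentum ((z t).1, (z t).2) s := fun t s => by rw [← hP]; rfl
  have hQa : ∀ t s, (S.restrict B.admissible).Q (z t) s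
      = B.force ((z t).1, (z t).2) s := fun t s => by rw [← hQ]; rfl
  refine ⟨fun t _ => (z t).1.2, fun a ha φ φ' hφ => ?_, fun a ha φ φ' hφ => ?_⟩
  · have h5 := (S.restrict B.admissible).weak_form htime hz h (singleInl a ha) hφ
    rw [← integral_neg] at h5
    simp only [hPa, hQa] at h5
    have e1 : ∀ t, B.momentum ((z t).1, (z t).2) (singleInl a ha (φ' t))
        = B.mass a * inner ℝ ((z t).2.1.1 a) (φ' t) := fun t => momentum_inl_single _ a _
    have e2 : ∀ t, B.force ((z t).1, (z t).2) (singleInl a ha (φ t))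
        = - B.loadU a (z t).1 (φ t) := fun t => hB.force_inl_single h1 h2 h3 _ a _
    simp only [e1, e2, neg_neg] at h5
    exact h5
  · have h5 := (S.restrict B.admissible).weak_form htime hz h (singleInr a ha) hφ
    simp only [hPa, hQa] at h5
    have e1 : ∀ t, B.momentum ((z t).1, (z t).2) (singleInr a ha (φ' t))
        = ∫ x in B.domain, B.dchiRate (B.field (z t).1.1.2 x) (B.field (z t).2.1.2 x)
          (B.shape a x • φ' t) := fun t => hB.momentum_inr_single h4 _ a _
    have e2 : ∀ t, B.force ((z t).1, (z t).2) (singleInr a ha (φ t))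
        = (∫ x in B.domain, B.dchiNu (B.field (z t).1.1.2 x) (B.field (z t).2.1.2 x)
            (B.shape a x • φ t))
          + B.eta * inner ℝ ((z t).2.1.2 a) (φ t) - B.loadNu a (z t).1 (φ t) :=
      fun t => hB.force_inr_single h1 h2 h4 _ a _
    have hD : Continuous B.coenergyD := continuous_integralFDeriv h4.contDiff_one hB.memLp_pairCLM
    have i1 : Integrable (fun t => ∫ x in B.domain,
        B.dchiNu (B.field (z t).1.1.2 x) (B.field (z t).2.1.2 x) (B.shape a x • φ t))
        (volume.restrict (Ioo t₀ tf)) := by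
      have h6 := integrable_clm_apply_restrict (π := fun t =>
        (B.coenergyD ((z t).1.1.2, (z t).2.1.2)).comp
          ((ContinuousLinearMap.inl ℝ (B.Node → Vec k) (B.Node → Vec k)).comp
            (ContinuousLinearMap.single ℝ (fun _ : B.Node => Vec k) a)))
        ((hD.comp (by fun_prop)).clm_comp continuous_const) hφ.1
      refine h6.congr (Eventually.of_forall fun t => ?_)
      exact hB.coenergyD_inl_single h4 _ a _
    have i2 : Integrable (fun t => B.eta * inner ℝ ((z t).2.1.2 a) (φ t))
        (volume.restrict (Ioo t₀ tf)) := by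
      refine Integrable.const_mul ?_ _
      exact integrable_clm_apply_restrict (π := fun t => innerSL ℝ ((z t).2.1.2 a))
        ((innerSL ℝ).continuous.comp (by fun_prop)) hφ.1
    -- The load is the sum of the co-energy and dissipation terms minus the force, all of which are
    -- known to be integrable in time.
    have i3 : Integrable (fun t => B.loadNu a (z t).1 (φ t)) (volume.restrict (Ioo t₀ tf)) := by
      have h6 := integrable_clm_apply_restrict (π := fun t =>
        ((S.restrict B.admissible).Q (z t)).comp (singleInr a ha))
        (((S.restrict B.admissible).continuous_Q.comp hz).clm_comp continuous_const) hφ.1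
      refine ((i1.add i2).sub h6).congr (Eventually.of_forall fun t => ?_)
      simp only [Pi.sub_apply, Pi.add_apply, ContinuousLinearMap.comp_apply, hQa, e2]
      ring
    simp only [e1, e2] at h5
    have e3 := integral_sub (i1.add i2) i3
    have e4 := integral_add i1 i2
    rw [integral_const_mul] at e4
    simp only [Pi.add_apply] at e3
    rw [e3, e4] at h5
    linarith

end Body

/-! ### From nodal convergence to convergence of trajectories and velocities -/

section Convergence

variable {F : Type*} [NormedAddCommGroup F] [NormedSpace ℝ F] {t₀ tf : ℝ}
  {Θ : ℕ → TimeSet t₀ tf}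

/-- Uniform convergence of piecewise affine functions with convergent nodal values and slopes. -/
theorem NodalLimit.tendstoUniformlyOn (htime : t₀ < tf)
    (hsize : Tendsto (fun n => (Θ n).size) atTop (𝓝 0)) {y v : ℕ → ℕ → F} {x w : ℝ → F}
    (hy : NodalLimit Θ y x) (hv : NodalLimit Θ v w) (hw : Continuous w) {p : ℕ → ℝ → F}
    (hp : ∀ᶠ n in atTop, ∀ i < (Θ n).N, ∀ t ∈ Icc ((Θ n).t i) ((Θ n).t (i + 1)),
      p n t = y n i + (t - (Θ n).t i) • v n i) :
    TendstoUniformlyOn p x atTop (Icc t₀ tf) := by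
  obtain ⟨M, hM⟩ := isCompact_Icc.exists_bound_of_continuousOn (hw.continuousOn (s := Icc t₀ tf))
  have hM0 : 0 ≤ M := (norm_nonneg _).trans (hM t₀ (left_mem_Icc.2 htime.le))
  have hs : Tendsto (fun n => (Θ n).size * (M + 1)) atTop (𝓝 0) := by
    simpa using hsize.mul_const (M + 1)
  refine Metric.tendstoUniformlyOn_iff.2 fun ε hε => ?_
  filter_upwards [hy (ε / 4) (by positivity), hv 1 one_pos, hp,
    hs.eventually_le_const (show (0 : ℝ) < ε / 4 by positivity)] with n h1 h2 h3 h4 t ht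
  obtain ⟨i, hi, hti⟩ := (Θ n).exists_mem_Icc_step htime ht
  -- Slopes within distance 1 of the bounded limit are bounded, so within a cell the trajectory
  -- moves by at most a multiple of the step.
  have h5 : ‖v n i‖ ≤ M + 1 :=
    calc ‖v n i‖ = ‖w t + (v n i - w t)‖ := by rw [add_sub_cancel]
      _ ≤ M + 1 := (norm_add_le _ _).trans (add_le_add (hM t ht) (h2 i hi t hti))
  have h6 : ‖(t - (Θ n).t i) • v n i‖ ≤ ε / 4 := by
    rw [norm_smul, Real.norm_of_nonneg (sub_nonneg.2 hti.1)]
    refine (mul_le_mul ?_ h5 (norm_nonneg _) (Θ n).size_nonneg).trans h4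
    exact (sub_le_sub_right hti.2 _).trans ((Θ n).step_le_size hi)
  rw [dist_comm, dist_eq_norm, h3 i hi t hti, add_sub_right_comm]
  linarith [norm_add_le (y n i - x t) ((t - (Θ n).t i) • v n i), h1 i hi t hti]

/-- Convergence in `Lʳ` of piecewise constant velocities with convergent nodal values. -/
theorem NodalLimit.tendsto_eLpNorm_velocity {v : ℕ → ℕ → F} {w : ℝ → F} (hv : NodalLimit Θ v w)
    {p : ℕ → ℝ → F} (hp : ∀ᶠ n in atTop, ∀ i < (Θ n).N, v n i = (Θ n).rate (p n) i) (r : ℝ≥0∞) :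
    Tendsto (fun n => eLpNorm (fun t => (Θ n).velocity (p n) t - w t) r
      (volume.restrict (Ioo t₀ tf))) atTop (𝓝 0) := by
  set μ := volume.restrict (Ioo t₀ tf)
  have hμ : μ univ ^ r.toReal⁻¹ ≠ ⊤ :=
    ENNReal.rpow_ne_top_of_nonneg (by positivity) (measure_ne_top _ _)
  -- A pointwise bound `ε` gives the `Lʳ` bound `μ univ ^ (1 / r) * ε`; for `r = ⊤` the exponent is
  -- 0 by convention, so no case distinction arises.
  have hlim : Tendsto (fun ε : ℝ => μ univ ^ r.toReal⁻¹ * ENNReal.ofReal ε) (𝓝[>] 0) (𝓝 0) := by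
    have h1 : Tendsto ENNReal.ofReal (𝓝[>] 0) (𝓝 (ENNReal.ofReal 0)) :=
      (ENNReal.continuous_ofReal.tendsto 0).mono_left nhdsWithin_le_nhds
    simpa using ENNReal.Tendsto.const_mul (a := μ univ ^ r.toReal⁻¹) h1 (Or.inr hμ)
  refine ENNReal.tendsto_nhds_zero.2 fun δ hδ => ?_
  obtain ⟨ε, hε, hε0⟩ := ((hlim.eventually_le_const hδ).and self_mem_nhdsWithin).exists
  filter_upwards [hv ε hε0, hp] with n h1 h2
  refine (eLpNorm_le_of_ae_bound (C := ε) ?_).trans hε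
  filter_upwards [ae_restrict_mem measurableSet_Ioo] with t ht
  obtain ⟨i, hi, hti⟩ := (Θ n).exists_mem_Ico_step (Ioo_subset_Ico_self ht)
  rw [(Θ n).velocity_eq _ hi hti, ← h2 i hi]
  exact h1 i hi t (Ico_subset_Icc_self hti)

end Convergence

namespace Body

variable {d k : ℕ} {B : Body d k} {t₀ tf : ℝ}

/-- Subsequential convergence of discrete solutions to a semi-discrete solution. -/
theorem Standing.exists_limit (hB : B.Standing) (h1 : B.A1) (h2 : B.A2) (h3 : B.A3)
    (h4 : B.A4) (htime : t₀ < tf) {S : ImplicitSystem B.State} (hP : S.P = B.momentum)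
    (hQ : S.Q = B.force) {Θ : ℕ → TimeSet t₀ tf}
    (hsize : Tendsto (fun n => (Θ n).size) atTop (𝓝 0)) {p₀ v₀ : ℕ → B.State} {M : ℝ}
    (hbound : ∀ n, ‖p₀ n‖ ≤ M ∧ ‖v₀ n‖ ≤ M) {p : ℕ → ℝ → B.State}
    (hp : ∀ᶠ n in atTop, B.DiscreteSolution (Θ n) (p₀ n) (v₀ n) (p n)) :
    ∃ (x v : ℝ → B.State) (σ : ℕ → ℕ), MemW2Inf t₀ tf x v ∧ B.SemiDiscreteSolution t₀ tf x v ∧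
      StrictMono σ ∧ TendstoUniformlyOn (fun j => p (σ j)) x atTop (Icc t₀ tf) ∧
      ∀ r : ℝ≥0∞, Tendsto (fun j => eLpNorm (fun t => (Θ (σ j)).velocity (p (σ j)) t - v t) r
        (volume.restrict (Ioo t₀ tf))) atTop (𝓝 0) := by
  have hex : ∀ n, ∃ y v : ℕ → B.admissible, B.DiscreteSolution (Θ n) (p₀ n) (v₀ n) (p n) →
      (S.restrict B.admissible).IsDiscrete (Θ n) y v ∧
      (∀ i ≤ (Θ n).N, (y i : B.State) = p n ((Θ n).t i)) ∧
      (∀ i < (Θ n).N, (v i : B.State) = (Θ n).rate (p n) i) ∧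
      (y 0 : B.State) = p₀ n ∧ (v 0 : B.State) = v₀ n := by
    intro n
    by_cases h : B.DiscreteSolution (Θ n) (p₀ n) (v₀ n) (p n)
    · obtain ⟨y, v, h'⟩ := hB.exists_isDiscrete_of_discreteSolution h1 h2 h3 h4 htime hP hQ h
      exact ⟨y, v, fun _ => h'⟩
    · exact ⟨0, 0, fun h' => absurd h' h⟩
  choose y v hyv using hex
  have hd : ∀ᶠ n in atTop, ‖y n 0‖ ≤ M ∧ ‖v n 0‖ ≤ M ∧
      (S.restrict B.admissible).IsDiscrete (Θ n) (y n) (v n) := by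
    filter_upwards [hp] with n hn
    obtain ⟨e1, -, -, e2, e3⟩ := hyv n hn
    refine ⟨?_, ?_, e1⟩
    · exact (congrArg norm e2).trans_le (hbound n).1
    · exact (congrArg norm e3).trans_le (hbound n).2
  obtain ⟨z, σ, C, hσ, hz, hlim, hx, hPQ⟩ :=
    (S.restrict B.admissible).exists_limit htime hsize hd
  have hz1 : Continuous fun t => ((z t).1 : B.State) := by have := hz.continuous; fun_prop
  have hz2 : Continuous fun t => ((z t).2 : B.State) := by have := hz.continuous; fun_prop
  have hl1 : NodalLimit (fun n => Θ (σ n)) (fun n i => (y (σ n) i : B.State))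
      (fun t => ((z t).1 : B.State)) :=
    hlim.comp (Ψ := fun e : B.admissible × B.admissible => (e.1 : B.State)) hz.continuous
      (by fun_prop)
  have hl2 : NodalLimit (fun n => Θ (σ n)) (fun n i => (v (σ n) i : B.State))
      (fun t => ((z t).2 : B.State)) :=
    hlim.comp (Ψ := fun e : B.admissible × B.admissible => (e.2 : B.State)) hz.continuous
      (by fun_prop)
  have hpσ := hσ.tendsto_atTop.eventually hp
  refine ⟨fun t => (z t).1, fun t => (z t).2, σ, ?_,
    hB.semiDiscreteSolution h1 h2 h3 h4 htime hP hQ hz.continuous hPQ, hσ, ?_, fun r => ?_⟩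
  · refine memW2Inf_of_lipschitz (C := C) ?_ ?_ fun t ht => ?_
    · exact LipschitzWith.of_dist_le_mul fun s t =>
        (le_max_left _ _).trans (hz.dist_le_mul s t)
    · exact LipschitzWith.of_dist_le_mul fun s t =>
        (le_max_right _ _).trans (hz.dist_le_mul s t)
    -- The integral equation holds in the admissible subspace; the inclusion commutes with the
    -- integral.
    · have e := B.admissible.subtypeL.intervalIntegral_comp_comm (μ := volume)
        ((continuous_snd.comp hz.continuous).intervalIntegrable t₀ t)
      have e' := congrArg (Subtype.val) (hx t ht)
      exact e'.trans (congrArg (fun b => ((z t₀).1 : B.State) + b) e.symm)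
  · refine hl1.tendstoUniformlyOn htime (hsize.comp hσ.tendsto_atTop) hl2 hz2 ?_
    filter_upwards [hpσ] with n hn i hi t ht
    obtain ⟨-, e1, e2, -, -⟩ := hyv (σ n) hn
    rw [hn.1.1 i hi t ht, e1 i hi.le, e2 i hi]
  · refine hl2.tendsto_eLpNorm_velocity ?_ r
    filter_upwards [hpσ] with n hn i hi
    exact (hyv (σ n) hn).2.2.1 i hi

end Body

end ComplexBody

end

/-! ### The main theorem -/

theorem theorem3 {d k : ℕ} (hd : 0 < d) (B : ComplexBody.Body d k) (hB : B.Standing)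
    (h1 : B.A1) (h2 : B.A2) (h3 : B.A3) (h4 : B.A4) (h5 : B.A5)
    {t₀ tf : ℝ} (htime : t₀ < tf)
    (Θ : ℕ → ComplexBody.TimeSet t₀ tf)
    (hsize : Filter.Tendsto (fun h => (Θ h).size) Filter.atTop (nhds 0))
    (p₀ v₀ : ℕ → B.State)
    (hp₀ : ∀ h, B.Admissible (p₀ h)) (hv₀ : ∀ h, B.Admissible (v₀ h))
    (hbound : ∃ C : ℝ, ∀ h,
      (Θ h).ratio + ‖(p₀ h).1‖ + ‖(p₀ h).2‖ + ‖(v₀ h).1‖ + ‖(v₀ h).2‖ ≤ C) :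
    -- existence and uniqueness of the discrete solution for large `h`
    (∃ H : ℕ, ∀ h ≥ H, ∃ p : ℝ → B.State,
      B.DiscreteSolution (Θ h) (p₀ h) (v₀ h) p ∧
      ∀ q : ℝ → B.State, B.DiscreteSolution (Θ h) (p₀ h) (v₀ h) q →
        Set.EqOn q p (Set.Icc t₀ tf)) ∧
    -- convergence of the discrete solutions up to a subsequence
    (∀ p : ℕ → ℝ → B.State,
      (∀ᶠ h in Filter.atTop, B.DiscreteSolution (Θ h) (p₀ h) (v₀ h) (p h)) →
      ∃ (x v : ℝ → B.State) (σ : ℕ → ℕ),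
        ComplexBody.MemW2Inf t₀ tf x v ∧
        B.SemiDiscreteSolution t₀ tf x v ∧
        StrictMono σ ∧
        TendstoUniformlyOn (fun j => p (σ j)) x Filter.atTop (Set.Icc t₀ tf) ∧
        ∀ r : ENNReal, 1 ≤ r → r ≠ ⊤ →
          Filter.Tendsto
            (fun j => MeasureTheory.eLpNorm
              (fun t => (Θ (σ j)).velocity (p (σ j)) t - v t) r
              (MeasureTheory.volume.restrict (Set.Ioo t₀ tf)))
            Filter.atTop (nhds 0)) := by
  obtain ⟨S, hP, hQ⟩ := hB.exists_system h1 h2 h4 h5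
  constructor
  -- Large `h` means that the largest step times `S.L` is below the monotonicity constant.
  · have hs : Tendsto (fun h => (Θ h).size * S.L) atTop (𝓝 0) := by
      simpa using hsize.mul_const S.L
    obtain ⟨H, hH⟩ := eventually_atTop.1 (hs.eventually_lt_const S.c_pos)
    exact ⟨H, fun h hh => hB.exists_unique_discreteSolution h1 h2 h3 h4 htime hP hQ (hH h hh)
      (hp₀ h) (hv₀ h)⟩
  · intro p hp
    obtain ⟨C, hC⟩ := hbound
    -- All summands in the assumed bound are nonnegative, so each one is at most `C`, and so is the
    -- maximum norm of a pair.
    have hM : ∀ h, ‖p₀ h‖ ≤ C ∧ ‖v₀ h‖ ≤ C := by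
      intro h
      have e1 := hC h
      have e2 := (Θ h).ratio_nonneg
      have e3 := norm_nonneg (p₀ h).1
      have e4 := norm_nonneg (p₀ h).2
      have e5 := norm_nonneg (v₀ h).1
      have e6 := norm_nonneg (v₀ h).2
      exact ⟨max_le (by linarith) (by linarith), max_le (by linarith) (by linarith)⟩
    obtain ⟨x, v, σ, hx, hxs, hσ, hu, hL⟩ := hB.exists_limit h1 h2 h3 h4 htime hP hQ hsize hM hp
    exact ⟨x, v, σ, hx, hxs, hσ, hu, fun r _ _ => hL r⟩
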